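/- Work in homotopy type theory, that is, in intensional Martin-Löf type theory with cumulative universes $\mathcal U_0:\mathcal U_1:\cdots$, function types $\prod$ (with judgmental $\beta$ and $\eta$), the types $\mathbf 0,\mathbf 1,\mathbb N,+,\Sigma$, path types $a=_A b$ with path induction, and the Univalence Axiom for every universe (the canonical map $(A=_{\mathcal U_i}B)\to(A\simeq B)$ is an equivalence), together with the following type formers, whose induction principles compute judgmentally on points and propositionally on the listed path constructors: - the one-step truncation $\{A\}$, the higher inductive type with constructors $f:A\to\{A\}$ and $e:\prod_{a,b:A}f(a)=f(b)$; - the propositional truncation $\|A\|$, the higher inductive type with constructors $|{-}|:A\to\|A\|$ and $\varepsilon:\prod_{x,y:\|A\|}x=y$; - for $n\ge 0$ the $n$-truncation $\|A\|_n$, an $n$-type with a map $|{-}|_n:A\to\|A\|_n$ and induction into families of $n$-types. Here a $(-2)$-type (contractible type) is a type $X$ with an element of $\sum_{x:X}\prod_{y:X}x=y$, an $(n+1)$-type is a type all of whose path types are $n$-types, a mere proposition is a $(-1)$-type, and a set is a $0$-type. A type $X$ is connected if $\|X\|_0$ is contractible and simply connected if $\|X\|_1$ is contractible. Write $\mathrm{ap}_f(p):f(a)=f(b)$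 for the action of $f$ on a path $p:a=b$, and $x\ne y$ for $(x=y)\to\mathbf 0$. Proposition 3.2. In this theory the following hold (that is, the corresponding closed types, quantified over $A:\mathcal U_i$, are inhabited) for every universe level $i$ and every type $A:\mathcal U_i$: 1. For all $a,b:A$ and every path $p:a=_A b$ we have $\mathrm{ap}_f(p)\ne e(a,b)$. 2. If $\|\{A\}\|_1$ is a set, then it is empty: $\text{is-set}(\|\{A\}\|_1)\to\|\{A\}\|_1\to\mathbf 0$. In particular, $\{A\}$ is not simply connected. 3. $\|\{A\}\|_0\simeq\|A\|$, hence $\|\{A\}\|_0$ is a mere proposition. In particular, if $A$ is inhabited (given an element of $A$, or merely of $\|A\|$), then $\{A\}$ is connected. -/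

import Mathlib

/-!
Homotopy type theory as a formal system: intensional Martin-Löf type theory with a cumulative
hierarchy of universes à la Russell, dependent function types with judgmental beta and eta, and
primitive constants for `0`, `1`, `ℕ`, `+`, `Σ`, path types, the one-step truncation `{A}`, the
propositional truncation `‖A‖`, the `n`-truncations `‖A‖_n` (`n ≥ 0`) and the univalence principle.
A statement of homotopy type theory is a closed type; it holds if the type has a closed inhabitant.
-/

namespace HoTT

/-- Primitive constants. The numbers `i`, `j` are universe levels: `i` is that of the type arguments,
`j` that of the motive of an induction principle. In `tr n i` and its companions,
`n` is the truncation level. -/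
inductive Const : Type
  | empty | emptyInd (j : ℕ)
  | unit | star | unitInd (j : ℕ)
  | nat | zero | succ | natInd (j : ℕ)
  | sum (i : ℕ) | inl (i : ℕ) | inr (i : ℕ) | sumInd (i j : ℕ)
  | sigma (i : ℕ) | pair (i : ℕ) | sigmaInd (i j : ℕ)
  | path (i : ℕ) | rfl (i : ℕ) | pathInd (i j : ℕ)
  | one (i : ℕ) | oneF (i : ℕ) | oneE (i : ℕ) | oneInd (i j : ℕ) | oneIndE (i j : ℕ)
  | ptr (i : ℕ) | ptrMk (i : ℕ) | ptrEps (i : ℕ) | ptrInd (i j : ℕ) | ptrIndEps (i j : ℕ)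
  | tr (n i : ℕ) | trMk (n i : ℕ) | trTrunc (n i : ℕ) | trInd (n i j : ℕ)
  | ua (i : ℕ)
  deriving DecidableEq

/-- Raw terms (types are terms), with de Bruijn indices. `pi A B` and `lam A b` bind one variable in
their second argument. -/
inductive Term : Type
  | var (n : ℕ)
  | univ (i : ℕ)
  | pi (A B : Term)
  | lam (A b : Term)
  | app (f a : Term)
  | const (c : Const)
  deriving DecidableEq

namespace Term

/-- Extension of a renaming under a binder. -/
def upRen (r : ℕ → ℕ) : ℕ → ℕ
  | 0 => 0
  | n + 1 => r n + 1

/-- Renaming of the free variables. -/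
def rename : Term → (ℕ → ℕ) → Term
  | var n, r => var (r n)
  | univ i, _ => univ i
  | pi A B, r => pi (A.rename r) (B.rename (upRen r))
  | lam A b, r => lam (A.rename r) (b.rename (upRen r))
  | app f a, r => app (f.rename r) (a.rename r)
  | const c, _ => const c

/-- Extension of a substitution under a binder. -/
def upSub (s : ℕ → Term) : ℕ → Term
  | 0 => var 0
  | n + 1 => (s n).rename Nat.succ

/-- Simultaneous capture-avoiding substitution. -/
def subst : Term → (ℕ → Term) → Term
  | var n, s => s n
  | univ i, _ => univ i
  | pi A B, s => pi (A.subst s) (B.subst (upSub s))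
  | lam A b, s => lam (A.subst s) (b.subst (upSub s))
  | app f a, s => app (f.subst s) (a.subst s)
  | const c, _ => const c

/-- The substitution replacing variable `0` by `a` and lowering the others. -/
def single (a : Term) : ℕ → Term
  | 0 => a
  | n + 1 => var n

/-- `b.inst a` is `b[a/x]`, where `x` is the variable with index `0`. -/
def inst (b a : Term) : Term := b.subst (single a)

/-- Weakening by one variable. -/
def shift (t : Term) : Term := t.rename Nat.succ

/-- A constant applied to a list of arguments. -/
def call (c : Const) (args : List Term) : Term := args.foldl app (const c)

end Term

/-! ### Writing terms with named bound variables

A `Tm` is a term that is given at each number of enclosing binders (de Bruijn level). The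
binders `Pi` and `Lam` hand the bound variable to a Lean function, so that terms can be written
with ordinary variable names. The raw closed term is the value at `0`. -/

/-- A term depending on the number of enclosing binders. -/
abbrev Tm : Type := ℕ → Term

/-- The variable bound by the binder that stands under `d` other binders. -/
def bound (d : ℕ) : Tm := fun d' => .var (d' - (d + 1))

/-- The universe of level `i`. -/
def U (i : ℕ) : Tm := fun _ => .univ i

/-- A primitive constant. -/
def con (c : Const) : Tm := fun _ => .const c

/-- Application. -/
def appTm (f a : Tm) : Tm := fun d => .app (f d) (a d)

infixl:100 " ⬝ " => appTm

/-- `Π (x : A), B x`. -/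
def Pi (A : Tm) (B : Tm → Tm) : Tm := fun d => .pi (A d) (B (bound d) (d + 1))

/-- `λ (x : A), b x`. -/
def Lam (A : Tm) (b : Tm → Tm) : Tm := fun d => .lam (A d) (b (bound d) (d + 1))

/-- `A → B`. -/
def Arr (A B : Tm) : Tm := Pi A fun _ => B

/-! ### Defined notions of type theory

The level `i` is that of the types `A`, `B`; the level `j` is that of the family `P`. -/

/-- The empty type `0`. -/
def Empty0 : Tm := con .empty

/-- `Σ (x : A), B x`. -/
def Sig (i : ℕ) (A : Tm) (B : Tm → Tm) : Tm := con (.sigma i) ⬝ A ⬝ Lam A B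

/-- `A × B`. -/
def Prd (i : ℕ) (A B : Tm) : Tm := Sig i A fun _ => B

/-- The pair `(a, b) : Σ (x : A), B x`. -/
def Pair (i : ℕ) (A : Tm) (B : Tm → Tm) (a b : Tm) : Tm :=
  con (.pair i) ⬝ A ⬝ Lam A B ⬝ a ⬝ b

/-- The path type `x =_A y`. -/
def Path (i : ℕ) (A x y : Tm) : Tm := con (.path i) ⬝ A ⬝ x ⬝ y

/-- `refl_x : x =_A x`. -/
def Refl (i : ℕ) (A x : Tm) : Tm := con (.rfl i) ⬝ A ⬝ x

/-- Path induction: from `r : C x refl_x` and `p : x =_A y` an element of `C y p`. -/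
def J (i j : ℕ) (A x : Tm) (C : Tm → Tm → Tm) (r y p : Tm) : Tm :=
  con (.pathInd i j) ⬝ A ⬝ x ⬝ (Lam A fun y' => Lam (Path i A x y') fun p' => C y' p') ⬝ r ⬝ y ⬝ p

/-- `transport^P(p, u) : P y` for `P : A → U j`, `p : x =_A y` and `u : P x`. -/
def Transport (i j : ℕ) (A P x y p u : Tm) : Tm :=
  J i j A x (fun y' _ => Arr (P ⬝ x) (P ⬝ y')) (Lam (P ⬝ x) fun v => v) y p ⬝ u

/-- `ap_g(p) : g x =_B g y` for `g : A → B` (with `B : U j`) and `p : x =_A y`. -/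
def Ap (i j : ℕ) (A B g x y p : Tm) : Tm :=
  J i j A x (fun y' _ => Path j B (g ⬝ x) (g ⬝ y')) (Refl j B (g ⬝ x)) y p

/-- `apd_g(p) : transport^P(p, g x) =_{P y} g y` for `g : Π (x : A), P x` and `p : x =_A y`. -/
def Apd (i j : ℕ) (A P g x y p : Tm) : Tm :=
  J i j A x (fun y' p' => Path j (P ⬝ y') (Transport i j A P x y' p' (g ⬝ x)) (g ⬝ y'))
    (Refl j (P ⬝ x) (g ⬝ x)) y p

/-- `A` is contractible. -/
def IsContr (i : ℕ) (A : Tm) : Tm := Sig i A fun x => Pi A fun y => Path i A x y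

/-- `IsType i k A` says that `A` is a `(k - 2)`-type. -/
def IsType (i : ℕ) : ℕ → Tm → Tm
  | 0, A => IsContr i A
  | k + 1, A => Pi A fun x => Pi A fun y => IsType i k (Path i A x y)

/-- `A` is a mere proposition, i.e. a `(-1)`-type. -/
def IsProp (i : ℕ) (A : Tm) : Tm := IsType i 1 A

/-- `A` is a set, i.e. a `0`-type. -/
def IsSet (i : ℕ) (A : Tm) : Tm := IsType i 2 A

/-- `g : A → B` has a left inverse. -/
def LInv (i : ℕ) (A B g : Tm) : Tm :=
  Sig i (Arr B A) fun h => Pi A fun x => Path i A (h ⬝ (g ⬝ x)) x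

/-- `g : A → B` has a right inverse. -/
def RInv (i : ℕ) (A B g : Tm) : Tm :=
  Sig i (Arr B A) fun h => Pi B fun y => Path i B (g ⬝ (h ⬝ y)) y

/-- `g : A → B` is an equivalence. -/
def IsEquiv (i : ℕ) (A B g : Tm) : Tm := Prd i (LInv i A B g) (RInv i A B g)

/-- `A ≃ B`. -/
def Equiv (i : ℕ) (A B : Tm) : Tm := Sig i (Arr A B) fun g => IsEquiv i A B g

/-- The identity function. -/
def IdFun (A : Tm) : Tm := Lam A fun x => x

/-- The identity equivalence `A ≃ A`. -/
def IdEquiv (i : ℕ) (A : Tm) : Tm :=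
  Pair i (Arr A A) (fun g => IsEquiv i A A g) (IdFun A)
    (Pair i (LInv i A A (IdFun A)) (fun _ => RInv i A A (IdFun A))
      (Pair i (Arr A A) (fun h => Pi A fun x => Path i A (h ⬝ (IdFun A ⬝ x)) x)
        (IdFun A) (Lam A fun x => Refl i A x))
      (Pair i (Arr A A) (fun h => Pi A fun y => Path i A (IdFun A ⬝ (h ⬝ y)) y)
        (IdFun A) (Lam A fun y => Refl i A y)))

/-- The canonical map `(A = B) → (A ≃ B)` for `A B : U i`. -/
def IdToEquiv (i : ℕ) (A B : Tm) : Tm :=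
  Lam (Path (i + 1) (U i) A B) fun p =>
    J (i + 1) i (U i) A (fun B' _ => Equiv i A B') (IdEquiv i A) B p

/-- The one-step truncation `{A}`. -/
def One (i : ℕ) (A : Tm) : Tm := con (.one i) ⬝ A

/-- The point constructor `f : A → {A}`. -/
def OneF (i : ℕ) (A : Tm) : Tm := con (.oneF i) ⬝ A

/-- The path constructor `e(a, b) : f(a) = f(b)`. -/
def OneE (i : ℕ) (A a b : Tm) : Tm := con (.oneE i) ⬝ A ⬝ a ⬝ b

/-- The propositional truncation `‖A‖`. -/
def PTrunc (i : ℕ) (A : Tm) : Tm := con (.ptr i) ⬝ A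

/-- The `n`-truncation `‖A‖_n`. -/
def Trunc (n i : ℕ) (A : Tm) : Tm := con (.tr n i) ⬝ A

/-! ### The types of the primitive constants -/

/-- The type of a primitive constant, in named form. -/
def Const.typeTm : Const → Tm
  | .empty => U 0
  | .emptyInd j => Pi (Arr Empty0 (U j)) fun P => Pi Empty0 fun x => P ⬝ x
  | .unit => U 0
  | .star => con .unit
  | .unitInd j => Pi (Arr (con .unit) (U j)) fun P => Arr (P ⬝ con .star) <|
      Pi (con .unit) fun x => P ⬝ x
  | .nat => U 0
  | .zero => con .nat
  | .succ => Arr (con .nat) (con .nat)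
  | .natInd j => Pi (Arr (con .nat) (U j)) fun P => Arr (P ⬝ con .zero) <|
      Arr (Pi (con .nat) fun n => Arr (P ⬝ n) (P ⬝ (con .succ ⬝ n))) <|
      Pi (con .nat) fun n => P ⬝ n
  | .sum i => Arr (U i) <| Arr (U i) (U i)
  | .inl i => Pi (U i) fun A => Pi (U i) fun B => Arr A (con (.sum i) ⬝ A ⬝ B)
  | .inr i => Pi (U i) fun A => Pi (U i) fun B => Arr B (con (.sum i) ⬝ A ⬝ B)
  | .sumInd i j => Pi (U i) fun A => Pi (U i) fun B =>
      Pi (Arr (con (.sum i) ⬝ A ⬝ B) (U j)) fun P =>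
      Arr (Pi A fun a => P ⬝ (con (.inl i) ⬝ A ⬝ B ⬝ a)) <|
      Arr (Pi B fun b => P ⬝ (con (.inr i) ⬝ A ⬝ B ⬝ b)) <|
      Pi (con (.sum i) ⬝ A ⬝ B) fun x => P ⬝ x
  | .sigma i => Pi (U i) fun A => Arr (Arr A (U i)) (U i)
  | .pair i => Pi (U i) fun A => Pi (Arr A (U i)) fun B => Pi A fun a =>
      Arr (B ⬝ a) (con (.sigma i) ⬝ A ⬝ B)
  | .sigmaInd i j => Pi (U i) fun A => Pi (Arr A (U i)) fun B =>
      Pi (Arr (con (.sigma i) ⬝ A ⬝ B) (U j)) fun P =>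
      Arr (Pi A fun a => Pi (B ⬝ a) fun b => P ⬝ (con (.pair i) ⬝ A ⬝ B ⬝ a ⬝ b)) <|
      Pi (con (.sigma i) ⬝ A ⬝ B) fun x => P ⬝ x
  | .path i => Pi (U i) fun A => Arr A <| Arr A (U i)
  | .rfl i => Pi (U i) fun A => Pi A fun a => Path i A a a
  | .pathInd i j => Pi (U i) fun A => Pi A fun a =>
      Pi (Pi A fun b => Arr (Path i A a b) (U j)) fun P =>
      Arr (P ⬝ a ⬝ Refl i A a) <|
      Pi A fun b => Pi (Path i A a b) fun p => P ⬝ b ⬝ p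
  | .one i => Arr (U i) (U i)
  | .oneF i => Pi (U i) fun A => Arr A (One i A)
  | .oneE i => Pi (U i) fun A => Pi A fun a => Pi A fun b =>
      Path i (One i A) (OneF i A ⬝ a) (OneF i A ⬝ b)
  | .oneInd i j => Pi (U i) fun A => Pi (Arr (One i A) (U j)) fun P =>
      Pi (Pi A fun a => P ⬝ (OneF i A ⬝ a)) fun g =>
      Arr (Pi A fun a => Pi A fun b => Path j (P ⬝ (OneF i A ⬝ b))
        (Transport i j (One i A) P (OneF i A ⬝ a) (OneF i A ⬝ b) (OneE i A a b) (g ⬝ a))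
        (g ⬝ b)) <|
      Pi (One i A) fun x => P ⬝ x
  -- the propositional computation rule of `oneInd` on the path constructor
  | .oneIndE i j => Pi (U i) fun A => Pi (Arr (One i A) (U j)) fun P =>
      Pi (Pi A fun a => P ⬝ (OneF i A ⬝ a)) fun g =>
      Pi (Pi A fun a => Pi A fun b => Path j (P ⬝ (OneF i A ⬝ b))
        (Transport i j (One i A) P (OneF i A ⬝ a) (OneF i A ⬝ b) (OneE i A a b) (g ⬝ a))
        (g ⬝ b)) fun q =>
      Pi A fun a => Pi A fun b =>
      Path j
        (Path j (P ⬝ (OneF i A ⬝ b))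
          (Transport i j (One i A) P (OneF i A ⬝ a) (OneF i A ⬝ b) (OneE i A a b) (g ⬝ a))
          (g ⬝ b))
        (Apd i j (One i A) P (con (.oneInd i j) ⬝ A ⬝ P ⬝ g ⬝ q)
          (OneF i A ⬝ a) (OneF i A ⬝ b) (OneE i A a b))
        (q ⬝ a ⬝ b)
  | .ptr i => Arr (U i) (U i)
  | .ptrMk i => Pi (U i) fun A => Arr A (PTrunc i A)
  | .ptrEps i => Pi (U i) fun A => Pi (PTrunc i A) fun x => Pi (PTrunc i A) fun y =>
      Path i (PTrunc i A) x y
  | .ptrInd i j => Pi (U i) fun A => Pi (Arr (PTrunc i A) (U j)) fun P =>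
      Arr (Pi A fun a => P ⬝ (con (.ptrMk i) ⬝ A ⬝ a)) <|
      Arr (Pi (PTrunc i A) fun x => Pi (PTrunc i A) fun y =>
        Pi (P ⬝ x) fun u => Pi (P ⬝ y) fun v => Path j (P ⬝ y)
          (Transport i j (PTrunc i A) P x y (con (.ptrEps i) ⬝ A ⬝ x ⬝ y) u) v) <|
      Pi (PTrunc i A) fun x => P ⬝ x
  -- the propositional computation rule of `ptrInd` on the path constructor
  | .ptrIndEps i j => Pi (U i) fun A => Pi (Arr (PTrunc i A) (U j)) fun P =>
      Pi (Pi A fun a => P ⬝ (con (.ptrMk i) ⬝ A ⬝ a)) fun g =>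
      Pi (Pi (PTrunc i A) fun x => Pi (PTrunc i A) fun y =>
        Pi (P ⬝ x) fun u => Pi (P ⬝ y) fun v => Path j (P ⬝ y)
          (Transport i j (PTrunc i A) P x y (con (.ptrEps i) ⬝ A ⬝ x ⬝ y) u) v) fun q =>
      Pi (PTrunc i A) fun x => Pi (PTrunc i A) fun y =>
      Path j
        (Path j (P ⬝ y)
          (Transport i j (PTrunc i A) P x y (con (.ptrEps i) ⬝ A ⬝ x ⬝ y)
            (con (.ptrInd i j) ⬝ A ⬝ P ⬝ g ⬝ q ⬝ x))
          (con (.ptrInd i j) ⬝ A ⬝ P ⬝ g ⬝ q ⬝ y))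
        (Apd i j (PTrunc i A) P (con (.ptrInd i j) ⬝ A ⬝ P ⬝ g ⬝ q) x y
          (con (.ptrEps i) ⬝ A ⬝ x ⬝ y))
        (q ⬝ x ⬝ y ⬝ (con (.ptrInd i j) ⬝ A ⬝ P ⬝ g ⬝ q ⬝ x)
          ⬝ (con (.ptrInd i j) ⬝ A ⬝ P ⬝ g ⬝ q ⬝ y))
  | .tr _ i => Arr (U i) (U i)
  | .trMk n i => Pi (U i) fun A => Arr A (Trunc n i A)
  | .trTrunc n i => Pi (U i) fun A => IsType i (n + 2) (Trunc n i A)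
  | .trInd n i j => Pi (U i) fun A => Pi (Arr (Trunc n i A) (U j)) fun P =>
      Arr (Pi (Trunc n i A) fun x => IsType j (n + 2) (P ⬝ x)) <|
      Arr (Pi A fun a => P ⬝ (con (.trMk n i) ⬝ A ⬝ a)) <|
      Pi (Trunc n i A) fun x => P ⬝ x
  | .ua i => Pi (U i) fun A => Pi (U i) fun B =>
      IsEquiv (i + 1) (Path (i + 1) (U i) A B) (Equiv i A B) (IdToEquiv i A B)

/-- The type of a primitive constant, a closed term. -/
def Const.type (c : Const) : Term := c.typeTm 0

/-! ### Judgments -/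

open Term in
/-- The judgmental computation rules of the induction principles on point constructors. -/
inductive Comp : Term → Term → Prop
  | unit (j : ℕ) (P c : Term) :
      Comp (call (.unitInd j) [P, c, const .star]) c
  | zero (j : ℕ) (P z s : Term) :
      Comp (call (.natInd j) [P, z, s, const .zero]) z
  | succ (j : ℕ) (P z s n : Term) :
      Comp (call (.natInd j) [P, z, s, app (const .succ) n])
        (app (app s n) (call (.natInd j) [P, z, s, n]))
  | inl (i j : ℕ) (A B P l r a : Term) :
      Comp (call (.sumInd i j) [A, B, P, l, r, call (.inl i) [A, B, a]]) (app l a)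
  | inr (i j : ℕ) (A B P l r b : Term) :
      Comp (call (.sumInd i j) [A, B, P, l, r, call (.inr i) [A, B, b]]) (app r b)
  | pair (i j : ℕ) (A B P g a b : Term) :
      Comp (call (.sigmaInd i j) [A, B, P, g, call (.pair i) [A, B, a, b]]) (app (app g a) b)
  | rfl (i j : ℕ) (A a P r : Term) :
      Comp (call (.pathInd i j) [A, a, P, r, a, call (.rfl i) [A, a]]) r
  | one (i j : ℕ) (A P g q a : Term) :
      Comp (call (.oneInd i j) [A, P, g, q, call (.oneF i) [A, a]]) (app g a)
  | ptr (i j : ℕ) (A P g q a : Term) :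
      Comp (call (.ptrInd i j) [A, P, g, q, call (.ptrMk i) [A, a]]) (app g a)
  | tr (n i j : ℕ) (A P h g a : Term) :
      Comp (call (.trInd n i j) [A, P, h, g, call (.trMk n i) [A, a]]) (app g a)

/-- The three forms of judgment: `Γ` is a context, `a : A` in context `Γ`, and `a ≡ b : A` in
context `Γ`. The head of the list `Γ` is the type of the variable with index `0`. -/
inductive Judgment : Type
  | ctx (Γ : List Term)
  | typ (Γ : List Term) (a A : Term)
  | eqv (Γ : List Term) (a b A : Term)

open Judgment Term in
/-- Derivability of judgments. -/
inductive Derives : Judgment → Prop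
  -- contexts
  | nil : Derives (ctx [])
  | cons {Γ : List Term} {A : Term} {i : ℕ} :
      Derives (ctx Γ) → Derives (typ Γ A (univ i)) → Derives (ctx (A :: Γ))
  -- variables and constants
  | var {Γ : List Term} {n : ℕ} {A : Term} :
      Derives (ctx Γ) → Γ[n]? = some A → Derives (typ Γ (var n) (A.rename (· + (n + 1))))
  | const {Γ : List Term} (c : Const) :
      Derives (ctx Γ) → Derives (typ Γ (const c) c.type)
  -- universes
  | univ {Γ : List Term} (i : ℕ) :
      Derives (ctx Γ) → Derives (typ Γ (univ i) (univ (i + 1)))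
  | cumul {Γ : List Term} {A : Term} {i : ℕ} :
      Derives (typ Γ A (univ i)) → Derives (typ Γ A (univ (i + 1)))
  | cumul_eqv {Γ : List Term} {A B : Term} {i : ℕ} :
      Derives (eqv Γ A B (univ i)) → Derives (eqv Γ A B (univ (i + 1)))
  -- dependent functions
  | pi {Γ : List Term} {A B : Term} {i : ℕ} :
      Derives (typ Γ A (univ i)) → Derives (typ (A :: Γ) B (univ i)) →
      Derives (typ Γ (pi A B) (univ i))
  | pi_eqv {Γ : List Term} {A A' B B' : Term} {i : ℕ} :
      Derives (typ Γ A (univ i)) → Derives (eqv Γ A A' (univ i)) →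
      Derives (eqv (A :: Γ) B B' (univ i)) →
      Derives (eqv Γ (pi A B) (pi A' B') (univ i))
  | lam {Γ : List Term} {A b B : Term} {i : ℕ} :
      Derives (typ Γ A (univ i)) → Derives (typ (A :: Γ) b B) →
      Derives (typ Γ (lam A b) (pi A B))
  | lam_eqv {Γ : List Term} {A A' b b' B : Term} {i : ℕ} :
      Derives (typ Γ A (univ i)) → Derives (eqv Γ A A' (univ i)) →
      Derives (eqv (A :: Γ) b b' B) →
      Derives (eqv Γ (lam A b) (lam A' b') (pi A B))
  | app {Γ : List Term} {A B f a : Term} :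
      Derives (typ Γ f (pi A B)) → Derives (typ Γ a A) →
      Derives (typ Γ (app f a) (B.inst a))
  | app_eqv {Γ : List Term} {A B f f' a a' : Term} :
      Derives (eqv Γ f f' (pi A B)) → Derives (eqv Γ a a' A) →
      Derives (eqv Γ (app f a) (app f' a') (B.inst a))
  | beta {Γ : List Term} {A B b a : Term} {i : ℕ} :
      Derives (typ Γ A (univ i)) → Derives (typ (A :: Γ) b B) → Derives (typ Γ a A) →
      Derives (eqv Γ (app (lam A b) a) (b.inst a) (B.inst a))
  | eta {Γ : List Term} {A B f : Term} :
      Derives (typ Γ f (pi A B)) →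
      Derives (eqv Γ f (lam A (app f.shift (var 0))) (pi A B))
  -- computation rules of the primitive constants
  | comp {Γ : List Term} {l r A : Term} :
      Comp l r → Derives (typ Γ l A) → Derives (typ Γ r A) → Derives (eqv Γ l r A)
  -- judgmental equality is an equivalence relation, and typing respects it
  | refl {Γ : List Term} {a A : Term} :
      Derives (typ Γ a A) → Derives (eqv Γ a a A)
  | symm {Γ : List Term} {a b A : Term} :
      Derives (eqv Γ a b A) → Derives (eqv Γ b a A)
  | trans {Γ : List Term} {a b c A : Term} :
      Derives (eqv Γ a b A) → Derives (eqv Γ b c A) → Derives (eqv Γ a c A)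
  | conv {Γ : List Term} {a A B : Term} {i : ℕ} :
      Derives (typ Γ a A) → Derives (eqv Γ A B (univ i)) → Derives (typ Γ a B)
  | conv_eqv {Γ : List Term} {a b A B : Term} {i : ℕ} :
      Derives (eqv Γ a b A) → Derives (eqv Γ A B (univ i)) → Derives (eqv Γ a b B)

/-- The statement expressed by the closed type `T` holds in homotopy type theory: `T` is inhabited
by a closed term. -/
def Holds (T : Tm) : Prop := ∃ t : Term, Derives (.typ [] t (T 0))

end HoTT

/-!
All seven statements are closed types of a deeply embedded type theory, and each of them is proved by
an explicit closed term. Universe levels can be raised uniformly in a derivation (`Derives.raise`),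
so it suffices to treat the level `0`.

**The mathematics.** The heart is a family over `{A}` that sees the paths `e(a, a)`. Univalence gives
function extensionality, and together they show that `Sets`, the type of types with uniqueness of
identity proofs, is a `1`-type: equivalence of types is a set-valued reflexive relation on `Sets` that
implies equality, and a type with such a relation is a `1`-type (`UIPPathOfRel`). On the other hand
`Sets` has a nonconstant loop `l` at `1 + 1`, the one that univalence makes of the exchange of the
summands (`NontrivialLoop`). The recursion principle of `{A}` turns a loop `l` at `t` into a function
`G : {A} → Sets` with `G (f a) = t` and `ap_G(e(a, b)) = l`, so that `ap_G(e(a, a)) ≠ refl`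
(`NontrivialSets`).

If now `p : a = b` and `ap_f(p) = e(a, b)`, then by path induction `refl = e(a, a)`, hence
`refl = ap_G(e(a, a))`, which is impossible. If `‖{A}‖_1` is a set, then `G` factors through it as
`Sets` is a `1`-type, so that `ap_G(e(a, a))` is the image of a loop in a set and is trivial;
hence `A` is empty, and so are `{A}` and `‖{A}‖_1`. A contractible `‖{A}‖_1` would be a set
with an element. The statements on `‖{A}‖_0` come from induction on truncations: its path types
are mere propositions, so that the paths `e(a, b)` connect all its points, and maps between it and
`‖A‖` are then determined by their values at the points that come from `A`.

**The formalization.** Derivations with the primitive rules would be very long. Instead, a type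
checker with a conversion test (`Oracle.ty`, `oracle`) is proved sound: what it accepts is
derivable (`Oracle.Sound.ty`, `oracle_sound`). The proof of soundness rests on the substitution lemma
`Derives.subst` and on rules for path induction, pairs and case analysis in which the motive is a
family with free variables (`pathInd_typ_eqv`, `sigmaInd_typ_eqv`, `sumInd_typ`). Each lemma of type
theory is then a type together with a term that the checker accepts by evaluation in the kernel; a
lemma that uses others is a function of them (`implies_of_checks`).
-/

namespace HoTT

/-! ### Renaming and substitution -/

namespace Term

theorem upRen_comp (r s : ℕ → ℕ) : upRen s ∘ upRen r = upRen (s ∘ r) := by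
  funext n; cases n <;> rfl

theorem rename_rename (t : Term) (r s : ℕ → ℕ) : (t.rename r).rename s = t.rename (s ∘ r) := by
  induction t generalizing r s <;> simp_all [rename, upRen_comp]

theorem upSub_upRen (r : ℕ → ℕ) (s : ℕ → Term) : upSub s ∘ upRen r = upSub (s ∘ r) := by
  funext n; cases n <;> rfl

theorem subst_rename (t : Term) (r : ℕ → ℕ) (s : ℕ → Term) :
    (t.rename r).subst s = t.subst (s ∘ r) := by
  induction t generalizing r s <;> simp_all [rename, subst, upSub_upRen]

theorem rename_upSub (r : ℕ → ℕ) (s : ℕ → Term) :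
    (fun n => (upSub s n).rename (upRen r)) = upSub fun n => (s n).rename r := by
  funext n
  cases n with
  | zero => rfl
  | succ n =>
    change ((s n).rename Nat.succ).rename (upRen r) = ((s n).rename r).rename Nat.succ
    rw [rename_rename, rename_rename]; rfl

theorem rename_subst (t : Term) (r : ℕ → ℕ) (s : ℕ → Term) :
    (t.subst s).rename r = t.subst fun n => (s n).rename r := by
  induction t generalizing r s <;> simp_all [rename, subst, rename_upSub]

theorem subst_upSub (s u : ℕ → Term) :
    (fun n => (upSub s n).subst (upSub u)) = upSub fun n => (s n).subst u := by
  funext n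
  cases n with
  | zero => rfl
  | succ n =>
    change ((s n).rename Nat.succ).subst (upSub u) = ((s n).subst u).rename Nat.succ
    rw [subst_rename, rename_subst]; rfl

theorem subst_subst (t : Term) (s u : ℕ → Term) :
    (t.subst s).subst u = t.subst fun n => (s n).subst u := by
  induction t generalizing s u <;> simp_all [subst, subst_upSub]

theorem upSub_var : upSub var = var := by funext n; cases n <;> rfl

theorem subst_var (t : Term) : t.subst var = t := by
  induction t <;> simp_all [subst, upSub_var]

theorem upSub_var_comp (r : ℕ → ℕ) : upSub (var ∘ r) = var ∘ upRen r := by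
  funext n; cases n <;> rfl

theorem rename_eq_subst (t : Term) (r : ℕ → ℕ) : t.rename r = t.subst (var ∘ r) := by
  induction t generalizing r <;> simp_all [rename, subst, upSub_var_comp]

theorem shift_rename (t : Term) (r : ℕ → ℕ) :
    t.shift.rename (upRen r) = (t.rename r).shift := by
  simp only [shift, rename_rename]; rfl

@[simp] theorem shift_subst_upSub (t : Term) (s : ℕ → Term) :
    t.shift.subst (upSub s) = (t.subst s).shift := by
  simp only [shift, subst_rename, rename_subst]; rfl

@[simp] theorem shift_inst (t a : Term) : t.shift.inst a = t := by
  rw [shift, inst, subst_rename]; exact subst_var t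

@[simp] theorem shift_subst_single (t a : Term) : t.shift.subst (single a) = t := shift_inst t a

theorem inst_rename (b a : Term) (r : ℕ → ℕ) :
    (b.inst a).rename r = (b.rename (upRen r)).inst (a.rename r) := by
  simp only [inst, rename_subst, subst_rename]
  congr 1; funext n; cases n <;> rfl

theorem inst_subst (b a : Term) (s : ℕ → Term) :
    (b.inst a).subst s = (b.subst (upSub s)).inst (a.subst s) := by
  simp only [inst, subst_subst]
  congr 1; funext n
  cases n with
  | zero => rfl
  | succ n => exact (shift_inst (s n) _).symm

/-- All free variables of the term are less than the given number. -/
def FreeBelow : ℕ → Term → Prop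
  | m, var n => n < m
  | _, univ _ => True
  | m, pi A B => FreeBelow m A ∧ FreeBelow (m + 1) B
  | m, lam A b => FreeBelow m A ∧ FreeBelow (m + 1) b
  | m, app f a => FreeBelow m f ∧ FreeBelow m a
  | _, const _ => True

theorem FreeBelow.subst_eq {t : Term} {m : ℕ} (h : FreeBelow m t) {s : ℕ → Term}
    (hs : ∀ n < m, s n = var n) : t.subst s = t := by
  have up : ∀ {m : ℕ} {s : ℕ → Term}, (∀ n < m, s n = var n) → ∀ n < m + 1, upSub s n = var n := by
    intro m s hs n hn
    cases n with
    | zero => rfl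
    | succ n =>
      change (s n).rename Nat.succ = _
      rw [hs n (by omega)]; rfl
  induction t generalizing m s with
  | var n => exact hs n h
  | univ | const => rfl
  | pi A B ihA ihB | lam A B ihA ihB =>
    rw [subst, ihA h.1 hs, ihB h.2 (up hs)]
  | app f a ihf iha => rw [subst, ihf h.1 hs, iha h.2 hs]

theorem FreeBelow.rename_eq {t : Term} (h : FreeBelow 0 t) (r : ℕ → ℕ) : t.rename r = t := by
  rw [rename_eq_subst]; exact h.subst_eq fun n hn => absurd hn (Nat.not_lt_zero n)

end Term

open Term

theorem isType_freeBelow (i k d₀ : ℕ) (A : Tm) (hA : ∀ d, d₀ ≤ d → (A d).FreeBelow d) (d : ℕ)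
    (hd : d₀ ≤ d) : (IsType i k A d).FreeBelow d := by
  induction k generalizing A d₀ d with
  | zero =>
    have h1 := hA d hd
    have h2 := hA (d + 1) (by omega)
    have h3 := hA (d + 2) (by omega)
    simp [IsType, IsContr, Sig, appTm, con, Lam, Pi, Path, bound, FreeBelow, *]
  | succ k ih =>
    refine ⟨hA d hd, hA (d + 1) (by omega), ih (d + 2) _ (fun d' hd' => ?_) (d + 2) le_rfl⟩
    have h := hA d' (by omega)
    simp only [Path, appTm, con, bound, FreeBelow, h, and_true, true_and]
    omega

theorem Const.type_freeBelow (c : Const) : c.type.FreeBelow 0 := by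
  cases c with
  | trTrunc n i =>
    refine ⟨trivial, isType_freeBelow i (n + 2) 1 _ (fun d hd => ?_) 1 le_rfl⟩
    simp only [Trunc, appTm, con, bound, FreeBelow, true_and]
    omega
  | trInd n i j =>
    refine ⟨trivial, ⟨?_, trivial⟩, ⟨?_, isType_freeBelow j (n + 2) 3 _
      (fun d hd => ?_) 3 le_rfl⟩, ?_⟩
    all_goals simp [Arr, Trunc, appTm, con, bound, Pi, FreeBelow]
    omega
  | _ => simp [Const.type, Const.typeTm, IsEquiv, Prd, Equiv, LInv, RInv, IdToEquiv, IdEquiv, Pair,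
      IdFun, J, Apd, Transport, Path, Refl, Arr, Sig, One, OneF, OneE, PTrunc, Trunc, Empty0, U,
      appTm, con, bound, Pi, Lam, FreeBelow]

theorem Const.type_rename (c : Const) (r : ℕ → ℕ) : c.type.rename r = c.type :=
  c.type_freeBelow.rename_eq r

theorem Const.type_subst (c : Const) (s : ℕ → Term) : c.type.subst s = c.type :=
  c.type_freeBelow.subst_eq fun n hn => absurd hn (Nat.not_lt_zero n)

theorem Comp.rename {l r : Term} (h : Comp l r) (s : ℕ → ℕ) : Comp (l.rename s) (r.rename s) := by
  cases h <;> constructor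

theorem Comp.subst {l r : Term} (h : Comp l r) (s : ℕ → Term) : Comp (l.subst s) (r.subst s) := by
  cases h <;> constructor

/-! ### Stability of derivability under renaming and substitution -/

open Judgment

/-- `r` maps the variables of the context `Γ` to variables of `Δ` of the same types. -/
def WtRen (r : ℕ → ℕ) (Γ Δ : List Term) : Prop :=
  ∀ n A, Γ[n]? = some A → ∃ A', Δ[r n]? = some A' ∧
    A'.rename (· + (r n + 1)) = (A.rename (· + (n + 1))).rename r

theorem WtRen.up {r : ℕ → ℕ} {Γ Δ : List Term} (h : WtRen r Γ Δ) (A : Term) :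
    WtRen (upRen r) (A :: Γ) (A.rename r :: Δ) := by
  intro n B hB
  cases n with
  | zero =>
    obtain rfl : A = B := by simpa using hB
    refine ⟨A.rename r, rfl, ?_⟩
    simp only [rename_rename]; rfl
  | succ n =>
    obtain ⟨B', h1, h2⟩ := h n B (by simpa using hB)
    refine ⟨B', by simpa [upRen] using h1, ?_⟩
    have h3 := congrArg (Term.rename · Nat.succ) h2
    simp only [rename_rename] at h3 ⊢
    exact h3

theorem wtRen_succ (A : Term) (Γ : List Term) : WtRen Nat.succ Γ (A :: Γ) := by
  intro n B hB
  refine ⟨B, by simpa using hB, ?_⟩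
  simp only [rename_rename]; rfl

/-- The statement of `Derives.rename` for a judgment. -/
def RenStable : Judgment → Prop
  | ctx _ => True
  | typ Γ a A => ∀ r Δ, WtRen r Γ Δ → Derives (ctx Δ) → Derives (typ Δ (a.rename r) (A.rename r))
  | eqv Γ a b A => ∀ r Δ, WtRen r Γ Δ → Derives (ctx Δ) →
      Derives (eqv Δ (a.rename r) (b.rename r) (A.rename r))

theorem Derives.rename {j : Judgment} (h : Derives j) : RenStable j := by
  induction h with
  | nil | cons => trivial
  | var hΓ hn =>
    intro r Δ hr hΔ
    obtain ⟨A', h1, h2⟩ := hr _ _ hn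
    rw [← h2]
    exact .var hΔ h1
  | const c =>
    intro r Δ _ hΔ
    rw [c.type_rename]
    exact .const c hΔ
  | univ i => exact fun r Δ _ hΔ => .univ i hΔ
  | cumul _ ih => exact fun r Δ hr hΔ => .cumul (ih r Δ hr hΔ)
  | cumul_eqv _ ih => exact fun r Δ hr hΔ => .cumul_eqv (ih r Δ hr hΔ)
  | pi _ _ ihA ihB =>
    intro r Δ hr hΔ
    have hA := ihA r Δ hr hΔ
    exact .pi hA (ihB _ _ (hr.up _) (.cons hΔ hA))
  | pi_eqv _ _ _ ihA ihA' ihB =>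
    intro r Δ hr hΔ
    have hA := ihA r Δ hr hΔ
    exact .pi_eqv hA (ihA' r Δ hr hΔ) (ihB _ _ (hr.up _) (.cons hΔ hA))
  | lam _ _ ihA ihb =>
    intro r Δ hr hΔ
    have hA := ihA r Δ hr hΔ
    exact .lam hA (ihb _ _ (hr.up _) (.cons hΔ hA))
  | lam_eqv _ _ _ ihA ihA' ihb =>
    intro r Δ hr hΔ
    have hA := ihA r Δ hr hΔ
    exact .lam_eqv hA (ihA' r Δ hr hΔ) (ihb _ _ (hr.up _) (.cons hΔ hA))
  | app _ _ ihf iha =>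
    intro r Δ hr hΔ
    rw [inst_rename]
    exact .app (ihf r Δ hr hΔ) (iha r Δ hr hΔ)
  | app_eqv _ _ ihf iha =>
    intro r Δ hr hΔ
    rw [inst_rename]
    exact .app_eqv (ihf r Δ hr hΔ) (iha r Δ hr hΔ)
  | beta _ _ _ ihA ihb iha =>
    intro r Δ hr hΔ
    have hA := ihA r Δ hr hΔ
    rw [inst_rename, inst_rename]
    exact .beta hA (ihb _ _ (hr.up _) (.cons hΔ hA)) (iha r Δ hr hΔ)
  | @eta Γ A B f _ ih =>
    intro r Δ hr hΔ
    have h := Derives.eta (ih r Δ hr hΔ)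
    rwa [← shift_rename] at h
  | comp hc _ _ ihl ihr =>
    intro r Δ hr hΔ
    exact .comp (hc.rename r) (ihl r Δ hr hΔ) (ihr r Δ hr hΔ)
  | refl _ ih => exact fun r Δ hr hΔ => .refl (ih r Δ hr hΔ)
  | symm _ ih => exact fun r Δ hr hΔ => .symm (ih r Δ hr hΔ)
  | trans _ _ ih ih' => exact fun r Δ hr hΔ => .trans (ih r Δ hr hΔ) (ih' r Δ hr hΔ)
  | conv _ _ ih ih' => exact fun r Δ hr hΔ => .conv (ih r Δ hr hΔ) (ih' r Δ hr hΔ)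
  | conv_eqv _ _ ih ih' => exact fun r Δ hr hΔ => .conv_eqv (ih r Δ hr hΔ) (ih' r Δ hr hΔ)

theorem Derives.weaken {Γ : List Term} {a A B : Term} (h : Derives (typ Γ a A))
    (hc : Derives (ctx (B :: Γ))) : Derives (typ (B :: Γ) a.shift A.shift) :=
  h.rename _ _ (wtRen_succ B Γ) hc

/-- `s` maps the variables of `Γ` to terms of the corresponding types in `Δ`. -/
def WtSub (s : ℕ → Term) (Γ Δ : List Term) : Prop :=
  ∀ n A, Γ[n]? = some A → Derives (typ Δ (s n) ((A.rename (· + (n + 1))).subst s))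

theorem WtSub.up {s : ℕ → Term} {Γ Δ : List Term} (h : WtSub s Γ Δ) {A : Term}
    (hc : Derives (ctx (A.subst s :: Δ))) : WtSub (upSub s) (A :: Γ) (A.subst s :: Δ) := by
  intro n B hB
  cases n with
  | zero =>
    obtain rfl : A = B := by simpa using hB
    have h1 := Derives.var (n := 0) hc rfl
    change Derives (typ _ _ (A.shift.subst (upSub s)))
    rw [shift_subst_upSub]
    exact h1
  | succ n =>
    have h1 := (h n B (by simpa using hB)).weaken hc
    have e : (B.rename (· + (n + 1))).shift = B.rename (· + (n + 1 + 1)) := by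
      simp only [shift, rename_rename]; rfl
    rw [← shift_subst_upSub, e] at h1
    exact h1

/-- The statement of `Derives.subst` for a judgment. -/
def SubStable : Judgment → Prop
  | ctx _ => True
  | typ Γ a A => ∀ s Δ, WtSub s Γ Δ → Derives (ctx Δ) → Derives (typ Δ (a.subst s) (A.subst s))
  | eqv Γ a b A => ∀ s Δ, WtSub s Γ Δ → Derives (ctx Δ) →
      Derives (eqv Δ (a.subst s) (b.subst s) (A.subst s))

theorem Derives.subst {j : Judgment} (h : Derives j) : SubStable j := by
  induction h with
  | nil | cons => trivial
  | var hΓ hn => exact fun s Δ hs _ => hs _ _ hn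
  | const c =>
    intro s Δ _ hΔ
    rw [c.type_subst]
    exact .const c hΔ
  | univ i => exact fun s Δ _ hΔ => .univ i hΔ
  | cumul _ ih => exact fun s Δ hs hΔ => .cumul (ih s Δ hs hΔ)
  | cumul_eqv _ ih => exact fun s Δ hs hΔ => .cumul_eqv (ih s Δ hs hΔ)
  | pi _ _ ihA ihB =>
    intro s Δ hs hΔ
    have hA := ihA s Δ hs hΔ
    have hc := Derives.cons hΔ hA
    exact .pi hA (ihB _ _ (hs.up hc) hc)
  | pi_eqv _ _ _ ihA ihA' ihB =>
    intro s Δ hs hΔ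
    have hA := ihA s Δ hs hΔ
    have hc := Derives.cons hΔ hA
    exact .pi_eqv hA (ihA' s Δ hs hΔ) (ihB _ _ (hs.up hc) hc)
  | lam _ _ ihA ihb =>
    intro s Δ hs hΔ
    have hA := ihA s Δ hs hΔ
    have hc := Derives.cons hΔ hA
    exact .lam hA (ihb _ _ (hs.up hc) hc)
  | lam_eqv _ _ _ ihA ihA' ihb =>
    intro s Δ hs hΔ
    have hA := ihA s Δ hs hΔ
    have hc := Derives.cons hΔ hA
    exact .lam_eqv hA (ihA' s Δ hs hΔ) (ihb _ _ (hs.up hc) hc)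
  | app _ _ ihf iha =>
    intro s Δ hs hΔ
    rw [inst_subst]
    exact .app (ihf s Δ hs hΔ) (iha s Δ hs hΔ)
  | app_eqv _ _ ihf iha =>
    intro s Δ hs hΔ
    rw [inst_subst]
    exact .app_eqv (ihf s Δ hs hΔ) (iha s Δ hs hΔ)
  | beta _ _ _ ihA ihb iha =>
    intro s Δ hs hΔ
    have hA := ihA s Δ hs hΔ
    have hc := Derives.cons hΔ hA
    rw [inst_subst, inst_subst]
    exact .beta hA (ihb _ _ (hs.up hc) hc) (iha s Δ hs hΔ)
  | @eta Γ A B f _ ih =>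
    intro s Δ hs hΔ
    have h := Derives.eta (ih s Δ hs hΔ)
    rwa [← shift_subst_upSub] at h
  | comp hc _ _ ihl ihr =>
    intro s Δ hs hΔ
    exact .comp (hc.subst s) (ihl s Δ hs hΔ) (ihr s Δ hs hΔ)
  | refl _ ih => exact fun s Δ hs hΔ => .refl (ih s Δ hs hΔ)
  | symm _ ih => exact fun s Δ hs hΔ => .symm (ih s Δ hs hΔ)
  | trans _ _ ih ih' => exact fun s Δ hs hΔ => .trans (ih s Δ hs hΔ) (ih' s Δ hs hΔ)
  | conv _ _ ih ih' => exact fun s Δ hs hΔ => .conv (ih s Δ hs hΔ) (ih' s Δ hs hΔ)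
  | conv_eqv _ _ ih ih' => exact fun s Δ hs hΔ => .conv_eqv (ih s Δ hs hΔ) (ih' s Δ hs hΔ)

theorem wtSub_single {Γ : List Term} {a A : Term} (hΓ : Derives (ctx Γ))
    (ha : Derives (typ Γ a A)) : WtSub (single a) (A :: Γ) Γ := by
  intro n B hB
  cases n with
  | zero =>
    obtain rfl : A = B := by simpa using hB
    change Derives (typ Γ a (A.shift.subst (single a)))
    rwa [shift_subst_single]
  | succ n =>
    have h := Derives.var (n := n) (A := B) hΓ (by simpa using hB)
    have e : (B.rename (· + (n + 1 + 1))).subst (single a) = B.rename (· + (n + 1)) := by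
      rw [subst_rename, rename_eq_subst]; rfl
    rw [e]; exact h

theorem Derives.inst {Γ : List Term} {a A b B : Term} (hΓ : Derives (ctx Γ))
    (hb : Derives (typ (A :: Γ) b B)) (ha : Derives (typ Γ a A)) :
    Derives (typ Γ (b.inst a) (B.inst a)) :=
  hb.subst _ _ (wtSub_single hΓ ha) hΓ

/-! ### Derived rules -/

namespace Term

@[simp] theorem upSub_zero (s : ℕ → Term) : upSub s 0 = var 0 := rfl

@[simp] theorem upSub_succ (s : ℕ → Term) (n : ℕ) : upSub s (n + 1) = (s n).shift := rfl

@[simp] theorem single_zero (a : Term) : single a 0 = a := rfl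

@[simp] theorem single_succ (a : Term) (n : ℕ) : single a (n + 1) = var n := rfl

/-- The substitution sending variable `0` to `a` and variable `n + 1` to `s n`. -/
def scons (a : Term) (s : ℕ → Term) : ℕ → Term
  | 0 => a
  | n + 1 => s n

/-- `inst2 t x y` substitutes `y` for variable `0` and `x` for variable `1`. -/
def inst2 (t x y : Term) : Term := t.subst (scons y (scons x var))

/-- The family `C` over `Σ (x : A), F x`, at the generic pair. -/
def pairInst (i : ℕ) (A F C : Term) : Term :=
  C.subst (scons (call (.pair i) [A.shift.shift, F.shift.shift, var 1, var 0]) fun n => var (n + 2))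

/-- The family `C` over `A + B`, at a generic element given by an injection `c`. -/
def injInst (c : Const) (A B C : Term) : Term :=
  C.subst (scons (call c [A.shift, B.shift, var 0]) fun n => var (n + 1))

theorem inst_upSub (t a : Term) (s : ℕ → Term) :
    (t.subst (upSub s)).inst a = t.subst (scons a s) := by
  rw [inst, subst_subst]
  congr 1; funext n
  cases n with
  | zero => rfl
  | succ n => exact shift_inst (s n) a

theorem inst_upRen (t a : Term) (r : ℕ → ℕ) :
    (t.rename (upRen r)).inst a = t.subst (scons a (var ∘ r)) := by
  rw [rename_eq_subst, ← upSub_var_comp, inst_upSub]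

theorem inst_upSub_single (t x y : Term) :
    (t.subst (upSub (single x))).inst y = inst2 t x y := by
  rw [inst_upSub, inst2]
  congr 2

@[simp] theorem call_subst (c : Const) (args : List Term) (s : ℕ → Term) :
    (call c args).subst s = call c (args.map (subst · s)) := by
  have : ∀ t : Term, (args.foldl app t).subst s = (args.map (subst · s)).foldl app (t.subst s) := by
    induction args with
    | nil => exact fun t => rfl
    | cons a l ih => exact fun t => ih (app t a)
  exact this (const c)

theorem subst_scons_var (t : Term) : t.subst (scons (var 0) (var ∘ Nat.succ)) = t := by
  conv_rhs => rw [← subst_var t]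
  congr 1; funext n; cases n <;> rfl

theorem inst2_pairInst (i : ℕ) (A F C x y : Term) :
    inst2 (pairInst i A F C) x y = C.inst (call (.pair i) [A, F, x, y]) := by
  rw [inst2, pairInst, subst_subst, inst]
  congr 1; funext n
  cases n with
  | zero =>
    have e : ∀ t : Term, t.shift.shift.subst (scons y (scons x var)) = t := fun t => by
      rw [shift, shift, subst_rename, subst_rename]; exact subst_var t
    simp only [scons, call, List.foldl, subst, single, e]
  | succ n => rfl

end Term

theorem cumul_le {Γ : List Term} {A : Term} {i j : ℕ} (h : Derives (typ Γ A (univ i)))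
    (hij : i ≤ j) : Derives (typ Γ A (univ j)) := by
  induction hij with
  | refl => exact h
  | step _ ih => exact ih.cumul

theorem cumul_eqv_le {Γ : List Term} {A B : Term} {i j : ℕ} (h : Derives (eqv Γ A B (univ i)))
    (hij : i ≤ j) : Derives (eqv Γ A B (univ j)) := by
  induction hij with
  | refl => exact h
  | step _ ih => exact ih.cumul_eqv

theorem subst_up_typ {Γ : List Term} {A D b B a : Term} {i : ℕ} (hΓ : Derives (ctx Γ))
    (hD : Derives (typ (A :: Γ) D (univ i))) (hb : Derives (typ (D :: A :: Γ) b B))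
    (ha : Derives (typ Γ a A)) :
    Derives (typ (D.inst a :: Γ) (b.subst (upSub (single a))) (B.subst (upSub (single a)))) :=
  have hc := Derives.cons hΓ (hΓ.inst hD ha)
  hb.subst _ _ ((wtSub_single hΓ ha).up hc) hc

theorem beta_two {Γ : List Term} {A D b B x y : Term} {i j : ℕ} (hΓ : Derives (ctx Γ))
    (hA : Derives (typ Γ A (univ i))) (hD : Derives (typ (A :: Γ) D (univ j)))
    (hb : Derives (typ (D :: A :: Γ) b B)) (hx : Derives (typ Γ x A))
    (hy : Derives (typ Γ y (D.inst x))) :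
    Derives (eqv Γ (app (app (lam A (lam D b)) x) y) (inst2 b x y) (inst2 B x y)) := by
  have h1 := Derives.app_eqv (.beta hA (.lam hD hb) hx) (.refl hy)
  have h2 := Derives.beta (hΓ.inst hD hx) (subst_up_typ hΓ hD hb hx) hy
  rw [inst_upSub_single, inst_upSub_single] at h2
  change Derives (eqv Γ _ (app (lam (D.inst x) (b.subst (upSub (single x)))) y) _) at h1
  rw [inst_upSub_single] at h1
  exact h1.trans h2

/-- The `β` rule for a weakened abstraction. -/
theorem beta_rename {Γ Δ : List Term} {A b B a : Term} {i : ℕ} {r : ℕ → ℕ} (hr : WtRen r Γ Δ)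
    (hΔ : Derives (ctx Δ)) (hA : Derives (typ Γ A (univ i))) (hb : Derives (typ (A :: Γ) b B))
    (ha : Derives (typ Δ a (A.rename r))) :
    Derives (eqv Δ (app ((lam A b).rename r) a) (b.subst (scons a (var ∘ r)))
      (B.subst (scons a (var ∘ r)))) := by
  have hA' := hA.rename r Δ hr hΔ
  have h := Derives.beta hA' (hb.rename _ _ (hr.up A) (.cons hΔ hA')) ha
  rwa [inst_upRen, inst_upRen] at h

theorem var_zero_typ {Γ : List Term} {A : Term} (h : Derives (ctx (A :: Γ))) :
    Derives (typ (A :: Γ) (var 0) A.shift) :=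
  .var h rfl

theorem wtRen_two (A B : Term) (Γ : List Term) : WtRen (· + 2) Γ (B :: A :: Γ) := by
  intro n C hC
  refine ⟨C, by simpa using hC, ?_⟩
  simp only [rename_rename]; rfl

section

variable {Γ : List Term}

/-! #### Path types -/

theorem path_typ {A x y : Term} {i : ℕ} (hΓ : Derives (ctx Γ))
    (hA : Derives (typ Γ A (univ i))) (hx : Derives (typ Γ x A)) (hy : Derives (typ Γ y A)) :
    Derives (typ Γ (call (.path i) [A, x, y]) (univ i)) := by
  have h := Derives.app (Derives.const (.path i) hΓ) hA
  simp [U, Arr, Pi, bound, subst, inst] at h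
  replace h := Derives.app h hx
  simp [subst, inst] at h
  exact Derives.app h hy

theorem idPath_typ {A x : Term} {i : ℕ} (hΓ : Derives (ctx Γ))
    (hA : Derives (typ Γ A (univ i))) (hx : Derives (typ Γ x A)) :
    Derives (typ Γ (call (.rfl i) [A, x]) (call (.path i) [A, x, x])) := by
  have h := Derives.app (Derives.const (.rfl i) hΓ) hA
  simp [Pi, bound, subst, inst, Path, appTm, con] at h
  replace h := Derives.app h hx
  simp [subst, inst] at h
  exact h

theorem pathInd_typ_pi {A x P r : Term} {i j : ℕ} (hΓ : Derives (ctx Γ))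
    (hA : Derives (typ Γ A (univ i))) (hx : Derives (typ Γ x A))
    (hP : Derives (typ Γ P (pi A (pi (call (.path i) [A.shift, x.shift, var 0]) (univ j)))))
    (hr : Derives (typ Γ r (app (app P x) (call (.rfl i) [A, x])))) :
    Derives (typ Γ (call (.pathInd i j) [A, x, P, r])
      (pi A (pi (call (.path i) [A.shift, x.shift, var 0])
        (app (app P.shift.shift (var 1)) (var 0))))) := by
  have h := Derives.app (Derives.const (.pathInd i j) hΓ) hA
  simp [U, Arr, Pi, bound, subst, inst, Path, Refl, appTm, con] at h
  replace h := Derives.app h hx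
  simp [subst, inst] at h
  replace h := Derives.app h hP
  simp [subst, inst] at h
  replace h := Derives.app h hr
  simp [subst, inst] at h
  exact h

theorem pathFamily_typ {A x : Term} {i : ℕ} (hΓ : Derives (ctx Γ))
    (hA : Derives (typ Γ A (univ i))) (hx : Derives (typ Γ x A)) :
    Derives (typ (A :: Γ) (call (.path i) [A.shift, x.shift, var 0]) (univ i)) :=
  have hc := Derives.cons hΓ hA
  path_typ hc (hA.weaken hc) (hx.weaken hc) (var_zero_typ hc)

theorem pathFamily_inst (i : ℕ) (A x y : Term) :
    (call (.path i) [A.shift, x.shift, var 0]).inst y = call (.path i) [A, x, y] := by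
  simp [subst, inst]

section

variable {A x C r y p : Term} {i j : ℕ}

/-- Path induction with a motive that is given as a family with two free variables. -/
theorem pathInd_typ_eqv (hΓ : Derives (ctx Γ))
    (hA : Derives (typ Γ A (univ i))) (hx : Derives (typ Γ x A))
    (hC : Derives (typ (call (.path i) [A.shift, x.shift, var 0] :: A :: Γ) C (univ j)))
    (hr : Derives (typ Γ r (inst2 C x (call (.rfl i) [A, x]))))
    (hy : Derives (typ Γ y A)) (hp : Derives (typ Γ p (call (.path i) [A, x, y]))) :
    Derives (typ Γ (call (.pathInd i j)
        [A, x, lam A (lam (call (.path i) [A.shift, x.shift, var 0]) C), r, y, p])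
      (inst2 C y p)) ∧
    (y = x ∨ Derives (eqv Γ y x A) →
      p = call (.rfl i) [A, x] ∨ Derives (eqv Γ p (call (.rfl i) [A, x]) (call (.path i) [A, x, y])) →
      Derives (eqv Γ (call (.pathInd i j)
        [A, x, lam A (lam (call (.path i) [A.shift, x.shift, var 0]) C), r, y, p]) r
      (inst2 C y p))) := by
  have hD := pathFamily_typ hΓ hA hx
  have hP := Derives.lam hA (.lam hD hC)
  have hx' := idPath_typ hΓ hA hx
  have bx := beta_two hΓ hA hD hC hx (by rwa [pathFamily_inst])
  have by_ := beta_two hΓ hA hD hC hy (by rwa [pathFamily_inst])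
  have hr' := hr.conv bx.symm
  have hf := pathInd_typ_pi hΓ hA hx hP hr'
  have ap : ∀ {z q : Term}, Derives (typ Γ z A) → Derives (typ Γ q (call (.path i) [A, x, z])) →
      Derives (typ Γ (call (.pathInd i j)
        [A, x, lam A (lam (call (.path i) [A.shift, x.shift, var 0]) C), r, z, q])
        (app (app (lam A (lam (call (.path i) [A.shift, x.shift, var 0]) C)) z) q)) := by
    intro z q hz hq
    have h := Derives.app hf hz
    simp [subst, inst] at h
    replace h := Derives.app h hq
    simp [subst, inst] at h
    exact h
  refine ⟨(ap hy hp).conv by_, fun hyx hpx => ?_⟩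
  have hyx' : Derives (eqv Γ y x A) := hyx.elim (fun e => e ▸ .refl hy) id
  have hpx' : Derives (eqv Γ p (call (.rfl i) [A, x]) (call (.path i) [A, x, y])) :=
    hpx.elim (fun e => by rw [← e]; exact .refl hp) id
  have h := Derives.app_eqv (.refl hf) hyx'
  simp [subst, inst] at h
  replace h := Derives.app_eqv h hpx'
  simp [subst, inst] at h
  have h2 := Derives.app_eqv (.refl hP) hyx'
  simp [subst, inst] at h2
  replace h2 := Derives.app_eqv h2 hpx'
  have h3 := Derives.comp (.rfl i j A x _ r) (ap hx hx') hr'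
  exact (h.trans (h3.conv_eqv h2.symm)).conv_eqv by_

end

/-! #### Dependent pairs -/

theorem sigma_typ {A F : Term} {i : ℕ} (hΓ : Derives (ctx Γ))
    (hA : Derives (typ Γ A (univ i))) (hF : Derives (typ Γ F (pi A (univ i)))) :
    Derives (typ Γ (call (.sigma i) [A, F]) (univ i)) := by
  have h := Derives.app (Derives.const (.sigma i) hΓ) hA
  simp [U, Arr, Pi, bound, subst, inst] at h
  exact Derives.app h hF

theorem pair_typ {A F x y : Term} {i : ℕ} (hΓ : Derives (ctx Γ))
    (hA : Derives (typ Γ A (univ i))) (hF : Derives (typ Γ F (pi A (univ i))))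
    (hx : Derives (typ Γ x A)) (hy : Derives (typ Γ y (app F x))) :
    Derives (typ Γ (call (.pair i) [A, F, x, y]) (call (.sigma i) [A, F])) := by
  have h := Derives.app (Derives.const (.pair i) hΓ) hA
  simp [U, Arr, Pi, bound, subst, inst, appTm, con] at h
  replace h := Derives.app h hF
  simp [subst, inst] at h
  replace h := Derives.app h hx
  simp [subst, inst] at h
  replace h := Derives.app h hy
  simp [subst, inst] at h
  exact h

/-- The pair rule with the second component typed in the contracted family. -/
theorem pair_typ_lam {A B x y : Term} {i : ℕ} (hΓ : Derives (ctx Γ))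
    (hA : Derives (typ Γ A (univ i))) (hB : Derives (typ (A :: Γ) B (univ i)))
    (hx : Derives (typ Γ x A)) (hy : Derives (typ Γ y (B.inst x))) :
    Derives (typ Γ (call (.pair i) [A, lam A B, x, y]) (call (.sigma i) [A, lam A B])) :=
  pair_typ hΓ hA (.lam hA hB) hx (hy.conv (.symm (.beta hA hB hx)))

theorem sigmaInd_typ_pi {A F P g : Term} {i j : ℕ} (hΓ : Derives (ctx Γ))
    (hA : Derives (typ Γ A (univ i))) (hF : Derives (typ Γ F (pi A (univ i))))
    (hP : Derives (typ Γ P (pi (call (.sigma i) [A, F]) (univ j))))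
    (hg : Derives (typ Γ g (pi A (pi (app F.shift (var 0)) (app P.shift.shift
      (call (.pair i) [A.shift.shift, F.shift.shift, var 1, var 0])))))) :
    Derives (typ Γ (call (.sigmaInd i j) [A, F, P, g])
      (pi (call (.sigma i) [A, F]) (app P.shift (var 0)))) := by
  have h := Derives.app (Derives.const (.sigmaInd i j) hΓ) hA
  simp [U, Arr, Pi, bound, subst, inst, appTm, con] at h
  replace h := Derives.app h hF
  simp [subst, inst] at h
  replace h := Derives.app h hP
  simp [subst, inst] at h
  replace h := Derives.app h hg
  simp [subst, inst] at h
  exact h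

/-- Induction on dependent pairs with a motive that is given as a family with a free variable. -/
theorem sigmaInd_typ_eqv {A B C g z : Term} {i j : ℕ} (hΓ : Derives (ctx Γ))
    (hA : Derives (typ Γ A (univ i))) (hB : Derives (typ (A :: Γ) B (univ i)))
    (hC : Derives (typ (call (.sigma i) [A, lam A B] :: Γ) C (univ j)))
    (hg : Derives (typ Γ g (pi A (pi B (pairInst i A (lam A B) C)))))
    (hz : Derives (typ Γ z (call (.sigma i) [A, lam A B]))) :
    Derives (typ Γ (call (.sigmaInd i j)
      [A, lam A B, lam (call (.sigma i) [A, lam A B]) C, g, z]) (C.inst z)) ∧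
    ∀ x y : Term, Derives (typ Γ x A) → Derives (typ Γ y (B.inst x)) →
      z = call (.pair i) [A, lam A B, x, y] ∨
        Derives (eqv Γ z (call (.pair i) [A, lam A B, x, y]) (call (.sigma i) [A, lam A B])) →
      Derives (eqv Γ (call (.sigmaInd i j)
        [A, lam A B, lam (call (.sigma i) [A, lam A B]) C, g, z]) (app (app g x) y)
        (C.inst z)) ∧
      Derives (eqv Γ (C.inst (call (.pair i) [A, lam A B, x, y])) (C.inst z) (univ j)) := by
  have hF := Derives.lam hA hB
  have hS := sigma_typ hΓ hA hF
  have hP := Derives.lam hS hC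
  have cA := Derives.cons hΓ hA
  have cB := Derives.cons cA hB
  have eB : Derives (eqv (A :: Γ) (app (lam A B).shift (var 0)) B (univ i)) := by
    have h := beta_rename (wtRen_succ A Γ) cA hA hB (var_zero_typ cA)
    rwa [subst_scons_var] at h
  have shift2 : ∀ t : Term, t.shift.shift = t.rename (· + 2) := fun t => by
    simp only [shift, rename_rename]; rfl
  have hp : Derives (typ (B :: A :: Γ)
      (call (.pair i) [A.shift.shift, (lam A B).shift.shift, var 1, var 0])
      (call (.sigma i) [A.shift.shift, (lam A B).shift.shift])) := by
    have h0 := var_zero_typ cB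
    have h1 := (var_zero_typ cA).weaken cB
    exact pair_typ cB ((hA.weaken cA).weaken cB) ((hF.weaken cA).weaken cB) h1
      (h0.conv (eB.symm.rename _ _ (wtRen_succ B _) cB))
  have eC : Derives (eqv (B :: A :: Γ) (app (lam (call (.sigma i) [A, lam A B]) C).shift.shift
      (call (.pair i) [A.shift.shift, (lam A B).shift.shift, var 1, var 0]))
      (pairInst i A (lam A B) C) (univ j)) := by
    rw [shift2 (lam (call (.sigma i) [A, lam A B]) C)]
    refine beta_rename (wtRen_two A B Γ) cB hS hC ?_
    rw [← shift2]
    exact hp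
  have e := Derives.pi_eqv (cumul_le hA (le_max_left i j)) (.refl (cumul_le hA (le_max_left i j)))
    (.symm (.pi_eqv (cumul_le (hB.conv (.refl (.univ i cA))) (le_max_left i j))
      (.symm (cumul_eqv_le eB (le_max_left i j)))
      (.symm (cumul_eqv_le eC (le_max_right i j)))))
  have hg' := hg.conv e.symm
  have hf := sigmaInd_typ_pi hΓ hA hF hP hg'
  have ap : ∀ {w : Term}, Derives (typ Γ w (call (.sigma i) [A, lam A B])) →
      Derives (typ Γ (call (.sigmaInd i j)
        [A, lam A B, lam (call (.sigma i) [A, lam A B]) C, g, w])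
        (app (lam (call (.sigma i) [A, lam A B]) C) w)) := by
    intro w hw
    have h := Derives.app hf hw
    simp [inst, subst] at h
    exact h
  have bz := Derives.beta hS hC hz
  refine ⟨(ap hz).conv bz, fun x y hx hy hzp => ?_⟩
  have hzp' : Derives (eqv Γ z (call (.pair i) [A, lam A B, x, y])
      (call (.sigma i) [A, lam A B])) := hzp.elim (fun e => by rw [← e]; exact .refl hz) id
  have hxy := pair_typ_lam hΓ hA hB hx hy
  have h := Derives.app_eqv (.refl hf) hzp'
  simp [inst, subst] at h
  have h2 := Derives.app_eqv (.refl hP) hzp'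
  have hr := Derives.app hg hx
  replace hr := Derives.app hr hy
  rw [inst_upSub_single, inst2_pairInst] at hr
  have bxy := Derives.beta hS hC hxy
  have h3 := Derives.comp (.pair i j A (lam A B) _ g x y) (ap hxy) (hr.conv bxy.symm)
  exact ⟨(h.trans (h3.conv_eqv h2.symm)).conv_eqv bz, bxy.symm.trans (h2.symm.trans bz)⟩

/-! #### Binary sums -/

theorem sum_typ {A B : Term} {i : ℕ} (hΓ : Derives (ctx Γ))
    (hA : Derives (typ Γ A (univ i))) (hB : Derives (typ Γ B (univ i))) :
    Derives (typ Γ (call (.sum i) [A, B]) (univ i)) := by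
  have h := Derives.app (Derives.const (.sum i) hΓ) hA
  simp [U, Arr, Pi, subst, inst] at h
  exact Derives.app h hB

theorem inl_typ {A B x : Term} {i : ℕ} (hΓ : Derives (ctx Γ)) (hA : Derives (typ Γ A (univ i)))
    (hB : Derives (typ Γ B (univ i))) (hx : Derives (typ Γ x A)) :
    Derives (typ Γ (call (.inl i) [A, B, x]) (call (.sum i) [A, B])) := by
  have h := Derives.app (Derives.const (.inl i) hΓ) hA
  simp [U, Arr, Pi, bound, subst, inst, appTm, con] at h
  replace h := Derives.app h hB
  simp [subst, inst] at h
  replace h := Derives.app h hx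
  simp [subst, inst] at h
  exact h

theorem inr_typ {A B x : Term} {i : ℕ} (hΓ : Derives (ctx Γ)) (hA : Derives (typ Γ A (univ i)))
    (hB : Derives (typ Γ B (univ i))) (hx : Derives (typ Γ x B)) :
    Derives (typ Γ (call (.inr i) [A, B, x]) (call (.sum i) [A, B])) := by
  have h := Derives.app (Derives.const (.inr i) hΓ) hA
  simp [U, Arr, Pi, bound, subst, inst, appTm, con] at h
  replace h := Derives.app h hB
  simp [subst, inst] at h
  replace h := Derives.app h hx
  simp [subst, inst] at h
  exact h

/-- Case analysis with a motive that is given as a family with a free variable. -/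
theorem sumInd_typ {A B C l r z : Term} {i j : ℕ} (hΓ : Derives (ctx Γ))
    (hA : Derives (typ Γ A (univ i))) (hB : Derives (typ Γ B (univ i)))
    (hC : Derives (typ (call (.sum i) [A, B] :: Γ) C (univ j)))
    (hl : Derives (typ Γ l (pi A (injInst (.inl i) A B C))))
    (hr : Derives (typ Γ r (pi B (injInst (.inr i) A B C))))
    (hz : Derives (typ Γ z (call (.sum i) [A, B]))) :
    Derives (typ Γ (call (.sumInd i j) [A, B, lam (call (.sum i) [A, B]) C, l, r, z])
      (C.inst z)) := by
  have hS := sum_typ hΓ hA hB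
  have hP := Derives.lam hS hC
  have cA := Derives.cons hΓ hA
  have cB := Derives.cons hΓ hB
  have el : Derives (eqv (A :: Γ) (app (lam (call (.sum i) [A, B]) C).shift
      (call (.inl i) [A.shift, B.shift, var 0])) (injInst (.inl i) A B C) (univ j)) :=
    beta_rename (wtRen_succ A Γ) cA hS hC
      (inl_typ cA (hA.weaken cA) (hB.weaken cA) (var_zero_typ cA))
  have er : Derives (eqv (B :: Γ) (app (lam (call (.sum i) [A, B]) C).shift
      (call (.inr i) [A.shift, B.shift, var 0])) (injInst (.inr i) A B C) (univ j)) :=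
    beta_rename (wtRen_succ B Γ) cB hS hC
      (inr_typ cB (hA.weaken cB) (hB.weaken cB) (var_zero_typ cB))
  have e : ∀ {D E E' : Term}, Derives (typ Γ D (univ i)) →
      Derives (eqv (D :: Γ) E E' (univ j)) →
      Derives (eqv Γ (pi D E') (pi D E) (univ (max i j))) := fun hD hE =>
    have hD' := cumul_le hD (le_max_left i j)
    .symm (.pi_eqv hD' (.refl hD') (cumul_eqv_le hE (le_max_right i j)))
  have h := Derives.app (Derives.const (.sumInd i j) hΓ) hA
  simp [U, Arr, Pi, bound, subst, inst, appTm, con] at h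
  replace h := Derives.app h hB
  simp [subst, inst] at h
  replace h := Derives.app h hP
  simp [subst, inst] at h
  replace h := Derives.app h (hl.conv (e hA el))
  simp [subst, inst] at h
  replace h := Derives.app h (hr.conv (e hB er))
  simp [subst, inst] at h
  replace h := Derives.app h hz
  simp [subst, inst] at h
  exact h.conv (.beta hS hC hz)

end

/-! ### A type checker -/

/-- Equality of terms, as a structurally recursive function that evaluates fast. -/
def Term.same : Term → Term → Bool
  | .var m, .var n => m == n
  | .univ i, .univ j => i == j
  | .pi A B, .pi A' B' => A.same A' && B.same B'
  | .lam A b, .lam A' b' => A.same A' && b.same b'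
  | .app f a, .app f' a' => f.same f' && a.same a'
  | .const c, .const c' => decide (c = c')
  | _, _ => false

/-- For an application `f s` that looks like the left-hand side of a computation rule: the instance
`l ≡ r` of the rule whose left-hand side `l` should be judgmentally equal to `f s`. The parameters
that are determined by `f` are taken from there; those in `s` may differ from them. -/
def contract : Term → Term → Option (Term × Term)
  | .app (.app (.app (.app (.app (.const (.sumInd i j)) A) B) P) l) r, s =>
    match s with
    | .app (.app (.app (.const (.inl _)) _) _) a =>
      some (call (.sumInd i j) [A, B, P, l, r, call (.inl i) [A, B, a]], app l a)
    | .app (.app (.app (.const (.inr _)) _) _) b =>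
      some (call (.sumInd i j) [A, B, P, l, r, call (.inr i) [A, B, b]], app r b)
    | _ => none
  | .app (.app (.app (.app (.const (.sigmaInd i j)) A) B) P) g, s =>
    match s with
    | .app (.app (.app (.app (.const (.pair _)) _) _) a) b =>
      some (call (.sigmaInd i j) [A, B, P, g, call (.pair i) [A, B, a, b]], app (app g a) b)
    | _ => none
  | .app (.app (.app (.app (.app (.const (.pathInd i j)) A) a) P) r) _, s =>
    match s with
    | .app (.app (.const (.rfl _)) _) _ =>
      some (call (.pathInd i j) [A, a, P, r, a, call (.rfl i) [A, a]], r)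
    | _ => none
  | .app (.app (.app (.app (.const (.oneInd i j)) A) P) g) q, s =>
    match s with
    | .app (.app (.const (.oneF _)) _) a =>
      some (call (.oneInd i j) [A, P, g, q, call (.oneF i) [A, a]], app g a)
    | _ => none
  | .app (.app (.app (.app (.const (.trInd n i j)) A) P) h) g, s =>
    match s with
    | .app (.app (.const (.trMk _ _)) _) a =>
      some (call (.trInd n i j) [A, P, h, g, call (.trMk n i) [A, a]], app g a)
    | _ => none
  | _, _ => none

/-- Untyped weak head reduction with bounded recursion depth. It only serves to guess the shape of
the main argument of an induction principle. -/
def hint : ℕ → Term → Term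
  | n + 1, .app f a =>
    match hint n f with
    | .lam _ b => hint n (b.inst a)
    | f' => match contract f' (hint n a) with
      | some (_, r) => hint n r
      | none => .app f' a
  | _, t => t

/-- The reduction and conversion tests that the type checker calls. Their answers may depend on a
context. -/
structure Oracle where
  /-- A reduced form of a type that is not in weak head normal form, and a universe in which the two
  are judgmentally equal. -/
  whTy : List Term → Term → Option (Term × ℕ)
  /-- A reduced form of a term of a given type. -/
  whTm : List Term → Term → Term → Term
  /-- Conversion of types; the answer is a universe in which they are judgmentally equal. -/
  cvTy : List Term → Term → Term → Option ℕ
  /-- Conversion of terms of a given type. -/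
  cvTm : List Term → Term → Term → Term → Bool
  /-- Conversion of applications by comparison of functions and arguments; the answer is a type at
  which the terms are judgmentally equal. -/
  cvNe : List Term → Term → Term → Option Term
  /-- The recursion depth of `hint`. -/
  fuel : ℕ

namespace Oracle

variable (K : Oracle)

/-- Domain and codomain of a type that is judgmentally equal to a function type. -/
def asPi (Γ : List Term) : Term → Option (Term × Term)
  | .pi A B => some (A, B)
  | F => match K.whTy Γ F with
    | some (.pi A B, _) => some (A, B)
    | _ => none

/-- The level of a type that is judgmentally equal to a universe. -/
def asU (Γ : List Term) : Term → Option ℕ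
  | .univ i => some i
  | F => match K.whTy Γ F with
    | some (.univ i, _) => some i
    | _ => none

/-- Elements of `S` are elements of `T`, by conversion or cumulativity. -/
def sub (Γ : List Term) (S T : Term) : Bool :=
  S.same T ||
  match S, T with
  | .univ i, .univ j => i ≤ j
  | .univ i, T => match asU K Γ T with
    | some j => i ≤ j
    | none => false
  | S, T => (K.cvTy Γ S T).isSome

/-- Compare the inferred type `S` with the expected type, if there is one. -/
def fit (Γ : List Term) : Option Term → Term → Option Term
  | none, S => some S
  | some T, S => if sub K Γ S T then some T else none

/-- The type of a term in a context: inferred if the last argument is `none`, checked against `T` if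
it is `some T`. The induction principles of `=`, `Σ` and `+`, and pairs, are treated separately if
they have all their arguments and the families among them are abstractions. They then have the type
that is expected when substitution takes the place of `β`-redexes. -/
def ty : Term → List Term → Option Term → Option Term
  | .var n, Γ, e => match Γ[n]? with
    | some A => fit K Γ e (A.rename (· + (n + 1)))
    | none => none
  | .univ i, Γ, e => fit K Γ e (.univ (i + 1))
  | .const c, Γ, e => fit K Γ e c.type
  | .pi A B, Γ, e =>
    (ty A Γ none).bind fun S => (asU K Γ S).bind fun i =>
    (ty B (A :: Γ) none).bind fun S' => (asU K (A :: Γ) S').bind fun j =>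
    fit K Γ e (.univ (max i j))
  | .lam A b, Γ, none =>
    (ty A Γ none).bind fun S => (asU K Γ S).bind fun _ =>
    (ty b (A :: Γ) none).bind fun B => some (.pi A B)
  | .lam A b, Γ, some T =>
    (ty A Γ none).bind fun S => (asU K Γ S).bind fun _ =>
    (asPi K Γ T).bind fun P =>
      if P.1.same A then
        (ty b (A :: Γ) (some P.2)).bind fun _ => some T
      else
        (ty b (A :: Γ) none).bind fun B => fit K Γ (some T) (.pi A B)
  | .app (.app (.app (.app (.app (.app (.const (.pathInd i j)) A) x) (.lam A' (.lam D C))) r) y) p,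
      Γ, e =>
    if A'.same A && D.same (call (.path i) [A.shift, x.shift, .var 0]) then
      (ty A Γ (some (.univ i))).bind fun _ =>
      (ty x Γ (some A)).bind fun _ =>
      (ty C (D :: A' :: Γ) (some (.univ j))).bind fun _ =>
      (ty r Γ (some (inst2 C x (call (.rfl i) [A, x])))).bind fun _ =>
      (ty y Γ (some A)).bind fun _ =>
      (ty p Γ (some (call (.path i) [A, x, y]))).bind fun _ =>
      fit K Γ e (inst2 C y p)
    else none
  | .app (.app (.app (.app (.const (.pair i)) A) (.lam A' B)) a) b, Γ, e =>
    if A'.same A then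
      (ty A Γ (some (.univ i))).bind fun _ =>
      (ty B (A' :: Γ) (some (.univ i))).bind fun _ =>
      (ty a Γ (some A)).bind fun _ =>
      (ty b Γ (some (B.inst a))).bind fun _ =>
      fit K Γ e (call (.sigma i) [A, .lam A' B])
    else none
  | .app (.app (.app (.app (.app (.const (.sigmaInd i j)) A) (.lam A' B)) (.lam S C)) g) z, Γ, e =>
    if A'.same A && S.same (call (.sigma i) [A, .lam A' B]) then
      (ty A Γ (some (.univ i))).bind fun _ =>
      (ty B (A' :: Γ) (some (.univ i))).bind fun _ =>
      (ty C (S :: Γ) (some (.univ j))).bind fun _ =>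
      (ty g Γ (some (.pi A (.pi B (pairInst i A (.lam A' B) C))))).bind fun _ =>
      (ty z Γ (some S)).bind fun _ =>
      fit K Γ e (C.inst z)
    else none
  | .app (.app (.app (.app (.app (.app (.const (.sumInd i j)) A) B) (.lam S C)) l) r) z, Γ, e =>
    if S.same (call (.sum i) [A, B]) then
      (ty A Γ (some (.univ i))).bind fun _ =>
      (ty B Γ (some (.univ i))).bind fun _ =>
      (ty C (S :: Γ) (some (.univ j))).bind fun _ =>
      (ty l Γ (some (.pi A (injInst (.inl i) A B C)))).bind fun _ =>
      (ty r Γ (some (.pi B (injInst (.inr i) A B C)))).bind fun _ =>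
      (ty z Γ (some S)).bind fun _ =>
      fit K Γ e (C.inst z)
    else none
  | .app f a, Γ, e =>
    (ty f Γ none).bind fun F => (asPi K Γ F).bind fun P =>
    (ty a Γ (some P.1)).bind fun _ => fit K Γ e (P.2.inst a)

/-- A weak head reduction step, with a type at which the two terms are judgmentally equal. -/
def red (Γ : List Term) : Term → Option (Term × Term)
  | .app (.app (.app (.app (.app (.app (.const (.pathInd i j)) A) x) (.lam A' (.lam D C))) r) y)
      p =>
    match hint K.fuel p with
    | .app (.app (.const (.rfl _)) _) _ =>
      (ty K (call (.pathInd i j) [A, x, .lam A' (.lam D C), r, y, p]) Γ none).bind fun T =>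
      if (y.same x || K.cvTm Γ y x A) && (p.same (call (.rfl i) [A, x]) ||
          K.cvTm Γ p (call (.rfl i) [A, x]) (call (.path i) [A, x, y]))
      then some (r, T) else none
    | _ => none
  | .app (.app (.app (.app (.app (.const (.sigmaInd i j)) A) (.lam A' B)) (.lam S C)) g) z =>
    match hint K.fuel z with
    | .app (.app (.app (.app (.const (.pair _)) _) _) x) y =>
      (ty K (call (.sigmaInd i j) [A, .lam A' B, .lam S C, g, z]) Γ none).bind fun T =>
      (ty K x Γ (some A)).bind fun _ => (ty K y Γ (some (B.inst x))).bind fun _ =>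
      if z.same (call (.pair i) [A, .lam A' B, x, y]) ||
          K.cvTm Γ z (call (.pair i) [A, .lam A' B, x, y]) S
      then match g with
        | .lam A₁ (.lam B₁ b) =>
          some (if A₁.same A && B₁.same B then inst2 b x y else .app (.app g x) y, T)
        | g => some (.app (.app g x) y, T)
      else none
    | _ => none
  | .app (.lam A b) a =>
    (ty K A Γ none).bind fun S => (asU K Γ S).bind fun _ =>
    (ty K b (A :: Γ) none).bind fun B =>
    (ty K a Γ (some A)).bind fun _ => some (b.inst a, B.inst a)
  | .app f a =>
    match contract f (hint K.fuel a) with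
    | some (l, r) =>
      if l.same (.app f a) then
        (ty K l Γ none).bind fun T => (ty K r Γ (some T)).bind fun _ => some (r, T)
      else
        (K.cvNe Γ (.app f a) l).bind fun T => (ty K l Γ (some T)).bind fun _ =>
        (ty K r Γ (some T)).bind fun _ => some (r, T)
    | none =>
      (red Γ f).bind fun fF => (asPi K Γ fF.2).bind fun P =>
      (ty K a Γ (some P.1)).bind fun _ => some (.app fF.1 a, P.2.inst a)
  | _ => none

/-- `whTy` with one more reduction step. -/
def whTyStep (Γ : List Term) (A : Term) : Option (Term × ℕ) :=
  match red K Γ A with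
  | some (A', T) =>
    (asU K Γ T).bind fun i =>
    match K.whTy Γ A' with
    | some (A'', j) => some (A'', max i j)
    | none => some (A', i)
  | none => none

/-- `whTm` with one more reduction step. -/
def whTmStep (Γ : List Term) (a A : Term) : Term :=
  match red K Γ a with
  | some (a', T) => if T.same A || (K.cvTy Γ T A).isSome then K.whTm Γ a' A else a
  | none => a

/-- `whTy`, where a type that does not reduce is its own reduced form. -/
def whD (Γ : List Term) (A : Term) : Term × ℕ := (K.whTy Γ A).getD (A, 0)

/-- Conversion of types: comparison of the weak head normal forms. -/
def cvTyStep (Γ : List Term) (A B : Term) : Option ℕ :=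
  if A.same B then some 0 else
  match whD K Γ A, whD K Γ B with
  | (.univ i, k), (.univ j, l) => if i == j then some (max (i + 1) (max k l)) else none
  | (.pi A B, k), (.pi A' B', l) =>
    (ty K A Γ none).bind fun S => (asU K Γ S).bind fun i =>
    (ty K B (A :: Γ) none).bind fun S' => (asU K (A :: Γ) S').bind fun j =>
    (K.cvTy Γ A A').bind fun m => (K.cvTy (A :: Γ) B B').bind fun n =>
    some (max (max k l) (max (max i j) (max m n)))
  | (A, k), (B, l) =>
    (K.cvNe Γ A B).bind fun T => (asU K Γ T).bind fun m => some (max m (max k l))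

/-- Conversion of functions by the `η` rule: comparison of the values at a variable. -/
def cvEta (Γ : List Term) (a b C D : Term) : Bool :=
  ((ty K C Γ none).bind (asU K Γ)).isSome && (ty K a Γ (some (.pi C D))).isSome &&
  (ty K b Γ (some (.pi C D))).isSome &&
  K.cvTm (C :: Γ) (.app a.shift (.var 0)) (.app b.shift (.var 0)) D

/-- Conversion of two applications of the same function, by comparison of the arguments. -/
def congr (Γ : List Term) : Term → Term → Term → Bool
  | .app f a, .app g b, A => f.same g &&
    match K.cvNe Γ (.app f a) (.app g b) with
    | some T => T.same A || (K.cvTy Γ T A).isSome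
    | none => false
  | _, _, _ => false

/-- Conversion of terms, directed by the type. -/
def cvTmStep (Γ : List Term) (a b A : Term) : Bool :=
  a.same b || congr K Γ a b A ||
  match (whD K Γ A).1 with
  | .pi C D =>
    match a, b with
    | .lam C₁ a', .lam C₂ b' =>
      if C₁.same C && C₂.same C then
        ((ty K C Γ none).bind (asU K Γ)).isSome &&
        (ty K a' (C :: Γ) (some D)).isSome && K.cvTm (C :: Γ) a' b' D
      else cvEta K Γ a b C D
    | _, _ => cvEta K Γ a b C D
  | .univ i => match K.cvTy Γ a b with
    | some k => k ≤ i
    | none => false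
  | _ => match K.cvNe Γ (K.whTm Γ a A) (K.whTm Γ b A) with
    | some T => T.same A || (K.cvTy Γ T A).isSome
    | none => false

/-- Conversion of applications by comparison of functions and arguments. -/
def cvNeStep (Γ : List Term) (t u : Term) : Option Term :=
  if t.same u then ty K t Γ none else
  match t, u with
  | .app f a, .app g b =>
    (K.cvNe Γ f g).bind fun F => (asPi K Γ F).bind fun P =>
    (ty K a Γ (some P.1)).bind fun _ => (ty K b Γ (some P.1)).bind fun _ =>
    if K.cvTm Γ a b P.1 then some (P.2.inst a) else none
  | _, _ => none

end Oracle

open Oracle in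
/-- The tests with recursion depth `n`. At depth `0` they give up. -/
def oracle : ℕ → Oracle
  | 0 => ⟨fun _ _ => none, fun _ a _ => a, fun _ _ _ => none, fun _ _ _ _ => false,
      fun _ _ _ => none, 0⟩
  | n + 1 => ⟨whTyStep (oracle n), whTmStep (oracle n), cvTyStep (oracle n),
      cvTmStep (oracle n), cvNeStep (oracle n), n + 1⟩

/-! ### Soundness of the type checker -/

theorem Term.same_iff {s t : Term} : s.same t = true ↔ s = t := by
  induction s generalizing t <;> cases t <;> simp_all [Term.same]

theorem contract_comp {f a l r : Term} (h : contract f a = some (l, r)) : Comp l r := by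
  unfold contract at h
  split at h
  all_goals first
    | (split at h <;> first
        | (obtain ⟨rfl, rfl⟩ := by simpa using h
           constructor)
        | simp at h)
    | simp at h

/-- Equal terms, or judgmentally equal types. -/
def TyEq (Γ : List Term) (A B : Term) : Prop := A = B ∨ ∃ k, Derives (eqv Γ A B (univ k))

theorem TyEq.conv {Γ : List Term} {A B t : Term} (h : TyEq Γ A B) (ht : Derives (typ Γ t A)) :
    Derives (typ Γ t B) := by
  obtain rfl | ⟨k, h⟩ := h
  · exact ht
  · exact ht.conv h

theorem TyEq.conv_eqv {Γ : List Term} {A B t u : Term} (h : TyEq Γ A B)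
    (ht : Derives (eqv Γ t u A)) : Derives (eqv Γ t u B) := by
  obtain rfl | ⟨k, h⟩ := h
  · exact ht
  · exact ht.conv_eqv h

theorem TyEq.symm {Γ : List Term} {A B : Term} (h : TyEq Γ A B) : TyEq Γ B A := by
  obtain rfl | ⟨k, h⟩ := h
  · exact .inl rfl
  · exact .inr ⟨k, h.symm⟩

namespace Oracle

/-- The answers of the oracle are derivable. -/
structure Sound (K : Oracle) : Prop where
  whTy : ∀ {Γ A A' k}, Derives (ctx Γ) → K.whTy Γ A = some (A', k) → Derives (eqv Γ A A' (univ k))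
  whTm : ∀ {Γ a A}, Derives (ctx Γ) → a = K.whTm Γ a A ∨ Derives (eqv Γ a (K.whTm Γ a A) A)
  cvTy : ∀ {Γ A B k}, Derives (ctx Γ) → K.cvTy Γ A B = some k →
    A = B ∨ Derives (eqv Γ A B (univ k))
  cvTm : ∀ {Γ a b A}, Derives (ctx Γ) → K.cvTm Γ a b A = true → a = b ∨ Derives (eqv Γ a b A)
  cvNe : ∀ {Γ t u T}, Derives (ctx Γ) → K.cvNe Γ t u = some T → Derives (eqv Γ t u T)

variable {K : Oracle}

theorem Sound.asPi (hK : K.Sound) {Γ : List Term} {F : Term} {P : Term × Term}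
    (hΓ : Derives (ctx Γ)) (h : asPi K Γ F = some P) : TyEq Γ F (pi P.1 P.2) := by
  unfold Oracle.asPi at h
  split at h
  · obtain rfl := by simpa using h
    exact .inl rfl
  · split at h
    · next e =>
      obtain rfl := by simpa using h
      exact .inr ⟨_, hK.whTy hΓ e⟩
    · simp at h

theorem Sound.asU (hK : K.Sound) {Γ : List Term} {F : Term} {i : ℕ}
    (hΓ : Derives (ctx Γ)) (h : asU K Γ F = some i) : TyEq Γ F (univ i) := by
  unfold Oracle.asU at h
  split at h
  · obtain rfl := by simpa using h
    exact .inl rfl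
  · split at h
    · next e =>
      obtain rfl := by simpa using h
      exact .inr ⟨_, hK.whTy hΓ e⟩
    · simp at h

theorem Sound.tyEq_of_cvTy (hK : K.Sound) {Γ : List Term} {A B : Term} (hΓ : Derives (ctx Γ))
    (h : A.same B = true ∨ (K.cvTy Γ A B).isSome) : TyEq Γ A B := by
  obtain h | h := h
  · exact .inl (Term.same_iff.1 h)
  · obtain ⟨k, hk⟩ := Option.isSome_iff_exists.1 h
    exact (hK.cvTy hΓ hk).imp id fun h => ⟨k, h⟩

theorem Sound.sub (hK : K.Sound) {Γ : List Term} {S T t : Term} (hΓ : Derives (ctx Γ))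
    (h : sub K Γ S T = true) (ht : Derives (typ Γ t S)) : Derives (typ Γ t T) := by
  unfold Oracle.sub at h
  rw [Bool.or_eq_true] at h
  obtain h | h := h
  · rwa [← Term.same_iff.1 h]
  · split at h
    · exact cumul_le ht (by simpa using h)
    · split at h
      · next e => exact (hK.asU hΓ e).symm.conv (cumul_le ht (by simpa using h))
      · simp at h
    · exact (hK.tyEq_of_cvTy hΓ (.inr h)).conv ht

theorem Sound.fit (hK : K.Sound) {Γ : List Term} {S T t : Term} {e : Option Term}
    (hΓ : Derives (ctx Γ)) (h : fit K Γ e S = some T) (ht : Derives (typ Γ t S)) :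
    Derives (typ Γ t T) ∧ ∀ T₀, e = some T₀ → T = T₀ := by
  unfold Oracle.fit at h
  split at h
  · obtain rfl := by simpa using h
    exact ⟨ht, by simp⟩
  · split at h
    · next hs =>
      obtain rfl := by simpa using h
      exact ⟨hK.sub hΓ hs ht, by simp⟩
    · simp at h

/-- What the type checker computes is derivable, and checking mode returns the given type. -/
theorem Sound.ty (hK : K.Sound) (t : Term) (Γ : List Term) (e : Option Term) :
    ∀ T, Derives (ctx Γ) → ty K t Γ e = some T →
      Derives (typ Γ t T) ∧ ∀ T₀, e = some T₀ → T = T₀ := by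
  fun_induction Oracle.ty K t Γ e <;> intro T hΓ h <;>
    try simp only [Option.bind_eq_some_iff, reduceCtorEq] at h
  · next hA => exact hK.fit hΓ h (.var hΓ hA)
  · exact hK.fit hΓ h (.univ _ hΓ)
  · exact hK.fit hΓ h (.const _ hΓ)
  · next ihA ihB =>
    obtain ⟨S, hS, i, hi, S', hS', j, hj, h⟩ := h
    have hA := (hK.asU hΓ hi).conv (ihA S hΓ hS).1
    have hc := Derives.cons hΓ hA
    have hB := (hK.asU hc hj).conv (ihB S' hc hS').1
    exact hK.fit hΓ h (.pi (cumul_le hA (le_max_left i j)) (cumul_le hB (le_max_right i j)))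
  · next ihA ihb =>
    obtain ⟨S, hS, i, hi, B, hB, h⟩ := h
    obtain rfl := by simpa using h
    have hA := (hK.asU hΓ hi).conv (ihA S hΓ hS).1
    exact ⟨.lam hA (ihb B (.cons hΓ hA) hB).1, by simp⟩
  · next ihA ihb ihb' =>
    obtain ⟨S, hS, i, hi, P, hP, h⟩ := h
    have hA := (hK.asU hΓ hi).conv (ihA S hΓ hS).1
    have hc := Derives.cons hΓ hA
    split at h
    · next hs =>
      rw [Option.bind_eq_some_iff] at h
      obtain ⟨B, hB, h⟩ := h
      obtain rfl := by simpa using h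
      have hb := ihb P B hc hB
      obtain rfl := hb.2 _ rfl
      have hP' := (hK.asPi hΓ hP).symm
      rw [Term.same_iff.1 hs] at hP'
      exact ⟨hP'.conv (.lam hA hb.1), by simp⟩
    · rw [Option.bind_eq_some_iff] at h
      obtain ⟨B, hB, h⟩ := h
      exact hK.fit hΓ h (.lam hA (ihb' B hc hB).1)
  · next hs ihA ihx ihC ihr ihy ihp =>
    rw [Bool.and_eq_true, Term.same_iff, Term.same_iff] at hs
    obtain ⟨rfl, rfl⟩ := hs
    obtain ⟨_, hA, _, hx, _, hC, _, hr, _, hy, _, hp, h⟩ := h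
    replace hA := ihA _ hΓ hA
    replace hx := ihx _ hΓ hx
    obtain rfl := hA.2 _ rfl
    obtain rfl := hx.2 _ rfl
    replace hC := ihC _ (.cons (.cons hΓ hA.1) (pathFamily_typ hΓ hA.1 hx.1)) hC
    replace hr := ihr _ hΓ hr
    replace hy := ihy _ hΓ hy
    replace hp := ihp _ hΓ hp
    obtain rfl := hC.2 _ rfl
    obtain rfl := hr.2 _ rfl
    obtain rfl := hy.2 _ rfl
    obtain rfl := hp.2 _ rfl
    exact hK.fit hΓ h (pathInd_typ_eqv hΓ hA.1 hx.1 hC.1 hr.1 hy.1 hp.1).1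
  · next hs ihA ihB iha ihb =>
    obtain rfl := Term.same_iff.1 hs
    obtain ⟨_, hA, _, hB, _, ha, _, hb, h⟩ := h
    replace hA := ihA _ hΓ hA
    obtain rfl := hA.2 _ rfl
    replace hB := ihB _ (.cons hΓ hA.1) hB
    replace ha := iha _ hΓ ha
    replace hb := ihb _ hΓ hb
    obtain rfl := hB.2 _ rfl
    obtain rfl := ha.2 _ rfl
    obtain rfl := hb.2 _ rfl
    exact hK.fit hΓ h (pair_typ_lam hΓ hA.1 hB.1 ha.1 hb.1)
  · next hs ihA ihB ihC ihg ihz =>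
    rw [Bool.and_eq_true, Term.same_iff, Term.same_iff] at hs
    obtain ⟨rfl, rfl⟩ := hs
    obtain ⟨_, hA, _, hB, _, hC, _, hg, _, hz, h⟩ := h
    replace hA := ihA _ hΓ hA
    obtain rfl := hA.2 _ rfl
    replace hB := ihB _ (.cons hΓ hA.1) hB
    obtain rfl := hB.2 _ rfl
    replace hC := ihC _ (.cons hΓ (sigma_typ hΓ hA.1 (.lam hA.1 hB.1))) hC
    replace hg := ihg _ hΓ hg
    replace hz := ihz _ hΓ hz
    obtain rfl := hC.2 _ rfl
    obtain rfl := hg.2 _ rfl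
    obtain rfl := hz.2 _ rfl
    exact hK.fit hΓ h (sigmaInd_typ_eqv hΓ hA.1 hB.1 hC.1 hg.1 hz.1).1
  · next hs ihA ihB ihC ihl ihr ihz =>
    obtain rfl := Term.same_iff.1 hs
    obtain ⟨_, hA, _, hB, _, hC, _, hl, _, hr, _, hz, h⟩ := h
    replace hA := ihA _ hΓ hA
    replace hB := ihB _ hΓ hB
    obtain rfl := hA.2 _ rfl
    obtain rfl := hB.2 _ rfl
    replace hC := ihC _ (.cons hΓ (sum_typ hΓ hA.1 hB.1)) hC
    replace hl := ihl _ hΓ hl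
    replace hr := ihr _ hΓ hr
    replace hz := ihz _ hΓ hz
    obtain rfl := hC.2 _ rfl
    obtain rfl := hl.2 _ rfl
    obtain rfl := hr.2 _ rfl
    obtain rfl := hz.2 _ rfl
    exact hK.fit hΓ h (sumInd_typ hΓ hA.1 hB.1 hC.1 hl.1 hr.1 hz.1)
  · next ihf iha =>
    obtain ⟨F, hF, P, hP, _, ha, h⟩ := h
    replace ha := iha P _ hΓ ha
    obtain rfl := ha.2 _ rfl
    exact hK.fit hΓ h (.app ((hK.asPi hΓ hP).conv (ihf _ hΓ hF).1) ha.1)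

theorem Sound.ty_none (hK : K.Sound) {t T : Term} {Γ : List Term} (hΓ : Derives (ctx Γ))
    (h : Oracle.ty K t Γ none = some T) : Derives (typ Γ t T) :=
  (hK.ty t Γ none T hΓ h).1

theorem Sound.ty_some (hK : K.Sound) {t T₀ T : Term} {Γ : List Term} (hΓ : Derives (ctx Γ))
    (h : Oracle.ty K t Γ (some T₀) = some T) : Derives (typ Γ t T₀) := by
  obtain ⟨h, h'⟩ := hK.ty t Γ _ T hΓ h
  rwa [← h' T₀ rfl]

theorem Sound.ty_isSome (hK : K.Sound) {t T₀ : Term} {Γ : List Term} (hΓ : Derives (ctx Γ))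
    (h : (Oracle.ty K t Γ (some T₀)).isSome = true) : Derives (typ Γ t T₀) :=
  have ⟨_, h⟩ := Option.isSome_iff_exists.1 h
  hK.ty_some hΓ h

theorem Sound.ty_univ (hK : K.Sound) {A S : Term} {i : ℕ} {Γ : List Term} (hΓ : Derives (ctx Γ))
    (h : Oracle.ty K A Γ none = some S) (hi : Oracle.asU K Γ S = some i) :
    Derives (typ Γ A (univ i)) :=
  (hK.asU hΓ hi).conv (hK.ty_none hΓ h)

theorem Sound.cvTm_or_same (hK : K.Sound) {Γ : List Term} {a b A : Term} (hΓ : Derives (ctx Γ))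
    (h : (a.same b || K.cvTm Γ a b A) = true) : a = b ∨ Derives (eqv Γ a b A) := by
  rw [Bool.or_eq_true, Term.same_iff] at h
  exact h.elim .inl (hK.cvTm hΓ)

theorem Sound.red (hK : K.Sound) (Γ : List Term) (t : Term) :
    ∀ t' T, Derives (ctx Γ) → red K Γ t = some (t', T) → Derives (eqv Γ t t' T) := by
  fun_induction Oracle.red K Γ t <;> intro t' T hΓ h <;>
    try simp only [Option.bind_eq_some_iff, reduceCtorEq] at h
  · obtain ⟨T', hT, h⟩ := h
    split at h
    · next hc =>
      rw [Bool.and_eq_true] at hc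
      simp only [Option.some.injEq, Prod.mk.injEq] at h
      obtain ⟨rfl, rfl⟩ := h
      simp only [call, List.foldl] at hT
      rw [Oracle.ty] at hT
      split at hT
      · next hs =>
        rw [Bool.and_eq_true, Term.same_iff, Term.same_iff] at hs
        obtain ⟨rfl, rfl⟩ := hs
        simp only [Option.bind_eq_some_iff] at hT
        obtain ⟨_, hA, _, hx, _, hC, _, hr, _, hy, _, hp, hT⟩ := hT
        obtain rfl : inst2 _ _ _ = _ := Option.some.inj hT
        replace hA := hK.ty_some hΓ hA
        replace hx := hK.ty_some hΓ hx
        replace hC := hK.ty_some (.cons (.cons hΓ hA) (pathFamily_typ hΓ hA hx)) hC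
        exact (pathInd_typ_eqv hΓ hA hx hC (hK.ty_some hΓ hr) (hK.ty_some hΓ hy)
          (hK.ty_some hΓ hp)).2 (hK.cvTm_or_same hΓ hc.1) (hK.cvTm_or_same hΓ hc.2)
      · simp at hT
    · simp at h
  · obtain ⟨T', hT, _, hx, _, hy, h⟩ := h
    split at h
    · next hc =>
      simp only [call, List.foldl] at hT
      rw [Oracle.ty] at hT
      split at hT
      · next hs =>
        rw [Bool.and_eq_true, Term.same_iff, Term.same_iff] at hs
        obtain ⟨rfl, rfl⟩ := hs
        simp only [Option.bind_eq_some_iff] at hT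
        obtain ⟨_, hA, _, hB, _, hC, _, hg, _, hz, hT⟩ := hT
        obtain rfl : inst _ _ = _ := Option.some.inj hT
        replace hA := hK.ty_some hΓ hA
        replace hx := hK.ty_some hΓ hx
        replace hy := hK.ty_some hΓ hy
        have cA := Derives.cons hΓ hA
        replace hB := hK.ty_some cA hB
        replace hC := hK.ty_some (.cons hΓ (sigma_typ hΓ hA (.lam hA hB))) hC
        obtain ⟨h1, h2⟩ := (sigmaInd_typ_eqv hΓ hA hB hC (hK.ty_some hΓ hg)
          (hK.ty_some hΓ hz)).2 _ _ hx hy (hK.cvTm_or_same hΓ hc)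
        split at h
        · simp only [Option.some.injEq, Prod.mk.injEq] at h
          obtain ⟨rfl, rfl⟩ := h
          split
          · next hs =>
            rw [Bool.and_eq_true, Term.same_iff, Term.same_iff] at hs
            obtain ⟨rfl, rfl⟩ := hs
            refine h1.trans (.conv_eqv ?_ h2)
            rw [← inst2_pairInst]
            simp only [Oracle.ty, Oracle.asPi, Option.bind_eq_some_iff, Option.some.injEq,
              exists_eq_left', Term.same_iff.2 rfl, if_true] at hg
            obtain ⟨_, _, _, _, _, ⟨_, _, _, _, _, hb, _⟩, _⟩ := hg
            exact beta_two hΓ hA hB (hK.ty_some (.cons cA hB) hb) hx hy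
          · exact h1
        · simp only [Option.some.injEq, Prod.mk.injEq] at h
          obtain ⟨rfl, rfl⟩ := h
          exact h1
      · simp at hT
    · simp at h
  · obtain ⟨S, hS, i, hi, B, hB, _, ha, h⟩ := h
    simp only [Option.some.injEq, Prod.mk.injEq] at h
    obtain ⟨rfl, rfl⟩ := h
    have hA := hK.ty_univ hΓ hS hi
    exact .beta hA (hK.ty_none (.cons hΓ hA) hB) (hK.ty_some hΓ ha)
  · next hc hs =>
    obtain ⟨T', hT, _, hr, h⟩ := h
    simp only [Option.some.injEq, Prod.mk.injEq] at h
    obtain ⟨rfl, rfl⟩ := h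
    rw [← Term.same_iff.1 hs]
    exact .comp (contract_comp hc) (hK.ty_none hΓ hT) (hK.ty_some hΓ hr)
  · next hc hs =>
    obtain ⟨T', hT, _, hl, _, hr, h⟩ := h
    simp only [Option.some.injEq, Prod.mk.injEq] at h
    obtain ⟨rfl, rfl⟩ := h
    exact (hK.cvNe hΓ hT).trans
      (.comp (contract_comp hc) (hK.ty_some hΓ hl) (hK.ty_some hΓ hr))
  · next ih =>
    obtain ⟨⟨f', F⟩, hF, P, hP, _, ha, h⟩ := h
    simp only [Option.some.injEq, Prod.mk.injEq] at h
    obtain ⟨rfl, rfl⟩ := h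
    exact .app_eqv ((hK.asPi hΓ hP).conv_eqv (ih _ _ hΓ hF)) (.refl (hK.ty_some hΓ ha))

theorem Sound.whTyStep (hK : K.Sound) {Γ : List Term} {A A' : Term} {k : ℕ}
    (hΓ : Derives (ctx Γ)) (h : whTyStep K Γ A = some (A', k)) :
    Derives (eqv Γ A A' (univ k)) := by
  unfold Oracle.whTyStep at h
  split at h
  · next hr =>
    rw [Option.bind_eq_some_iff] at h
    obtain ⟨i, hi, h⟩ := h
    have h1 := (hK.asU hΓ hi).conv_eqv (hK.red _ _ _ _ hΓ hr)
    split at h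
    · next hw =>
      simp only [Option.some.injEq, Prod.mk.injEq] at h
      obtain ⟨rfl, rfl⟩ := h
      exact (cumul_eqv_le h1 (le_max_left _ _)).trans
        (cumul_eqv_le (hK.whTy hΓ hw) (le_max_right _ _))
    · simp only [Option.some.injEq, Prod.mk.injEq] at h
      obtain ⟨rfl, rfl⟩ := h
      exact h1
  · simp at h

theorem Sound.whTmStep (hK : K.Sound) {Γ : List Term} {a A : Term} (hΓ : Derives (ctx Γ)) :
    a = whTmStep K Γ a A ∨ Derives (eqv Γ a (whTmStep K Γ a A) A) := by
  unfold Oracle.whTmStep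
  split
  · next hr =>
    split
    · next hc =>
      rw [Bool.or_eq_true] at hc
      have h1 := (hK.tyEq_of_cvTy hΓ hc).conv_eqv (hK.red _ _ _ _ hΓ hr)
      obtain h2 | h2 := hK.whTm hΓ
      · exact .inr (h2 ▸ h1)
      · exact .inr (h1.trans h2)
    · exact .inl rfl
  · exact .inl rfl

theorem Sound.whD (hK : K.Sound) {Γ : List Term} {A A' : Term} {k : ℕ} (hΓ : Derives (ctx Γ))
    (h : whD K Γ A = (A', k)) : A = A' ∨ Derives (eqv Γ A A' (univ k)) := by
  unfold Oracle.whD at h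
  cases hw : K.whTy Γ A with
  | none =>
    rw [hw] at h
    exact .inl (congrArg Prod.fst h)
  | some p =>
    rw [hw] at h
    subst h
    exact .inr (hK.whTy hΓ hw)

theorem eqv_of_whD {Γ : List Term} {A A' B B' : Term} {k l m : ℕ}
    (hA : A = A' ∨ Derives (eqv Γ A A' (univ k))) (hB : B = B' ∨ Derives (eqv Γ B B' (univ l)))
    (h : Derives (eqv Γ A' B' (univ m))) :
    Derives (eqv Γ A B (univ (max m (max k l)))) := by
  have h1 : Derives (eqv Γ A B' (univ (max m (max k l)))) := by
    obtain rfl | hA := hA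
    · exact cumul_eqv_le h (by omega)
    · exact (cumul_eqv_le hA (by omega)).trans (cumul_eqv_le h (by omega))
  obtain rfl | hB := hB
  · exact h1
  · exact h1.trans (cumul_eqv_le hB.symm (by omega))

theorem Sound.cvTyStep (hK : K.Sound) {Γ : List Term} {A B : Term} {k : ℕ}
    (hΓ : Derives (ctx Γ)) (h : cvTyStep K Γ A B = some k) :
    A = B ∨ Derives (eqv Γ A B (univ k)) := by
  unfold Oracle.cvTyStep at h
  split at h
  · next hs => exact .inl (Term.same_iff.1 hs)
  · refine .inr ?_
    split at h
    · next hA hB =>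
      split at h
      · next hij =>
        obtain rfl := by simpa using hij
        obtain rfl := Option.some.inj h
        exact eqv_of_whD (hK.whD hΓ hA) (hK.whD hΓ hB) (.refl (.univ _ hΓ))
      · simp at h
    · next A₁ B₁ k A₂ B₂ l hA hB =>
      simp only [Option.bind_eq_some_iff, Option.some.injEq] at h
      obtain ⟨S, hS, i, hi, S', hS', j, hj, m, hm, n, hn, rfl⟩ := h
      have hA₁ := hK.ty_univ hΓ hS hi
      have hc := Derives.cons hΓ hA₁
      have hB₁ := hK.ty_univ hc hS' hj
      have eA : Derives (eqv Γ A₁ A₂ (univ (max (max i j) (max m n)))) :=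
        (hK.cvTy hΓ hm).elim (fun e => e ▸ .refl (cumul_le hA₁ (by omega)))
          fun e => cumul_eqv_le e (by omega)
      have eB : Derives (eqv (A₁ :: Γ) B₁ B₂ (univ (max (max i j) (max m n)))) :=
        (hK.cvTy hc hn).elim (fun e => e ▸ .refl (cumul_le hB₁ (by omega)))
          fun e => cumul_eqv_le e (by omega)
      rw [max_comm]
      exact eqv_of_whD (hK.whD hΓ hA) (hK.whD hΓ hB)
        (.pi_eqv (cumul_le hA₁ (by omega)) eA eB)
    · next hA hB =>
      simp only [Option.bind_eq_some_iff, Option.some.injEq] at h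
      obtain ⟨T, hT, m, hm, rfl⟩ := h
      exact eqv_of_whD (hK.whD hΓ hA) (hK.whD hΓ hB) ((hK.asU hΓ hm).conv_eqv (hK.cvNe hΓ hT))

theorem Sound.isUniv (hK : K.Sound) {Γ : List Term} {C : Term} (hΓ : Derives (ctx Γ))
    (h : ((Oracle.ty K C Γ none).bind (Oracle.asU K Γ)).isSome = true) :
    ∃ i, Derives (typ Γ C (univ i)) := by
  obtain ⟨i, hi⟩ := Option.isSome_iff_exists.1 h
  obtain ⟨S, hS, hi⟩ := Option.bind_eq_some_iff.1 hi
  exact ⟨i, hK.ty_univ hΓ hS hi⟩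

theorem Sound.cvEta (hK : K.Sound) {Γ : List Term} {a b C D : Term} (hΓ : Derives (ctx Γ))
    (h : cvEta K Γ a b C D = true) : Derives (eqv Γ a b (pi C D)) := by
  unfold Oracle.cvEta at h
  simp only [Bool.and_eq_true] at h
  obtain ⟨⟨⟨hC, ha⟩, hb⟩, hab⟩ := h
  obtain ⟨i, hC⟩ := hK.isUniv hΓ hC
  have ea := Derives.eta (hK.ty_isSome hΓ ha)
  have eb := Derives.eta (hK.ty_isSome hΓ hb)
  obtain e | e := hK.cvTm (.cons hΓ hC) hab
  · rw [e] at ea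
    exact ea.trans eb.symm
  · exact (ea.trans (.lam_eqv hC (.refl hC) e)).trans eb.symm

theorem Sound.congr (hK : K.Sound) {Γ : List Term} {a b A : Term} (hΓ : Derives (ctx Γ))
    (h : congr K Γ a b A = true) : Derives (eqv Γ a b A) := by
  unfold Oracle.congr at h
  split at h
  · rw [Bool.and_eq_true] at h
    replace h := h.2
    split at h
    · next hT =>
      rw [Bool.or_eq_true] at h
      exact (hK.tyEq_of_cvTy hΓ h).conv_eqv (hK.cvNe hΓ hT)
    · simp at h
  · simp at h

theorem Sound.cvTmStep (hK : K.Sound) {Γ : List Term} {a b A : Term} (hΓ : Derives (ctx Γ))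
    (h : cvTmStep K Γ a b A = true) : a = b ∨ Derives (eqv Γ a b A) := by
  unfold Oracle.cvTmStep at h
  rw [Bool.or_eq_true, Bool.or_eq_true, Term.same_iff] at h
  obtain (h | h) | h := h
  · exact .inl h
  · exact .inr (hK.congr hΓ h)
  · have hA : TyEq Γ (Oracle.whD K Γ A).1 A :=
      (hK.whD (A := A) hΓ rfl).elim (fun e => .inl e.symm) fun e => .inr ⟨_, e.symm⟩
    split at h
    · next hw =>
      rw [hw] at hA
      refine .inr (hA.conv_eqv ?_)
      split at h
      · split at h
        · next hs =>
          rw [Bool.and_eq_true, Term.same_iff, Term.same_iff] at hs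
          obtain ⟨rfl, rfl⟩ := hs
          simp only [Bool.and_eq_true] at h
          obtain ⟨⟨hC, ha⟩, hab⟩ := h
          obtain ⟨i, hC⟩ := hK.isUniv hΓ hC
          have hc := Derives.cons hΓ hC
          refine .lam_eqv hC (.refl hC) ?_
          exact (hK.cvTm hc hab).elim (fun e => e ▸ .refl (hK.ty_isSome hc ha)) id
        · exact hK.cvEta hΓ h
      · exact hK.cvEta hΓ h
    · next hw =>
      rw [hw] at hA
      split at h
      · next hk =>
        exact (hK.cvTy hΓ hk).imp id fun e => hA.conv_eqv (cumul_eqv_le e (by simpa using h))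
      · simp at h
    · split at h
      · next hT =>
        rw [Bool.or_eq_true] at h
        have e := (hK.tyEq_of_cvTy hΓ h).conv_eqv (hK.cvNe hΓ hT)
        have e1 : Derives (eqv Γ a (K.whTm Γ b A) A) := by
          obtain h1 | h1 := hK.whTm (a := a) (A := A) hΓ
          · rwa [← h1] at e
          · exact h1.trans e
        obtain h2 | h2 := hK.whTm (a := b) (A := A) hΓ
        · rw [← h2] at e1
          exact .inr e1
        · exact .inr (e1.trans h2.symm)
      · simp at h

theorem Sound.cvNeStep (hK : K.Sound) {Γ : List Term} {t u T : Term} (hΓ : Derives (ctx Γ))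
    (h : cvNeStep K Γ t u = some T) : Derives (eqv Γ t u T) := by
  unfold Oracle.cvNeStep at h
  split at h
  · next hs =>
    rw [← Term.same_iff.1 hs]
    exact .refl (hK.ty_none hΓ h)
  · split at h
    · simp only [Option.bind_eq_some_iff] at h
      obtain ⟨F, hF, P, hP, _, ha, _, hb, h⟩ := h
      split at h
      · next hab =>
        obtain rfl := Option.some.inj h
        exact .app_eqv ((hK.asPi hΓ hP).conv_eqv (hK.cvNe hΓ hF))
          ((hK.cvTm hΓ hab).elim (fun e => e ▸ .refl (hK.ty_some hΓ ha)) id)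
      · simp at h
    · simp at h

end Oracle

/-- Every oracle is sound, by induction on its depth. -/
theorem oracle_sound (n : ℕ) : (oracle n).Sound := by
  induction n with
  | zero => constructor <;> simp [oracle]
  | succ n ih => exact ⟨ih.whTyStep, ih.whTmStep, ih.cvTyStep, ih.cvTmStep, ih.cvNeStep⟩

/-! ### Raising universe levels -/

/-- Add `k` to all universe levels of a constant. -/
def Const.raise (k : ℕ) : Const → Const
  | .empty => .empty
  | .emptyInd j => .emptyInd (k + j)
  | .unit => .unit
  | .star => .star
  | .unitInd j => .unitInd (k + j)
  | .nat => .nat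
  | .zero => .zero
  | .succ => .succ
  | .natInd j => .natInd (k + j)
  | .sum i => .sum (k + i)
  | .inl i => .inl (k + i)
  | .inr i => .inr (k + i)
  | .sumInd i j => .sumInd (k + i) (k + j)
  | .sigma i => .sigma (k + i)
  | .pair i => .pair (k + i)
  | .sigmaInd i j => .sigmaInd (k + i) (k + j)
  | .path i => .path (k + i)
  | .rfl i => .rfl (k + i)
  | .pathInd i j => .pathInd (k + i) (k + j)
  | .one i => .one (k + i)
  | .oneF i => .oneF (k + i)
  | .oneE i => .oneE (k + i)
  | .oneInd i j => .oneInd (k + i) (k + j)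
  | .oneIndE i j => .oneIndE (k + i) (k + j)
  | .ptr i => .ptr (k + i)
  | .ptrMk i => .ptrMk (k + i)
  | .ptrEps i => .ptrEps (k + i)
  | .ptrInd i j => .ptrInd (k + i) (k + j)
  | .ptrIndEps i j => .ptrIndEps (k + i) (k + j)
  | .tr n i => .tr n (k + i)
  | .trMk n i => .trMk n (k + i)
  | .trTrunc n i => .trTrunc n (k + i)
  | .trInd n i j => .trInd n (k + i) (k + j)
  | .ua i => .ua (k + i)

namespace Term

/-- Add `k` to all universe levels in a term. -/
def raise (k : ℕ) : Term → Term
  | var n => var n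
  | univ i => univ (k + i)
  | pi A B => pi (A.raise k) (B.raise k)
  | lam A b => lam (A.raise k) (b.raise k)
  | app f a => app (f.raise k) (a.raise k)
  | const c => const (c.raise k)

theorem raise_rename (k : ℕ) (t : Term) (r : ℕ → ℕ) :
    (t.rename r).raise k = (t.raise k).rename r := by
  induction t generalizing r <;> simp_all [rename, raise]

theorem raise_subst (k : ℕ) (t : Term) (s : ℕ → Term) :
    (t.subst s).raise k = (t.raise k).subst fun n => (s n).raise k := by
  have up : ∀ s : ℕ → Term, (fun n => (upSub s n).raise k) = upSub fun n => (s n).raise k := by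
    intro s; funext n
    cases n with
    | zero => rfl
    | succ n => exact raise_rename k (s n) Nat.succ
  induction t generalizing s <;> simp_all [subst, raise]

theorem raise_inst (k : ℕ) (b a : Term) : (b.inst a).raise k = (b.raise k).inst (a.raise k) := by
  rw [inst, raise_subst, inst]
  congr 1; funext n; cases n <;> rfl

end Term

theorem isType_raise (k i n : ℕ) (A : Tm) (d : ℕ) :
    (IsType i n A d).raise k = IsType (k + i) n (fun d => (A d).raise k) d := by
  induction n generalizing A d with
  | zero => rfl
  | succ n ih =>
    change Term.pi _ (Term.pi _ _) = Term.pi _ (Term.pi _ _)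
    rw [ih]; rfl

theorem Const.type_raise_typ {Γ : List Term} (k : ℕ) (c : Const) (hΓ : Derives (ctx Γ)) :
    Derives (typ Γ (.const (c.raise k)) (c.type.raise k)) := by
  have h := Derives.const (c.raise k) hΓ
  cases c with
  | empty | unit | nat => exact cumul_le h (Nat.zero_le _)
  | trTrunc n i =>
    have e : (Const.trTrunc n i).type.raise k = (Const.trTrunc n (k + i)).type := by
      change Term.pi _ _ = Term.pi _ _
      rw [isType_raise]; rfl
    rw [e]; exact h
  | trInd n i j =>
    have e : (Const.trInd n i j).type.raise k = (Const.trInd n (k + i) (k + j)).type := by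
      change Term.pi _ (Term.pi _ (Term.pi (Term.pi _ _) _)) =
        Term.pi _ (Term.pi _ (Term.pi (Term.pi _ _) _))
      rw [isType_raise]; rfl
    rw [e]; exact h
  | _ => exact h

theorem Comp.raise {l r : Term} (h : Comp l r) (k : ℕ) : Comp (l.raise k) (r.raise k) := by
  cases h <;> constructor

/-- Add `k` to all universe levels in a judgment. -/
def Judgment.raise (k : ℕ) : Judgment → Judgment
  | ctx Γ => ctx (Γ.map (Term.raise k))
  | typ Γ a A => typ (Γ.map (Term.raise k)) (a.raise k) (A.raise k)
  | eqv Γ a b A => eqv (Γ.map (Term.raise k)) (a.raise k) (b.raise k) (A.raise k)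

theorem Derives.raise {j : Judgment} (h : Derives j) (k : ℕ) : Derives (j.raise k) := by
  induction h with
  | nil => exact .nil
  | cons _ _ ih ih' => exact .cons ih ih'
  | var _ hn ih =>
    simp only [Judgment.raise, Term.raise_rename]
    exact .var ih (by simp [hn])
  | const c _ ih => exact c.type_raise_typ k ih
  | univ i _ ih => exact .univ (k + i) ih
  | cumul _ ih => exact .cumul ih
  | cumul_eqv _ ih => exact .cumul_eqv ih
  | pi _ _ ih ih' => exact .pi ih ih'
  | pi_eqv _ _ _ ih ih' ih'' => exact .pi_eqv ih ih' ih''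
  | lam _ _ ih ih' => exact .lam ih ih'
  | lam_eqv _ _ _ ih ih' ih'' => exact .lam_eqv ih ih' ih''
  | app _ _ ih ih' =>
    simp only [Judgment.raise, Term.raise_inst]
    exact .app ih ih'
  | app_eqv _ _ ih ih' =>
    simp only [Judgment.raise, Term.raise_inst]
    exact .app_eqv ih ih'
  | beta _ _ _ ih ih' ih'' =>
    simp only [Judgment.raise, Term.raise_inst]
    exact .beta ih ih' ih''
  | eta _ ih =>
    simp only [Judgment.raise, Term.raise, Term.shift, Term.raise_rename]
    exact .eta ih
  | comp h _ _ ih ih' => exact .comp (h.raise k) ih ih'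
  | refl _ ih => exact .refl ih
  | symm _ ih => exact .symm ih
  | trans _ _ ih ih' => exact .trans ih ih'
  | conv _ _ ih ih' => exact .conv ih ih'
  | conv_eqv _ _ ih ih' => exact .conv_eqv ih ih'

theorem Holds.raise {T T' : Tm} (h : Holds T) (k : ℕ) (e : T' 0 = (T 0).raise k) : Holds T' := by
  obtain ⟨t, ht⟩ := h
  exact ⟨t.raise k, e ▸ ht.raise k⟩

/-! ### Deriving lemmas from lemmas -/

instance Term.decidableFreeBelow : (m : ℕ) → (t : Term) → Decidable (t.FreeBelow m)
  | m, .var n => inferInstanceAs (Decidable (n < m))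
  | _, .univ _ => isTrue trivial
  | m, .pi A B =>
    have := decidableFreeBelow m A
    have := decidableFreeBelow (m + 1) B
    inferInstanceAs (Decidable (_ ∧ _))
  | m, .lam A b =>
    have := decidableFreeBelow m A
    have := decidableFreeBelow (m + 1) b
    inferInstanceAs (Decidable (_ ∧ _))
  | m, .app f a =>
    have := decidableFreeBelow m f
    have := decidableFreeBelow m a
    inferInstanceAs (Decidable (_ ∧ _))
  | _, .const _ => isTrue trivial

/-- The function type `D₁ → ⋯ → Dₘ → T`. -/
def arrows (Ds : List Tm) (T : Tm) : Tm := Ds.foldr Arr T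

/-- The types `Ds` and `T` are closed, as far as this matters for `arrows Ds T` under `k` binders. -/
def closedFrom : ℕ → List Tm → Tm → Bool
  | k, [], T => (T k).same (T 0)
  | k, D :: Ds, T =>
    (D k).same (D 0) && decide ((arrows Ds T (k + 1)).FreeBelow 0) && closedFrom (k + 1) Ds T

/-- If all of `Ds` hold, then `T` holds. -/
def Implies : List Tm → Tm → Prop
  | [], T => Holds T
  | D :: Ds, T => Holds D → Implies Ds T

theorem implies_of_derives {k : ℕ} {Ds : List Tm} {T : Tm} {t : Term}
    (hc : closedFrom k Ds T = true) (ht : Derives (typ [] t (arrows Ds T k))) : Implies Ds T := by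
  induction Ds generalizing k t with
  | nil =>
    rw [closedFrom, Term.same_iff] at hc
    exact ⟨t, hc ▸ ht⟩
  | cons D Ds ih =>
    simp only [closedFrom, Bool.and_eq_true, Term.same_iff, decide_eq_true_eq] at hc
    obtain ⟨⟨hD, hf⟩, hc⟩ := hc
    rintro ⟨d, hd⟩
    rw [← hD] at hd
    have e : (arrows Ds T (k + 1)).inst d = arrows Ds T (k + 1) :=
      hf.subst_eq fun n hn => absurd hn (Nat.not_lt_zero n)
    exact ih hc (e ▸ Derives.app ht hd)

/-- The type checker accepts `t` as a function from `Ds` to `T`. The recursion depth `40` of the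
conversion test suffices for all terms below. -/
def checks (Ds : List Tm) (T t : Tm) : Bool :=
  closedFrom 0 Ds T && ((oracle 40).ty (t 0) [] (some (arrows Ds T 0))).isSome

theorem implies_of_checks (Ds : List Tm) {T : Tm} (t : Tm) (h : checks Ds T t = true) :
    Implies Ds T := by
  rw [checks, Bool.and_eq_true] at h
  exact implies_of_derives h.1 ((oracle_sound 40).ty_isSome .nil h.2)

/-! ### Paths, mere propositions and function extensionality -/

/-- The first projection of `z : Σ (x : A), B x`. -/
def Fst (i : ℕ) (A : Tm) (B : Tm → Tm) (z : Tm) : Tm :=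
  con (.sigmaInd i i) ⬝ A ⬝ Lam A B ⬝ (Lam (Sig i A B) fun _ => A) ⬝
    (Lam A fun a => Lam (B a) fun _ => a) ⬝ z

/-- The second projection of `z : Σ (x : A), B x`. -/
def Snd (i : ℕ) (A : Tm) (B : Tm → Tm) (z : Tm) : Tm :=
  con (.sigmaInd i i) ⬝ A ⬝ Lam A B ⬝ (Lam (Sig i A B) fun z => B (Fst i A B z)) ⬝
    (Lam A fun a => Lam (B a) fun b => b) ⬝ z

/-- Induction on `z : Σ (x : A), B x`: an element of `P z` from elements `g a b` of `P (a, b)`. -/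
def SigElim (i j : ℕ) (A : Tm) (B P : Tm → Tm) (g : Tm → Tm → Tm) (z : Tm) : Tm :=
  con (.sigmaInd i j) ⬝ A ⬝ Lam A B ⬝ Lam (Sig i A B) P ⬝
    (Lam A fun a => Lam (B a) fun b => g a b) ⬝ z

/-- The path `p⁻¹ ⬝ q : y = z` for `p : x =_A y` and `q : x =_A z`. -/
def Cmp (i : ℕ) (A x y z p q : Tm) : Tm :=
  J i i A x (fun y' _ => Path i A y' z) q y p

/-- Any two elements of `A` are equal. -/
def AllPaths (i : ℕ) (A : Tm) : Tm := Pi A fun x => Pi A fun y => Path i A x y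

/-- Uniqueness of identity proofs: any two parallel paths in `A` are equal. -/
def UIP (i : ℕ) (A : Tm) : Tm := Pi A fun x => Pi A fun y => AllPaths i (Path i A x y)

/-- `p⁻¹ ⬝ p = refl`. -/
def CmpSelf (i : ℕ) : Tm :=
  Pi (U i) fun A => Pi A fun x => Pi A fun y => Pi (Path i A x y) fun p =>
    Path i (Path i A y y) (Cmp i A x y y p p) (Refl i A y)

theorem holds_cmpSelf (i : ℕ) : Holds (CmpSelf i) :=
  (implies_of_checks []
    (Lam (U 0) fun A => Lam A fun x => Lam A fun y => Lam (Path 0 A x y) fun p =>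
      J 0 0 A x (fun y' p' => Path 0 (Path 0 A y' y') (Cmp 0 A x y' y' p' p') (Refl 0 A y'))
        (Refl 0 (Path 0 A x x) (Refl 0 A x)) y p)
    (by decide +kernel) : Holds (CmpSelf 0)).raise i rfl

/-- If `c` gives a path between any two elements of `A`, then every `p : x = y` is equal to
`c(x, x)⁻¹ ⬝ c(x, y)`. -/
def PathOfAllPaths (i : ℕ) : Tm :=
  Pi (U i) fun A => Pi (AllPaths i A) fun c =>
    Pi A fun x => Pi A fun y => Pi (Path i A x y) fun p =>
      Path i (Path i A x y) (Cmp i A x x y (c ⬝ x ⬝ x) (c ⬝ x ⬝ y)) p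

theorem holds_pathOfAllPaths (i : ℕ) : Holds (PathOfAllPaths i) :=
  (implies_of_checks [CmpSelf 0]
    (Lam (CmpSelf 0) fun cs =>
      Lam (U 0) fun A => Lam (AllPaths 0 A) fun c =>
      Lam A fun x => Lam A fun y => Lam (Path 0 A x y) fun p =>
        J 0 0 A x
          (fun y' p' => Path 0 (Path 0 A x y') (Cmp 0 A x x y' (c ⬝ x ⬝ x) (c ⬝ x ⬝ y')) p')
          (cs ⬝ A ⬝ x ⬝ x ⬝ (c ⬝ x ⬝ x)) y p)
    (by decide +kernel) (holds_cmpSelf 0) : Holds (PathOfAllPaths 0)).raise i rfl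

/-- A type with a path between any two elements is a mere proposition. -/
def IsPropOfAllPaths (i : ℕ) : Tm := Pi (U i) fun A => Arr (AllPaths i A) (IsProp i A)

theorem holds_isPropOfAllPaths (i : ℕ) : Holds (IsPropOfAllPaths i) :=
  (implies_of_checks [PathOfAllPaths 0]
    (Lam (PathOfAllPaths 0) fun ct =>
      Lam (U 0) fun A => Lam (AllPaths 0 A) fun c => Lam A fun x => Lam A fun y =>
        Pair 0 (Path 0 A x y) (fun p => Pi (Path 0 A x y) fun q => Path 0 (Path 0 A x y) p q)
          (Cmp 0 A x x y (c ⬝ x ⬝ x) (c ⬝ x ⬝ y)) (ct ⬝ A ⬝ c ⬝ x ⬝ y))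
    (by decide +kernel) (holds_pathOfAllPaths 0) : Holds (IsPropOfAllPaths 0)).raise i rfl

/-- Any two elements of a contractible type are equal. -/
def AllPathsOfIsContr : Tm := Pi (U 0) fun A => Arr (IsContr 0 A) (AllPaths 0 A)

theorem holds_allPathsOfIsContr : Holds AllPathsOfIsContr :=
  implies_of_checks []
    (Lam (U 0) fun A => Lam (IsContr 0 A) fun h =>
      SigElim 0 0 A (fun x => Pi A fun y => Path 0 A x y) (fun _ => AllPaths 0 A) (fun x c =>
        Lam A fun y => Lam A fun z => Cmp 0 A x y z (c ⬝ y) (c ⬝ z)) h)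
    (by decide +kernel)

/-- A type with a path between any two elements satisfies uniqueness of identity proofs. -/
def UIPOfAllPaths : Tm := Pi (U 0) fun A => Arr (AllPaths 0 A) (UIP 0 A)

theorem holds_uipOfAllPaths : Holds UIPOfAllPaths :=
  implies_of_checks [PathOfAllPaths 0]
    (Lam (PathOfAllPaths 0) fun ct =>
      Lam (U 0) fun A => Lam (AllPaths 0 A) fun c => Lam A fun x => Lam A fun y =>
      Lam (Path 0 A x y) fun p => Lam (Path 0 A x y) fun q =>
        Cmp 0 (Path 0 A x y) (Cmp 0 A x x y (c ⬝ x ⬝ x) (c ⬝ x ⬝ y)) p q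
          (ct ⬝ A ⬝ c ⬝ x ⬝ y ⬝ p) (ct ⬝ A ⬝ c ⬝ x ⬝ y ⬝ q))
    (by decide +kernel) (holds_pathOfAllPaths 0)

/-- Sets satisfy uniqueness of identity proofs. -/
def UIPOfIsSet : Tm := Pi (U 0) fun A => Arr (IsSet 0 A) (UIP 0 A)

theorem holds_uipOfIsSet : Holds UIPOfIsSet :=
  implies_of_checks []
    (Lam (U 0) fun A => Lam (IsSet 0 A) fun h => Lam A fun x => Lam A fun y =>
      let P := Path 0 A x y
      Lam P fun p => Lam P fun q =>
        Fst 0 (Path 0 P p q) (fun r => Pi (Path 0 P p q) fun r' => Path 0 (Path 0 P p q) r r')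
          (h ⬝ x ⬝ y ⬝ p ⬝ q))
    (by decide +kernel)

/-- Types with uniqueness of identity proofs are sets. -/
def IsSetOfUIP : Tm := Pi (U 0) fun A => Arr (UIP 0 A) (IsSet 0 A)

theorem holds_isSetOfUIP : Holds IsSetOfUIP :=
  implies_of_checks [IsPropOfAllPaths 0]
    (Lam (IsPropOfAllPaths 0) fun ip => Lam (U 0) fun A => Lam (UIP 0 A) fun h =>
      Lam A fun x => Lam A fun y => ip ⬝ Path 0 A x y ⬝ (h ⬝ x ⬝ y))
    (by decide +kernel) (holds_isPropOfAllPaths 0)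

/-- Induction on equivalences out of `A`: it suffices to consider the identity of `A`. This is where
univalence enters. -/
def EquivInd : Tm :=
  Pi (U 0) fun A => Pi (Pi (U 0) fun B => Arr (Arr A B) (U 1)) fun D =>
    Arr (D ⬝ A ⬝ IdFun A) <|
    Pi (U 0) fun B => Pi (Equiv 0 A B) fun e =>
      D ⬝ B ⬝ Fst 0 (Arr A B) (fun g => IsEquiv 0 A B g) e

theorem holds_equivInd : Holds EquivInd :=
  implies_of_checks []
    (Lam (U 0) fun A => Lam (Pi (U 0) fun B => Arr (Arr A B) (U 1)) fun D =>
      Lam (D ⬝ A ⬝ IdFun A) fun d => Lam (U 0) fun B => Lam (Equiv 0 A B) fun e =>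
      let X := Path 1 (U 0) A B
      let Y := Equiv 0 A B
      let g := IdToEquiv 0 A B
      let P := fun B e => D ⬝ B ⬝ Fst 0 (Arr A B) (fun g => IsEquiv 0 A B g) e
      SigElim 1 1 (LInv 1 X Y g) (fun _ => RInv 1 X Y g) (fun _ => P B e) (fun _ r =>
        SigElim 1 1 (Arr Y X) (fun h => Pi Y fun y => Path 1 Y (g ⬝ (h ⬝ y)) y) (fun _ => P B e)
          (fun h H => J 1 1 Y (g ⬝ (h ⬝ e)) (fun e' _ => P B e')
            (J 1 1 (U 0) A (fun B' p => P B' (IdToEquiv 0 A B' ⬝ p)) d B (h ⬝ e)) e (H ⬝ e)) r)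
        (con (.ua 0) ⬝ A ⬝ B))
    (by decide +kernel)

/-- The same, with equivalences given as functions that are equivalences. -/
def IsEquivInd : Tm :=
  Pi (U 0) fun A => Pi (Pi (U 0) fun B => Arr (Arr A B) (U 1)) fun D =>
    Arr (D ⬝ A ⬝ IdFun A) <|
    Pi (U 0) fun B => Pi (Arr A B) fun g => Arr (IsEquiv 0 A B g) (D ⬝ B ⬝ g)

theorem holds_isEquivInd : Holds IsEquivInd :=
  implies_of_checks [EquivInd]
    (Lam EquivInd fun ei => Lam (U 0) fun A =>
      Lam (Pi (U 0) fun B => Arr (Arr A B) (U 1)) fun D => Lam (D ⬝ A ⬝ IdFun A) fun d =>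
      Lam (U 0) fun B => Lam (Arr A B) fun g => Lam (IsEquiv 0 A B g) fun w =>
        ei ⬝ A ⬝ D ⬝ d ⬝ B ⬝ Pair 0 (Arr A B) (fun g => IsEquiv 0 A B g) g w)
    (by decide +kernel) holds_equivInd

/-- Dependent functions on `B` are equal if they become so after composition with `g : A → B`. -/
def EqOfPrecompEq (A B g : Tm) : Tm :=
  Pi (Arr B (U 0)) fun C => Pi (Pi B fun y => C ⬝ y) fun u => Pi (Pi B fun y => C ⬝ y) fun v =>
    Arr (Path 0 (Pi A fun x => C ⬝ (g ⬝ x)) (Lam A fun x => u ⬝ (g ⬝ x))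
      (Lam A fun x => v ⬝ (g ⬝ x))) (Path 0 (Pi B fun y => C ⬝ y) u v)

/-- `EqOfPrecompEq` for all equivalences `g`. -/
def EqOfPrecompEquivEq : Tm :=
  Pi (U 0) fun A => Pi (U 0) fun B => Pi (Arr A B) fun g =>
    Arr (IsEquiv 0 A B g) (EqOfPrecompEq A B g)

theorem holds_eqOfPrecompEquivEq : Holds EqOfPrecompEquivEq :=
  implies_of_checks [IsEquivInd]
    (Lam IsEquivInd fun ei => Lam (U 0) fun A =>
      ei ⬝ A ⬝ (Lam (U 0) fun B' => Lam (Arr A B') fun g => EqOfPrecompEq A B' g) ⬝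
        (Lam (Arr A (U 0)) fun C => Lam (Pi A fun y => C ⬝ y) fun u =>
          Lam (Pi A fun y => C ⬝ y) fun v => Lam (Path 0 (Pi A fun x => C ⬝ x) u v) fun h => h))
    (by decide +kernel) holds_isEquivInd

/-- Function extensionality for dependent functions. -/
def FunExt : Tm :=
  Pi (U 0) fun A => Pi (Arr A (U 0)) fun B =>
    Pi (Pi A fun x => B ⬝ x) fun f => Pi (Pi A fun x => B ⬝ x) fun g =>
      Arr (Pi A fun x => Path 0 (B ⬝ x) (f ⬝ x) (g ⬝ x)) (Path 0 (Pi A fun x => B ⬝ x) f g)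

/-- Let `E` be the type of triples `(x, b, p)` with `p : f x = b`. The map `x ↦ (x, f x, refl)` is an
equivalence `A → E`. The functions `(x, b, p) ↦ f x` and `(x, b, p) ↦ b` on `E` agree after
composition with it, so they are equal. A homotopy `h` from `f` to `g` is a map
`x ↦ (x, g x, h x)` to `E`; composition with it gives `f = g`. -/
theorem holds_funExt : Holds FunExt :=
  implies_of_checks [EqOfPrecompEquivEq]
    (Lam EqOfPrecompEquivEq fun pc => Lam (U 0) fun A => Lam (Arr A (U 0)) fun B =>
      Lam (Pi A fun x => B ⬝ x) fun f => Lam (Pi A fun x => B ⬝ x) fun g =>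
      Lam (Pi A fun x => Path 0 (B ⬝ x) (f ⬝ x) (g ⬝ x)) fun h =>
      let F := fun x => Sig 0 (B ⬝ x) fun b => Path 0 (B ⬝ x) (f ⬝ x) b
      let E := Sig 0 A F
      let mk := fun x b p => Pair 0 A F x (Pair 0 (B ⬝ x) (fun b => Path 0 (B ⬝ x) (f ⬝ x) b) b p)
      let s := Lam A fun x => mk x (f ⬝ x) (Refl 0 (B ⬝ x) (f ⬝ x))
      let p1 := fun z => Fst 0 A F z
      let p2 := fun z => SigElim 0 0 A F (fun z => B ⬝ p1 z) (fun x w =>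
        Fst 0 (B ⬝ x) (fun b => Path 0 (B ⬝ x) (f ⬝ x) b) w) z
      let l := Pair 0 (Arr E A) (fun h => Pi A fun x => Path 0 A (h ⬝ (s ⬝ x)) x)
        (Lam E p1) (Lam A fun x => Refl 0 A x)
      let r := Pair 0 (Arr E A) (fun h => Pi E fun z => Path 0 E (s ⬝ (h ⬝ z)) z)
        (Lam E p1) (Lam E fun z => SigElim 0 0 A F (fun z => Path 0 E (s ⬝ p1 z) z) (fun x w =>
          SigElim 0 0 (B ⬝ x) (fun b => Path 0 (B ⬝ x) (f ⬝ x) b)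
            (fun w => Path 0 E (s ⬝ x) (Pair 0 A F x w))
            (fun b p => J 0 0 (B ⬝ x) (f ⬝ x) (fun b' p' => Path 0 E (s ⬝ x) (mk x b' p'))
              (Refl 0 E (s ⬝ x)) b p) w) z)
      let C := Lam E fun z => B ⬝ p1 z
      let u := Lam E fun z => f ⬝ p1 z
      let v := Lam E p2
      let S := Pi E fun z => B ⬝ p1 z
      Ap 0 0 S (Pi A fun x => B ⬝ x) (Lam S fun w => Lam A fun x => w ⬝ mk x (g ⬝ x) (h ⬝ x)) u v
        (pc ⬝ A ⬝ E ⬝ s ⬝ Pair 0 (LInv 0 A E s) (fun _ => RInv 0 A E s) l r ⬝ C ⬝ u ⬝ v ⬝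
          Refl 0 (Pi A fun x => B ⬝ x) f))
    (by decide +kernel) holds_eqOfPrecompEquivEq

/-! ### Uniqueness of identity proofs from relations, and its closure properties -/

/-- For a relation `R` on `A` that is reflexive by `r`: the element of `R x y` given by
`p : x =_A y`. -/
def Enc (i : ℕ) (A R r x y p : Tm) : Tm :=
  J i 0 A x (fun y' _ => R ⬝ x ⬝ y') (r ⬝ x) y p

/-- If `R` is a reflexive relation on `A` that implies equality, then two paths with equal images
under `Enc` are equal. -/
def EncInj (i : ℕ) : Tm :=
  Pi (U i) fun A => Pi (Arr A (Arr A (U 0))) fun R =>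
    Pi (Pi A fun x => R ⬝ x ⬝ x) fun r =>
    Arr (Pi A fun x => Pi A fun y => Arr (R ⬝ x ⬝ y) (Path i A x y)) <|
    Pi A fun x => Pi A fun y => Pi (Path i A x y) fun p => Pi (Path i A x y) fun q =>
      Arr (Path 0 (R ⬝ x ⬝ y) (Enc i A R r x y p) (Enc i A R r x y q))
        (Path i (Path i A x y) p q)

/-- If `d` turns elements of `R x y` into paths, then `s(c) = d(r)⁻¹ ⬝ d(c)` is a left inverse of
`Enc`, by path induction. -/
theorem holds_encInj (n : Fin 2) : Holds (EncInj n) :=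
  let enc (i : ℕ) : Tm :=
    Lam (CmpSelf i) fun cs => Lam (U i) fun A => Lam (Arr A (Arr A (U 0))) fun R =>
    Lam (Pi A fun x => R ⬝ x ⬝ x) fun r =>
    Lam (Pi A fun x => Pi A fun y => Arr (R ⬝ x ⬝ y) (Path i A x y)) fun d =>
    Lam A fun x => Lam A fun y => Lam (Path i A x y) fun p => Lam (Path i A x y) fun q =>
    Lam (Path 0 (R ⬝ x ⬝ y) (Enc i A R r x y p) (Enc i A R r x y q)) fun h =>
    let s := fun y c => Cmp i A x x y (d ⬝ x ⬝ x ⬝ (r ⬝ x)) (d ⬝ x ⬝ y ⬝ c)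
    let e := fun p => Enc i A R r x y p
    let k := fun p => J i i A x (fun y' p' => Path i (Path i A x y') (s y' (Enc i A R r x y' p')) p')
      (cs ⬝ A ⬝ x ⬝ x ⬝ (d ⬝ x ⬝ x ⬝ (r ⬝ x))) y p
    Cmp i (Path i A x y) (s y (e q)) p q
      (J 0 i (R ⬝ x ⬝ y) (e p) (fun c _ => Path i (Path i A x y) (s y c) p) (k p) (e q) h) (k q)
  implies_of_checks [CmpSelf n] (enc n) (by revert n; decide +kernel) (holds_cmpSelf n)

/-- A type with a reflexive relation that has at most one element for each pair and implies equality
satisfies uniqueness of identity proofs. -/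
def UIPOfRel (i : ℕ) : Tm :=
  Pi (U i) fun A => Pi (Arr A (Arr A (U 0))) fun R =>
    Arr (Pi A fun x => Pi A fun y => AllPaths 0 (R ⬝ x ⬝ y)) <|
    Arr (Pi A fun x => R ⬝ x ⬝ x) <|
    Arr (Pi A fun x => Pi A fun y => Arr (R ⬝ x ⬝ y) (Path i A x y)) (UIP i A)

theorem holds_uipOfRel (n : Fin 2) : Holds (UIPOfRel n) :=
  let uip (i : ℕ) : Tm :=
    Lam (EncInj i) fun ei => Lam (U i) fun A => Lam (Arr A (Arr A (U 0))) fun R =>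
    Lam (Pi A fun x => Pi A fun y => AllPaths 0 (R ⬝ x ⬝ y)) fun c =>
    Lam (Pi A fun x => R ⬝ x ⬝ x) fun r =>
    Lam (Pi A fun x => Pi A fun y => Arr (R ⬝ x ⬝ y) (Path i A x y)) fun d =>
    Lam A fun x => Lam A fun y => Lam (Path i A x y) fun p => Lam (Path i A x y) fun q =>
      ei ⬝ A ⬝ R ⬝ r ⬝ d ⬝ x ⬝ y ⬝ p ⬝ q ⬝ (c ⬝ x ⬝ y ⬝ Enc i A R r x y p ⬝ Enc i A R r x y q)
  implies_of_checks [EncInj n] (uip n) (by revert n; decide +kernel) (holds_encInj n)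

/-- If a type has a reflexive set-valued relation that implies equality, then its path types satisfy
uniqueness of identity proofs. -/
def UIPPathOfRel : Tm :=
  Pi (U 1) fun A => Pi (Arr A (Arr A (U 0))) fun R =>
    Arr (Pi A fun x => Pi A fun y => UIP 0 (R ⬝ x ⬝ y)) <|
    Arr (Pi A fun x => R ⬝ x ⬝ x) <|
    Arr (Pi A fun x => Pi A fun y => Arr (R ⬝ x ⬝ y) (Path 1 A x y)) <|
    Pi A fun x => Pi A fun y => UIP 1 (Path 1 A x y)

theorem holds_uipPathOfRel : Holds UIPPathOfRel :=
  implies_of_checks [EncInj 1, UIPOfRel 1]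
    (Lam (EncInj 1) fun ei => Lam (UIPOfRel 1) fun ur =>
      Lam (U 1) fun A => Lam (Arr A (Arr A (U 0))) fun R =>
      Lam (Pi A fun x => Pi A fun y => UIP 0 (R ⬝ x ⬝ y)) fun c =>
      Lam (Pi A fun x => R ⬝ x ⬝ x) fun r =>
      Lam (Pi A fun x => Pi A fun y => Arr (R ⬝ x ⬝ y) (Path 1 A x y)) fun d =>
      Lam A fun x => Lam A fun y =>
      let P := Path 1 A x y
      let e := fun p => Enc 1 A R r x y p
      ur ⬝ P ⬝ (Lam P fun p => Lam P fun q => Path 0 (R ⬝ x ⬝ y) (e p) (e q)) ⬝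
        (Lam P fun p => Lam P fun q => c ⬝ x ⬝ y ⬝ e p ⬝ e q) ⬝
        (Lam P fun p => Refl 0 (R ⬝ x ⬝ y) (e p)) ⬝ (ei ⬝ A ⬝ R ⬝ r ⬝ d ⬝ x ⬝ y))
    (by decide +kernel) (holds_encInj 1) (holds_uipOfRel 1)

/-- Products of families with at most one element have at most one element. -/
def AllPathsPi : Tm :=
  Pi (U 0) fun A => Pi (Arr A (U 0)) fun B =>
    Arr (Pi A fun x => AllPaths 0 (B ⬝ x)) (AllPaths 0 (Pi A fun x => B ⬝ x))

theorem holds_allPathsPi : Holds AllPathsPi :=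
  implies_of_checks [FunExt]
    (Lam FunExt fun fe => Lam (U 0) fun A => Lam (Arr A (U 0)) fun B =>
      Lam (Pi A fun x => AllPaths 0 (B ⬝ x)) fun c =>
      Lam (Pi A fun x => B ⬝ x) fun f => Lam (Pi A fun x => B ⬝ x) fun g =>
        fe ⬝ A ⬝ B ⬝ f ⬝ g ⬝ Lam A fun x => c ⬝ x ⬝ (f ⬝ x) ⬝ (g ⬝ x))
    (by decide +kernel) holds_funExt

/-- Uniqueness of identity proofs passes to products. -/
def UIPPi : Tm :=
  Pi (U 0) fun A => Pi (Arr A (U 0)) fun B =>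
    Arr (Pi A fun x => UIP 0 (B ⬝ x)) (UIP 0 (Pi A fun x => B ⬝ x))

/-- The relation is pointwise equality of functions. -/
theorem holds_uipPi : Holds UIPPi :=
  implies_of_checks [UIPOfRel 0, FunExt, AllPathsPi]
    (Lam (UIPOfRel 0) fun ur => Lam FunExt fun fe => Lam AllPathsPi fun ap =>
      Lam (U 0) fun A => Lam (Arr A (U 0)) fun B => Lam (Pi A fun x => UIP 0 (B ⬝ x)) fun c =>
      let F := Pi A fun x => B ⬝ x
      ur ⬝ F ⬝ (Lam F fun f => Lam F fun g => Pi A fun x => Path 0 (B ⬝ x) (f ⬝ x) (g ⬝ x)) ⬝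
        (Lam F fun f => Lam F fun g =>
          ap ⬝ A ⬝ (Lam A fun x => Path 0 (B ⬝ x) (f ⬝ x) (g ⬝ x)) ⬝
            (Lam A fun x => c ⬝ x ⬝ (f ⬝ x) ⬝ (g ⬝ x))) ⬝
        (Lam F fun f => Lam A fun x => Refl 0 (B ⬝ x) (f ⬝ x)) ⬝ (fe ⬝ A ⬝ B))
    (by decide +kernel) (holds_uipOfRel 0) holds_funExt holds_allPathsPi

/-- Equality of dependent pairs from a path between the first components and a path over it between
the second ones. -/
def SigPath : Tm :=
  Pi (U 0) fun A => Pi (Arr A (U 0)) fun B => Pi A fun a => Pi (B ⬝ a) fun b =>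
    Pi A fun a' => Pi (Path 0 A a a') fun p => Pi (B ⬝ a') fun b' =>
    Arr (Path 0 (B ⬝ a') (Transport 0 0 A B a a' p b) b')
      (Path 0 (Sig 0 A fun x => B ⬝ x) (Pair 0 A (fun x => B ⬝ x) a b)
        (Pair 0 A (fun x => B ⬝ x) a' b'))

theorem holds_sigPath : Holds SigPath :=
  implies_of_checks []
    (Lam (U 0) fun A => Lam (Arr A (U 0)) fun B => Lam A fun a => Lam (B ⬝ a) fun b =>
      let S := Sig 0 A fun x => B ⬝ x
      let mk := fun a b => Pair 0 A (fun x => B ⬝ x) a b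
      Lam A fun a' => Lam (Path 0 A a a') fun p =>
      J 0 0 A a
        (fun a' p => Pi (B ⬝ a') fun b' =>
          Arr (Path 0 (B ⬝ a') (Transport 0 0 A B a a' p b) b') (Path 0 S (mk a b) (mk a' b')))
        (Lam (B ⬝ a) fun b' => Lam (Path 0 (B ⬝ a) b b') fun q =>
          J 0 0 (B ⬝ a) b (fun b' _ => Path 0 S (mk a b) (mk a b')) (Refl 0 S (mk a b)) b' q)
        a' p)
    (by decide +kernel)

/-- Having at most one element passes to dependent sums. -/
def AllPathsSig : Tm :=
  Pi (U 0) fun A => Pi (Arr A (U 0)) fun B =>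
    Arr (AllPaths 0 A) <| Arr (Pi A fun x => AllPaths 0 (B ⬝ x)) <|
    AllPaths 0 (Sig 0 A fun x => B ⬝ x)

theorem holds_allPathsSig : Holds AllPathsSig :=
  implies_of_checks [SigPath]
    (Lam SigPath fun sp => Lam (U 0) fun A => Lam (Arr A (U 0)) fun B =>
      Lam (AllPaths 0 A) fun c => Lam (Pi A fun x => AllPaths 0 (B ⬝ x)) fun d =>
      let F := fun x => B ⬝ x
      let S := Sig 0 A F
      let mk := fun a b => Pair 0 A F a b
      Lam S fun z => Lam S fun w =>
      SigElim 0 0 A F (fun z => Path 0 S z w) (fun a b =>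
        SigElim 0 0 A F (fun w => Path 0 S (mk a b) w) (fun a' b' =>
          sp ⬝ A ⬝ B ⬝ a ⬝ b ⬝ a' ⬝ (c ⬝ a ⬝ a') ⬝ b' ⬝
            (d ⬝ a' ⬝ Transport 0 0 A B a a' (c ⬝ a ⬝ a') b ⬝ b')) w) z)
    (by decide +kernel) holds_sigPath

/-- Uniqueness of identity proofs passes to dependent sums. -/
def UIPSig : Tm :=
  Pi (U 0) fun A => Pi (Arr A (U 0)) fun B =>
    Arr (UIP 0 A) <| Arr (Pi A fun x => UIP 0 (B ⬝ x)) (UIP 0 (Sig 0 A fun x => B ⬝ x))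

/-- The relation between `z` and `w` is the type of pairs of a path between the first projections and
a path over it between the second projections. -/
theorem holds_uipSig : Holds UIPSig :=
  implies_of_checks [UIPOfRel 0, SigPath, AllPathsSig]
    (Lam (UIPOfRel 0) fun ur => Lam SigPath fun sp => Lam AllPathsSig fun as =>
      Lam (U 0) fun A => Lam (Arr A (U 0)) fun B =>
      Lam (UIP 0 A) fun c => Lam (Pi A fun x => UIP 0 (B ⬝ x)) fun d =>
      let F := fun x => B ⬝ x
      let S := Sig 0 A F
      let mk := fun a b => Pair 0 A F a b
      let p1 := fun z => Fst 0 A F z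
      let p2 := fun z => Snd 0 A F z
      let Q := fun z w p =>
        Path 0 (B ⬝ p1 w) (Transport 0 0 A B (p1 z) (p1 w) p (p2 z)) (p2 w)
      let R := fun z w => Sig 0 (Path 0 A (p1 z) (p1 w)) (Q z w)
      let Q' := fun a b a' b' p => Path 0 (B ⬝ a') (Transport 0 0 A B a a' p b) b'
      ur ⬝ S ⬝ (Lam S fun z => Lam S fun w => R z w) ⬝
        (Lam S fun z => Lam S fun w =>
          as ⬝ Path 0 A (p1 z) (p1 w) ⬝ Lam (Path 0 A (p1 z) (p1 w)) (Q z w) ⬝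
            (c ⬝ p1 z ⬝ p1 w) ⬝ (Lam (Path 0 A (p1 z) (p1 w)) fun p =>
              d ⬝ p1 w ⬝ Transport 0 0 A B (p1 z) (p1 w) p (p2 z) ⬝ p2 w)) ⬝
        (Lam S fun z => Pair 0 (Path 0 A (p1 z) (p1 z)) (Q z z) (Refl 0 A (p1 z))
          (Refl 0 (B ⬝ p1 z) (p2 z))) ⬝
        (Lam S fun z => Lam S fun w =>
          SigElim 0 0 A F (fun z => Arr (R z w) (Path 0 S z w)) (fun a b =>
            SigElim 0 0 A F (fun w => Arr (R (mk a b) w) (Path 0 S (mk a b) w)) (fun a' b' =>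
              Lam (Sig 0 (Path 0 A a a') (Q' a b a' b')) fun h =>
              SigElim 0 0 (Path 0 A a a') (Q' a b a' b') (fun _ => Path 0 S (mk a b) (mk a' b'))
                (fun p q => sp ⬝ A ⬝ B ⬝ a ⬝ b ⬝ a' ⬝ p ⬝ b' ⬝ q) h) w) z))
    (by decide +kernel) (holds_uipOfRel 0) holds_sigPath holds_allPathsSig

/-- Uniqueness of identity proofs passes to types of equivalences. -/
def UIPEquiv : Tm :=
  Pi (U 0) fun A => Pi (U 0) fun B => Arr (UIP 0 A) <| Arr (UIP 0 B) (UIP 0 (Equiv 0 A B))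

theorem holds_uipEquiv : Holds UIPEquiv :=
  implies_of_checks [UIPOfAllPaths, UIPPi, UIPSig]
    (Lam UIPOfAllPaths fun ua => Lam UIPPi fun up => Lam UIPSig fun us =>
      Lam (U 0) fun A => Lam (U 0) fun B => Lam (UIP 0 A) fun c => Lam (UIP 0 B) fun d =>
      let F := up ⬝ A ⬝ (Lam A fun _ => B) ⬝ (Lam A fun _ => d)
      let G := up ⬝ B ⬝ (Lam B fun _ => A) ⬝ (Lam B fun _ => c)
      us ⬝ Arr A B ⬝ (Lam (Arr A B) fun g => IsEquiv 0 A B g) ⬝ F ⬝ (Lam (Arr A B) fun g =>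
        us ⬝ LInv 0 A B g ⬝ (Lam (LInv 0 A B g) fun _ => RInv 0 A B g) ⬝
          (us ⬝ Arr B A ⬝ (Lam (Arr B A) fun h => Pi A fun x => Path 0 A (h ⬝ (g ⬝ x)) x) ⬝ G ⬝
            (Lam (Arr B A) fun h => up ⬝ A ⬝ (Lam A fun x => Path 0 A (h ⬝ (g ⬝ x)) x) ⬝
              (Lam A fun x =>
                ua ⬝ Path 0 A (h ⬝ (g ⬝ x)) x ⬝ (c ⬝ (h ⬝ (g ⬝ x)) ⬝ x)))) ⬝
          (Lam (LInv 0 A B g) fun _ =>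
            (us ⬝ Arr B A ⬝ (Lam (Arr B A) fun h => Pi B fun y => Path 0 B (g ⬝ (h ⬝ y)) y) ⬝ G ⬝
              (Lam (Arr B A) fun h => up ⬝ B ⬝ (Lam B fun y => Path 0 B (g ⬝ (h ⬝ y)) y) ⬝
                (Lam B fun y =>
                  ua ⬝ Path 0 B (g ⬝ (h ⬝ y)) y ⬝ (d ⬝ (g ⬝ (h ⬝ y)) ⬝ y)))))))
    (by decide +kernel) holds_uipOfAllPaths holds_uipPi holds_uipSig

/-- Uniqueness of identity proofs is itself a property: `UIP A` has at most one element. -/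
def AllPathsUIP : Tm := Pi (U 0) fun A => AllPaths 0 (UIP 0 A)

theorem holds_allPathsUIP : Holds AllPathsUIP :=
  implies_of_checks [UIPOfAllPaths, FunExt]
    (Lam UIPOfAllPaths fun ua => Lam FunExt fun fe => Lam (U 0) fun A =>
      Lam (UIP 0 A) fun s => Lam (UIP 0 A) fun t =>
      let P := fun x y => Path 0 A x y
      fe ⬝ A ⬝ (Lam A fun x => Pi A fun y => AllPaths 0 (P x y)) ⬝ s ⬝ t ⬝ Lam A fun x =>
      fe ⬝ A ⬝ (Lam A fun y => AllPaths 0 (P x y)) ⬝ (s ⬝ x) ⬝ (t ⬝ x) ⬝ Lam A fun y =>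
      fe ⬝ P x y ⬝ (Lam (P x y) fun p => Pi (P x y) fun q => Path 0 (P x y) p q) ⬝
        (s ⬝ x ⬝ y) ⬝ (t ⬝ x ⬝ y) ⬝ Lam (P x y) fun p =>
      fe ⬝ P x y ⬝ (Lam (P x y) fun q => Path 0 (P x y) p q) ⬝
        (s ⬝ x ⬝ y ⬝ p) ⬝ (t ⬝ x ⬝ y ⬝ p) ⬝ Lam (P x y) fun q =>
      ua ⬝ P x y ⬝ (s ⬝ x ⬝ y) ⬝ p ⬝ q ⬝ (s ⬝ x ⬝ y ⬝ p ⬝ q) ⬝ (t ⬝ x ⬝ y ⬝ p ⬝ q))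
    (by decide +kernel) holds_uipOfAllPaths holds_funExt

/-! ### The type of sets -/

/-- The type `Σ (A : U 0), UIP A` of sets. -/
def Sets : Tm := Sig 1 (U 0) (UIP 0)

/-- The set with underlying type `A` and proof `s` of `UIP A`. -/
def mkSet (A s : Tm) : Tm := Pair 1 (U 0) (UIP 0) A s

/-- The underlying type of a set. -/
def carrier (t : Tm) : Tm := Fst 1 (U 0) (UIP 0) t

/-- The function `A → carrier t` given by a path `l : (A, s) = t` in `Sets`. -/
def Cast (A s t l : Tm) : Tm :=
  J 1 0 Sets (mkSet A s) (fun t' _ => Arr A (carrier t')) (IdFun A) t l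

/-- An equivalence between sets is the cast along a path in `Sets`. -/
def PathOfEquiv : Tm :=
  Pi (U 0) fun A => Pi (UIP 0 A) fun s => Pi (U 0) fun B => Pi (Arr A B) fun g =>
    Arr (IsEquiv 0 A B g) <| Pi (UIP 0 B) fun t =>
    Sig 1 (Path 1 Sets (mkSet A s) (mkSet B t)) fun l =>
      Pi A fun x => Path 0 B (Cast A s (mkSet B t) l ⬝ x) (g ⬝ x)

theorem holds_pathOfEquiv : Holds PathOfEquiv :=
  implies_of_checks [IsEquivInd, AllPathsUIP]
    (Lam IsEquivInd fun ei => Lam AllPathsUIP fun uu =>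
      Lam (U 0) fun A => Lam (UIP 0 A) fun s =>
      let Q := fun B t g l => Pi A fun x => Path 0 B (Cast A s (mkSet B t) l ⬝ x) (g ⬝ x)
      ei ⬝ A ⬝
        (Lam (U 0) fun B => Lam (Arr A B) fun g => Pi (UIP 0 B) fun t =>
          Sig 1 (Path 1 Sets (mkSet A s) (mkSet B t)) (Q B t g)) ⬝
        (Lam (UIP 0 A) fun t => J 0 1 (UIP 0 A) s
          (fun t' _ => Sig 1 (Path 1 Sets (mkSet A s) (mkSet A t')) (Q A t' (IdFun A)))
          (Pair 1 (Path 1 Sets (mkSet A s) (mkSet A s)) (Q A s (IdFun A))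
            (Refl 1 Sets (mkSet A s)) (Lam A fun x => Refl 0 A x))
          t (uu ⬝ A ⬝ s ⬝ t)))
    (by decide +kernel) holds_isEquivInd holds_allPathsUIP

/-- `UIPPathOfRel` for `Σ (A : U 0), K A` and a relation `E` that depends on first components. -/
def UIPPathSig : Tm :=
  Pi (Arr (U 0) (U 0)) fun K => Pi (Arr (U 0) (Arr (U 0) (U 0))) fun E =>
    let S := Sig 1 (U 0) fun A => K ⬝ A
    let mk := fun A s => Pair 1 (U 0) (fun A => K ⬝ A) A s
    Arr (Pi (U 0) fun A => Arr (K ⬝ A) <| Pi (U 0) fun B => Arr (K ⬝ B) (UIP 0 (E ⬝ A ⬝ B))) <|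
    Arr (Pi (U 0) fun A => E ⬝ A ⬝ A) <|
    Arr (Pi (U 0) fun A => Pi (K ⬝ A) fun s => Pi (U 0) fun B => Pi (K ⬝ B) fun t =>
      Arr (E ⬝ A ⬝ B) (Path 1 S (mk A s) (mk B t))) <|
    Pi S fun z => Pi S fun w => UIP 1 (Path 1 S z w)

theorem holds_uipPathSig : Holds UIPPathSig :=
  implies_of_checks [UIPPathOfRel]
    (Lam UIPPathOfRel fun ur =>
      Lam (Arr (U 0) (U 0)) fun K => Lam (Arr (U 0) (Arr (U 0) (U 0))) fun E =>
      let F := fun A => K ⬝ A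
      let S := Sig 1 (U 0) F
      let mk := fun A s => Pair 1 (U 0) F A s
      let p1 := fun z => Fst 1 (U 0) F z
      let p2 := fun z => Snd 1 (U 0) F z
      let R := fun z w => E ⬝ p1 z ⬝ p1 w
      Lam (Pi (U 0) fun A => Arr (K ⬝ A) <|
        Pi (U 0) fun B => Arr (K ⬝ B) (UIP 0 (E ⬝ A ⬝ B))) fun c =>
      Lam (Pi (U 0) fun A => E ⬝ A ⬝ A) fun r =>
      Lam (Pi (U 0) fun A => Pi (K ⬝ A) fun s => Pi (U 0) fun B => Pi (K ⬝ B) fun t =>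
        Arr (E ⬝ A ⬝ B) (Path 1 S (mk A s) (mk B t))) fun d =>
      ur ⬝ S ⬝ (Lam S fun z => Lam S fun w => R z w) ⬝
        (Lam S fun z => Lam S fun w => c ⬝ p1 z ⬝ p2 z ⬝ p1 w ⬝ p2 w) ⬝
        (Lam S fun z => r ⬝ p1 z) ⬝
        (Lam S fun z => Lam S fun w =>
          SigElim 1 1 (U 0) F (fun z => Arr (R z w) (Path 1 S z w)) (fun A s =>
            SigElim 1 1 (U 0) F (fun w => Arr (E ⬝ A ⬝ p1 w) (Path 1 S (mk A s) w)) (fun B t =>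
              d ⬝ A ⬝ s ⬝ B ⬝ t) w) z))
    (by decide +kernel) holds_uipPathOfRel

/-- The path types of `Sets` satisfy uniqueness of identity proofs. -/
def UIPPathSets : Tm := Pi Sets fun z => Pi Sets fun w => UIP 1 (Path 1 Sets z w)

/-- The relation is the type of equivalences. -/
theorem holds_uipPathSets : Holds UIPPathSets :=
  implies_of_checks [UIPPathSig, UIPEquiv, PathOfEquiv]
    (Lam UIPPathSig fun ur => Lam UIPEquiv fun ue => Lam PathOfEquiv fun pe =>
      ur ⬝ (Lam (U 0) fun A => UIP 0 A) ⬝ (Lam (U 0) fun A => Lam (U 0) fun B => Equiv 0 A B) ⬝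
        (Lam (U 0) fun A => Lam (UIP 0 A) fun s => Lam (U 0) fun B => Lam (UIP 0 B) fun t =>
          ue ⬝ A ⬝ B ⬝ s ⬝ t) ⬝
        (Lam (U 0) fun A => IdEquiv 0 A) ⬝
        (Lam (U 0) fun A => Lam (UIP 0 A) fun s => Lam (U 0) fun B => Lam (UIP 0 B) fun t =>
          let P := Path 1 Sets (mkSet A s) (mkSet B t)
          Lam (Equiv 0 A B) fun e =>
          SigElim 0 1 (Arr A B) (fun g => IsEquiv 0 A B g) (fun _ => P) (fun g v =>
            Fst 1 P (fun l => Pi A fun x => Path 0 B (Cast A s (mkSet B t) l ⬝ x) (g ⬝ x))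
              (pe ⬝ A ⬝ s ⬝ B ⬝ g ⬝ v ⬝ t)) e))
    (by decide +kernel) holds_uipPathSig holds_uipEquiv holds_pathOfEquiv

/-- `Sets` is a `1`-type. -/
def IsTypeSets : Tm := IsType 1 3 Sets

theorem holds_isTypeSets : Holds IsTypeSets :=
  implies_of_checks [IsPropOfAllPaths 1, UIPPathSets]
    (Lam (IsPropOfAllPaths 1) fun ip => Lam UIPPathSets fun us => Lam Sets fun z => Lam Sets fun w =>
      let P := Path 1 Sets z w
      Lam P fun p => Lam P fun q => ip ⬝ Path 1 P p q ⬝ (us ⬝ z ⬝ w ⬝ p ⬝ q))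
    (by decide +kernel) (holds_isPropOfAllPaths 1) holds_uipPathSets

/-! ### A nontrivial loop in the type of sets -/

/-- The unit type. -/
def Unit1 : Tm := con .unit

/-- The type `1 + 1`. -/
def Two : Tm := con (.sum 0) ⬝ Unit1 ⬝ Unit1

/-- The left injection into `1 + 1`. -/
def inL (a : Tm) : Tm := con (.inl 0) ⬝ Unit1 ⬝ Unit1 ⬝ a

/-- The right injection into `1 + 1`. -/
def inR (a : Tm) : Tm := con (.inr 0) ⬝ Unit1 ⬝ Unit1 ⬝ a

/-- Case analysis on `x : 1 + 1`. -/
def TwoElim (j : ℕ) (P l r : Tm → Tm) (x : Tm) : Tm :=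
  con (.sumInd 0 j) ⬝ Unit1 ⬝ Unit1 ⬝ Lam Two P ⬝ Lam Unit1 l ⬝ Lam Unit1 r ⬝ x

/-- An element of any type `C` from `x : 0`. -/
def ExFalso (j : ℕ) (C x : Tm) : Tm := con (.emptyInd j) ⬝ (Lam Empty0 fun _ => C) ⬝ x

/-- The unit type has at most one element. -/
def AllPathsUnit : Tm := AllPaths 0 Unit1

theorem holds_allPathsUnit : Holds AllPathsUnit :=
  implies_of_checks []
    (Lam Unit1 fun x => con (.unitInd 0) ⬝ (Lam Unit1 fun y => Path 0 Unit1 x y) ⬝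
      (con (.unitInd 0) ⬝ (Lam Unit1 fun x => Path 0 Unit1 x (con .star)) ⬝
        Refl 0 Unit1 (con .star) ⬝ x))
    (by decide +kernel)

/-- The type expressing that `x : 1 + 1` lies in the left summand. -/
def isL (x : Tm) : Tm := TwoElim 1 (fun _ => U 0) (fun _ => Unit1) (fun _ => Empty0) x

/-- The type expressing that `x : 1 + 1` lies in the right summand. -/
def isR (x : Tm) : Tm := TwoElim 1 (fun _ => U 0) (fun _ => Empty0) (fun _ => Unit1) x

/-- `1 + 1` satisfies uniqueness of identity proofs. -/
def UIPTwo : Tm := UIP 0 Two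

/-- The relation says that `x` and `y` lie in the same summand. -/
theorem holds_uipTwo : Holds UIPTwo :=
  implies_of_checks [UIPOfRel 0, AllPathsUnit]
    (Lam (UIPOfRel 0) fun ur => Lam AllPathsUnit fun au =>
      let R := fun x y => TwoElim 1 (fun _ => U 0) (fun _ => isL y) (fun _ => isR y) x
      let ae := Lam Empty0 fun x => ExFalso 0 (Pi Empty0 fun y => Path 0 Empty0 x y) x
      let eq := fun c a b =>
        J 0 0 Unit1 a (fun b _ => Path 0 Two (c a) (c b)) (Refl 0 Two (c a)) b (au ⬝ a ⬝ b)
      ur ⬝ Two ⬝ (Lam Two fun x => Lam Two fun y => R x y) ⬝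
        (Lam Two fun x => Lam Two fun y => TwoElim 0 (fun x => AllPaths 0 (R x y))
          (fun _ => TwoElim 0 (fun y => AllPaths 0 (isL y)) (fun _ => au) (fun _ => ae) y)
          (fun _ => TwoElim 0 (fun y => AllPaths 0 (isR y)) (fun _ => ae) (fun _ => au) y) x) ⬝
        (Lam Two fun x => TwoElim 0 (fun x => R x x) (fun _ => con .star) (fun _ => con .star) x) ⬝
        (Lam Two fun x => Lam Two fun y => TwoElim 0 (fun x => Arr (R x y) (Path 0 Two x y))
          (fun a => TwoElim 0 (fun y => Arr (isL y) (Path 0 Two (inL a) y))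
            (fun b => Lam Unit1 fun _ => eq inL a b)
            (fun b => Lam Empty0 fun h => ExFalso 0 (Path 0 Two (inL a) (inR b)) h) y)
          (fun a => TwoElim 0 (fun y => Arr (isR y) (Path 0 Two (inR a) y))
            (fun b => Lam Empty0 fun h => ExFalso 0 (Path 0 Two (inR a) (inL b)) h)
            (fun b => Lam Unit1 fun _ => eq inR a b) y) x))
    (by decide +kernel) (holds_uipOfRel 0) holds_allPathsUnit

/-- The map that exchanges the two summands of `1 + 1`. -/
def swap : Tm := Lam Two fun x => TwoElim 0 (fun _ => Two) inR inL x

/-- `swap` is an equivalence. -/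
def IsEquivSwap : Tm := IsEquiv 0 Two Two swap

theorem holds_isEquivSwap : Holds IsEquivSwap :=
  implies_of_checks []
    (let H := Lam Two fun x => TwoElim 0 (fun x => Path 0 Two (swap ⬝ (swap ⬝ x)) x)
      (fun a => Refl 0 Two (inL a)) (fun a => Refl 0 Two (inR a)) x
    let Q := fun h => Pi Two fun x => Path 0 Two (h ⬝ (swap ⬝ x)) x
    let Q' := fun h => Pi Two fun x => Path 0 Two (swap ⬝ (h ⬝ x)) x
    Pair 0 (LInv 0 Two Two swap) (fun _ => RInv 0 Two Two swap)
      (Pair 0 (Arr Two Two) Q swap H) (Pair 0 (Arr Two Two) Q' swap H))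
    (by decide +kernel)

/-- Some point of `Sets` has a loop that is different from the constant one. -/
def NontrivialLoop : Tm :=
  Sig 1 Sets fun t => Sig 1 (Path 1 Sets t t) fun l =>
    Arr (Path 1 (Path 1 Sets t t) l (Refl 1 Sets t)) Empty0

/-- The point is `1 + 1` and the cast along the loop is `swap`. If the loop was constant, then
`inl ⋆` would be equal to `inr ⋆`. -/
theorem holds_nontrivialLoop : Holds NontrivialLoop :=
  implies_of_checks [PathOfEquiv, UIPTwo, IsEquivSwap]
    (Lam PathOfEquiv fun pe => Lam UIPTwo fun s => Lam IsEquivSwap fun w =>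
      let t := mkSet Two s
      let P := Path 1 Sets t t
      let N := fun t l => Arr (Path 1 (Path 1 Sets t t) l (Refl 1 Sets t)) Empty0
      SigElim 1 1 P (fun l => Pi Two fun x => Path 0 Two (Cast Two s t l ⬝ x) (swap ⬝ x))
        (fun _ => NontrivialLoop) (fun l H =>
          Pair 1 Sets (fun t => Sig 1 (Path 1 Sets t t) (N t)) t (Pair 1 P (N t) l (
            Lam (Path 1 P l (Refl 1 Sets t)) fun r =>
              J 0 0 Two (inL (con .star)) (fun y _ => isL y) (con .star) (inR (con .star))
                (J 1 0 P l
                  (fun l' _ => Path 0 Two (Cast Two s t l' ⬝ inL (con .star)) (inR (con .star)))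
                  (H ⬝ inL (con .star)) (Refl 1 Sets t) r))))
        (pe ⬝ Two ⬝ s ⬝ Two ⬝ swap ⬝ w ⬝ s))
    (by decide +kernel) holds_pathOfEquiv holds_uipTwo holds_isEquivSwap

/-! ### Maps out of the one-step truncation -/

/-- The transport of `u : T` along `p : x =_A y` in the constant family `T`. -/
def ConstTr (A T x y p u : Tm) : Tm := Transport 0 1 A (Lam A fun _ => T) x y p u

/-- The path from `u` to its transport in the constant family `T`. -/
def ConstTrPath (A T x y p u : Tm) : Tm :=
  J 0 1 A x (fun y' p' => Path 1 T u (ConstTr A T x y' p' u)) (Refl 1 T u) y p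

/-- If `apd_g(p)` is the composite of the canonical path `transport(p, g x) = g x` and `l`, then
`ap_g(p) = l`. -/
def ApOfApd : Tm :=
  Pi (U 0) fun A => Pi (U 1) fun T => Pi (Arr A T) fun g => Pi A fun x => Pi A fun y =>
    Pi (Path 0 A x y) fun p => Pi (Path 1 T (g ⬝ x) (g ⬝ y)) fun l =>
    Arr (Path 1 (Path 1 T (ConstTr A T x y p (g ⬝ x)) (g ⬝ y))
      (Apd 0 1 A (Lam A fun _ => T) g x y p)
      (Cmp 1 T (g ⬝ x) (ConstTr A T x y p (g ⬝ x)) (g ⬝ y) (ConstTrPath A T x y p (g ⬝ x)) l))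
    (Path 1 (Path 1 T (g ⬝ x) (g ⬝ y)) (Ap 0 1 A T g x y p) l)

theorem holds_apOfApd : Holds ApOfApd :=
  implies_of_checks []
    (Lam (U 0) fun A => Lam (U 1) fun T => Lam (Arr A T) fun g => Lam A fun x => Lam A fun y =>
      Lam (Path 0 A x y) fun p => J 0 1 A x (fun y p => Pi (Path 1 T (g ⬝ x) (g ⬝ y)) fun l =>
        Arr (Path 1 (Path 1 T (ConstTr A T x y p (g ⬝ x)) (g ⬝ y))
          (Apd 0 1 A (Lam A fun _ => T) g x y p)
          (Cmp 1 T (g ⬝ x) (ConstTr A T x y p (g ⬝ x)) (g ⬝ y) (ConstTrPath A T x y p (g ⬝ x)) l))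
        (Path 1 (Path 1 T (g ⬝ x) (g ⬝ y)) (Ap 0 1 A T g x y p) l))
      (Lam (Path 1 T (g ⬝ x) (g ⬝ x)) fun l =>
        Lam (Path 1 (Path 1 T (g ⬝ x) (g ⬝ x)) (Refl 1 T (g ⬝ x)) l) fun h => h) y p)
    (by decide +kernel)

/-- The function `G : {A} → T` maps none of the paths `e(a, a)` to a constant path. -/
def Nontrivial (A T G : Tm) : Tm :=
  Pi A fun a =>
    let x := OneF 0 A ⬝ a
    let P := Path 1 T (G ⬝ x) (G ⬝ x)
    Arr (Path 1 P (Ap 0 1 (One 0 A) T G x x (OneE 0 A a a)) (Refl 1 T (G ⬝ x))) Empty0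

/-- `G : {A} → T` is nontrivial if `apd_G(e(a, a))` comes from a nonconstant loop `l a`. -/
def NontrivialOfApd : Tm :=
  Pi (U 0) fun A => Pi (U 1) fun T => Pi (Arr (One 0 A) T) fun G =>
    let X := One 0 A
    let x := fun a => OneF 0 A ⬝ a
    let y := fun a => G ⬝ x a
    let p := fun a => OneE 0 A a a
    Pi (Pi A fun a => Path 1 T (y a) (y a)) fun l =>
    Arr (Pi A fun a => Arr (Path 1 (Path 1 T (y a) (y a)) (l ⬝ a) (Refl 1 T (y a))) Empty0) <|
    Arr (Pi A fun a =>
      Path 1 (Path 1 T (ConstTr X T (x a) (x a) (p a) (y a)) (y a))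
        (Apd 0 1 X (Lam X fun _ => T) G (x a) (x a) (p a))
        (Cmp 1 T (y a) (ConstTr X T (x a) (x a) (p a) (y a)) (y a)
          (ConstTrPath X T (x a) (x a) (p a) (y a)) (l ⬝ a)))
    (Nontrivial A T G)

theorem holds_nontrivialOfApd : Holds NontrivialOfApd :=
  implies_of_checks [ApOfApd]
    (Lam ApOfApd fun ac => Lam (U 0) fun A => Lam (U 1) fun T => Lam (Arr (One 0 A) T) fun G =>
      let X := One 0 A
      let x := fun a => OneF 0 A ⬝ a
      let y := fun a => G ⬝ x a
      let p := fun a => OneE 0 A a a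
      Lam (Pi A fun a => Path 1 T (y a) (y a)) fun l =>
      Lam (Pi A fun a =>
        Arr (Path 1 (Path 1 T (y a) (y a)) (l ⬝ a) (Refl 1 T (y a))) Empty0) fun n =>
      Lam (Pi A fun a =>
        Path 1 (Path 1 T (ConstTr X T (x a) (x a) (p a) (y a)) (y a))
          (Apd 0 1 X (Lam X fun _ => T) G (x a) (x a) (p a))
          (Cmp 1 T (y a) (ConstTr X T (x a) (x a) (p a) (y a)) (y a)
            (ConstTrPath X T (x a) (x a) (p a) (y a)) (l ⬝ a))) fun h =>
      Lam A fun a =>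
      let k := Ap 0 1 X T G (x a) (x a) (p a)
      Lam (Path 1 (Path 1 T (y a) (y a)) k (Refl 1 T (y a))) fun r =>
        n ⬝ a ⬝ Cmp 1 (Path 1 T (y a) (y a)) k (l ⬝ a) (Refl 1 T (y a))
          (ac ⬝ X ⬝ T ⬝ G ⬝ x a ⬝ x a ⬝ p a ⬝ (l ⬝ a) ⬝ (h ⬝ a)) r)
    (by decide +kernel) holds_apOfApd

/-- The data over the paths `e(a, b)` for an induction on `{A}` with value `g` at points. -/
def OneOver (A P g : Tm) : Tm :=
  Pi A fun a => Pi A fun b => Path 1 (P ⬝ (OneF 0 A ⬝ b))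
    (Transport 0 1 (One 0 A) P (OneF 0 A ⬝ a) (OneF 0 A ⬝ b) (OneE 0 A a b) (g ⬝ a)) (g ⬝ b)

/-- The function `{A} → T` with constant value `t` at points and data `q` over paths. -/
def OneRec (A T t q : Tm) : Tm :=
  con (.oneInd 0 1) ⬝ A ⬝ (Lam (One 0 A) fun _ => T) ⬝ (Lam A fun _ => t) ⬝ q

/-- `OneRec A T t q` is nontrivial if the data `q` come from a nonconstant loop `l`. -/
def NontrivialOneRec : Tm :=
  Pi (U 0) fun A => Pi (U 1) fun T => Pi T fun t => Pi (Path 1 T t t) fun l =>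
    Arr (Arr (Path 1 (Path 1 T t t) l (Refl 1 T t)) Empty0) <|
    let X := One 0 A
    Pi (OneOver A (Lam X fun _ => T) (Lam A fun _ => t)) fun q =>
    Arr (Pi A fun a =>
      let x := OneF 0 A ⬝ a
      let p := OneE 0 A a a
      Path 1 (Path 1 T (ConstTr X T x x p t) t) (q ⬝ a ⬝ a)
        (Cmp 1 T t (ConstTr X T x x p t) t (ConstTrPath X T x x p t) l))
    (Nontrivial A T (OneRec A T t q))

theorem holds_nontrivialOneRec : Holds NontrivialOneRec :=
  implies_of_checks [NontrivialOfApd]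
    (Lam NontrivialOfApd fun nt => Lam (U 0) fun A => Lam (U 1) fun T =>
      Lam T fun t => Lam (Path 1 T t t) fun l =>
      Lam (Arr (Path 1 (Path 1 T t t) l (Refl 1 T t)) Empty0) fun n =>
      let X := One 0 A
      let P := Lam X fun _ => T
      Lam (OneOver A P (Lam A fun _ => t)) fun q =>
      let x := fun a => OneF 0 A ⬝ a
      let p := fun a => OneE 0 A a a
      let Q := fun a => Path 1 T (ConstTr X T (x a) (x a) (p a) t) t
      let c := fun a => Cmp 1 T t (ConstTr X T (x a) (x a) (p a) t) t
        (ConstTrPath X T (x a) (x a) (p a) t) l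
      Lam (Pi A fun a => Path 1 (Q a) (q ⬝ a ⬝ a) (c a)) fun h =>
      let G := OneRec A T t q
      nt ⬝ A ⬝ T ⬝ G ⬝ (Lam A fun _ => l) ⬝ (Lam A fun _ => n) ⬝
        (Lam A fun a =>
          let d := Apd 0 1 X P G (x a) (x a) (p a)
          Cmp 1 (Q a) (q ⬝ a ⬝ a) d (c a)
            (Cmp 1 (Q a) d (q ⬝ a ⬝ a) d
              (con (.oneIndE 0 1) ⬝ A ⬝ P ⬝ (Lam A fun _ => t) ⬝ q ⬝ a ⬝ a) (Refl 1 (Q a) d))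
            (h ⬝ a)))
    (by decide +kernel) holds_nontrivialOfApd

/-- A nonconstant loop in `T` gives a nontrivial function `{A} → T`. -/
def NontrivialOfLoop : Tm :=
  Pi (U 0) fun A => Pi (U 1) fun T => Pi T fun t => Pi (Path 1 T t t) fun l =>
    Arr (Arr (Path 1 (Path 1 T t t) l (Refl 1 T t)) Empty0)
      (Sig 1 (Arr (One 0 A) T) fun G => Nontrivial A T G)

theorem holds_nontrivialOfLoop : Holds NontrivialOfLoop :=
  implies_of_checks [NontrivialOneRec]
    (Lam NontrivialOneRec fun re => Lam (U 0) fun A => Lam (U 1) fun T =>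
      Lam T fun t => Lam (Path 1 T t t) fun l =>
      Lam (Arr (Path 1 (Path 1 T t t) l (Refl 1 T t)) Empty0) fun n =>
      let X := One 0 A
      let x := fun a => OneF 0 A ⬝ a
      let tr := fun a b => ConstTr X T (x a) (x b) (OneE 0 A a b) t
      let C := fun a b => Cmp 1 T t (tr a b) t (ConstTrPath X T (x a) (x b) (OneE 0 A a b) t) l
      let q := Lam A fun a => Lam A fun b => C a b
      Pair 1 (Arr X T) (fun G => Nontrivial A T G) (OneRec A T t q)
        (re ⬝ A ⬝ T ⬝ t ⬝ l ⬝ n ⬝ q ⬝ Lam A fun a => Refl 1 (Path 1 T (tr a a) t) (C a a)))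
    (by decide +kernel) holds_nontrivialOneRec

/-- There is a nontrivial function `{A} → Sets`. -/
def NontrivialSets : Tm :=
  Pi (U 0) fun A => Sig 1 (Arr (One 0 A) Sets) fun G => Nontrivial A Sets G

theorem holds_nontrivialSets : Holds NontrivialSets :=
  implies_of_checks [NontrivialLoop, NontrivialOfLoop]
    (Lam NontrivialLoop fun lp => Lam NontrivialOfLoop fun cv => Lam (U 0) fun A =>
      let N := fun t l => Arr (Path 1 (Path 1 Sets t t) l (Refl 1 Sets t)) Empty0
      let S := Sig 1 (Arr (One 0 A) Sets) fun G => Nontrivial A Sets G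
      SigElim 1 1 Sets (fun t => Sig 1 (Path 1 Sets t t) (N t)) (fun _ => S) (fun t y =>
        SigElim 1 1 (Path 1 Sets t t) (N t) (fun _ => S) (fun l n =>
          cv ⬝ A ⬝ Sets ⬝ t ⬝ l ⬝ n) y) lp)
    (by decide +kernel) holds_nontrivialLoop holds_nontrivialOfLoop

/-! ### The paths `e(a, b)`, and the `1`-truncation of the one-step truncation -/

/-- `ap_f(p) ≠ e(a, b)`. -/
def ApNe : Tm :=
  Pi (U 0) fun A => Pi A fun a => Pi A fun b => Pi (Path 0 A a b) fun p =>
    Arr (Path 0 (Path 0 (One 0 A) (OneF 0 A ⬝ a) (OneF 0 A ⬝ b))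
      (Ap 0 0 A (One 0 A) (OneF 0 A) a b p) (OneE 0 A a b)) Empty0

/-- By path induction `p` is `refl`, so that `ap_f(p)` is `refl`; but a nontrivial function does not
map `e(a, a)` to a constant path. -/
theorem holds_apNe : Holds ApNe :=
  implies_of_checks [NontrivialSets]
    (Lam NontrivialSets fun cs =>
      Lam (U 0) fun A => Lam A fun a => Lam A fun b => Lam (Path 0 A a b) fun p =>
      let X := One 0 A
      let x := fun a => OneF 0 A ⬝ a
      let L := fun b => Path 0 X (x a) (x b)
      J 0 0 A a (fun b p => Arr (Path 0 (L b) (Ap 0 0 A X (OneF 0 A) a b p) (OneE 0 A a b)) Empty0)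
        (Lam (Path 0 (L a) (Refl 0 X (x a)) (OneE 0 A a a)) fun r =>
          SigElim 1 0 (Arr X Sets) (fun G => Nontrivial A Sets G) (fun _ => Empty0) (fun G n =>
            let P := Path 1 Sets (G ⬝ x a) (G ⬝ x a)
            let c := Refl 1 Sets (G ⬝ x a)
            n ⬝ a ⬝ J 0 1 (L a) (Refl 0 X (x a))
              (fun y _ => Path 1 P (Ap 0 1 X Sets G (x a) (x a) y) c)
              (Refl 1 P c) (OneE 0 A a a) r) (cs ⬝ A)) b p)
    (by decide +kernel) holds_nontrivialSets

/-- If `A` is inhabited and `{A}` has a nontrivial function to a `1`-type `T`, then `‖{A}‖_1` does not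
satisfy uniqueness of identity proofs. The constant family `T` is given by its values, as the
induction principle of the truncation asks for. -/
def NotUIPOfNontrivial : Tm :=
  Pi (U 0) fun A => Pi (U 1) fun T =>
    let X := One 0 A
    let Y := Trunc 1 0 X
    Arr (Pi Y fun y => IsType 1 3 (Lam Y (fun _ => T) ⬝ y)) <|
    Pi (Arr X T) fun G => Arr (Nontrivial A T G) <| Arr A <| Arr (UIP 0 Y) Empty0

/-- The function `G` extends to `k : ‖{A}‖_1 → T`. The image of `e(a, a)` under `G` is that of
`ap_m(e(a, a))` under `k`, where `m : {A} → ‖{A}‖_1`. If this loop was equal to `refl`, then `G`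
would map `e(a, a)` to a constant path. -/
theorem holds_notUIPOfNontrivial : Holds NotUIPOfNontrivial :=
  implies_of_checks []
    (Lam (U 0) fun A => Lam (U 1) fun T =>
      let X := One 0 A
      let Y := Trunc 1 0 X
      Lam (Pi Y fun y => IsType 1 3 (Lam Y (fun _ => T) ⬝ y)) fun it => Lam (Arr X T) fun G =>
      Lam (Nontrivial A T G) fun n => Lam A fun a => Lam (UIP 0 Y) fun h =>
      let k := con (.trInd 1 0 1) ⬝ X ⬝ (Lam Y fun _ => T) ⬝ it ⬝ G
      let m := con (.trMk 1 0) ⬝ X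
      let x := OneF 0 A ⬝ a
      let p := OneE 0 A a a
      let P := Path 1 T (G ⬝ x) (G ⬝ x)
      let c := Refl 1 T (G ⬝ x)
      let mp := Ap 0 0 X Y m x x p
      n ⬝ a ⬝ Cmp 1 P (Ap 0 1 Y T k (m ⬝ x) (m ⬝ x) mp) (Ap 0 1 X T G x x p) c
        (J 0 1 X x (fun y p => Path 1 (Path 1 T (G ⬝ x) (G ⬝ y))
          (Ap 0 1 Y T k (m ⬝ x) (m ⬝ y) (Ap 0 0 X Y m x y p)) (Ap 0 1 X T G x y p))
          (Refl 1 P c) x p)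
        (J 0 1 (Path 0 Y (m ⬝ x) (m ⬝ x)) (Refl 0 Y (m ⬝ x))
          (fun y _ => Path 1 P (Ap 0 1 Y T k (m ⬝ x) (m ⬝ x) y) c) (Refl 1 P c) mp
          (h ⬝ (m ⬝ x) ⬝ (m ⬝ x) ⬝ Refl 0 Y (m ⬝ x) ⬝ mp)))
    (by decide +kernel)

/-- If `A` is inhabited, then `‖{A}‖_1` does not satisfy uniqueness of identity proofs. -/
def NotUIP : Tm := Pi (U 0) fun A => Arr A <| Arr (UIP 0 (Trunc 1 0 (One 0 A))) Empty0

theorem holds_notUIP : Holds NotUIP :=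
  implies_of_checks [NontrivialSets, IsTypeSets, NotUIPOfNontrivial]
    (Lam NontrivialSets fun cs => Lam IsTypeSets fun it => Lam NotUIPOfNontrivial fun nu =>
      Lam (U 0) fun A =>
      let X := One 0 A
      let Y := Trunc 1 0 X
      SigElim 1 0 (Arr X Sets) (fun G => Nontrivial A Sets G)
        (fun _ => Arr A <| Arr (UIP 0 Y) Empty0)
        (fun G n => nu ⬝ A ⬝ Sets ⬝
          (Lam Y fun y => J 2 1 (U 1) Sets (fun Z _ => IsType 1 3 Z) it (Lam Y (fun _ => Sets) ⬝ y)
            (Refl 2 (U 1) Sets)) ⬝ G ⬝ n) (cs ⬝ A))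
    (by decide +kernel) holds_nontrivialSets holds_isTypeSets holds_notUIPOfNontrivial

/-- The empty type is a `1`-type. -/
def IsTypeEmpty : Tm := IsType 0 3 Empty0

theorem holds_isTypeEmpty : Holds IsTypeEmpty :=
  implies_of_checks []
    (Lam Empty0 fun x => ExFalso 0 (Pi Empty0 fun y => IsType 0 2 (Path 0 Empty0 x y)) x)
    (by decide +kernel)

/-- If `‖{A}‖_1` is a set, then it is empty. -/
def EmptyOfIsSet : Tm :=
  Pi (U 0) fun A => Arr (IsSet 0 (Trunc 1 0 (One 0 A))) (Arr (Trunc 1 0 (One 0 A)) Empty0)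

theorem holds_emptyOfIsSet : Holds EmptyOfIsSet :=
  implies_of_checks [NotUIP, UIPOfIsSet, IsTypeEmpty]
    (Lam NotUIP fun nu => Lam UIPOfIsSet fun us => Lam IsTypeEmpty fun te => Lam (U 0) fun A =>
      let X := One 0 A
      let Y := Trunc 1 0 X
      let P := Lam X fun _ => Empty0
      Lam (IsSet 0 Y) fun h =>
      let n := fun a => nu ⬝ A ⬝ a ⬝ (us ⬝ Y ⬝ h)
      con (.trInd 1 0 0) ⬝ X ⬝ (Lam Y fun _ => Empty0) ⬝ (Lam Y fun _ => te) ⬝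
        (Lam X fun u => con (.oneInd 0 0) ⬝ A ⬝ P ⬝ (Lam A fun a => n a) ⬝
          (Lam A fun a => Lam A fun b => ExFalso 0
            (Path 0 Empty0
              (Transport 0 0 X P (OneF 0 A ⬝ a) (OneF 0 A ⬝ b) (OneE 0 A a b) (n a)) (n b))
            (n a)) ⬝ u))
    (by decide +kernel) holds_notUIP holds_uipOfIsSet holds_isTypeEmpty

/-- `‖{A}‖_1` is not contractible. -/
def NotIsContr : Tm := Pi (U 0) fun A => Arr (IsContr 0 (Trunc 1 0 (One 0 A))) Empty0

theorem holds_notIsContr : Holds NotIsContr :=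
  implies_of_checks [EmptyOfIsSet, AllPathsOfIsContr, UIPOfAllPaths, IsSetOfUIP]
    (Lam EmptyOfIsSet fun es => Lam AllPathsOfIsContr fun ac => Lam UIPOfAllPaths fun ua =>
      Lam IsSetOfUIP fun su => Lam (U 0) fun A =>
      let Y := Trunc 1 0 (One 0 A)
      Lam (IsContr 0 Y) fun h => es ⬝ A ⬝ (su ⬝ Y ⬝ (ua ⬝ Y ⬝ (ac ⬝ Y ⬝ h))) ⬝
        Fst 0 Y (fun x => Pi Y fun y => Path 0 Y x y) h)
    (by decide +kernel) holds_emptyOfIsSet holds_allPathsOfIsContr holds_uipOfAllPaths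
    holds_isSetOfUIP

/-! ### The `0`-truncation of the one-step truncation -/

/-- Induction on `{A}` into families with at most one element. -/
def OneElim : Tm :=
  Pi (U 0) fun A => Pi (Arr (One 0 A) (U 0)) fun P =>
    Arr (Pi (One 0 A) fun u => AllPaths 0 (P ⬝ u)) <|
    Arr (Pi A fun a => P ⬝ (OneF 0 A ⬝ a)) (Pi (One 0 A) fun u => P ⬝ u)

theorem holds_oneElim : Holds OneElim :=
  implies_of_checks []
    (Lam (U 0) fun A => Lam (Arr (One 0 A) (U 0)) fun P =>
      Lam (Pi (One 0 A) fun u => AllPaths 0 (P ⬝ u)) fun c =>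
      Lam (Pi A fun a => P ⬝ (OneF 0 A ⬝ a)) fun g =>
      con (.oneInd 0 0) ⬝ A ⬝ P ⬝ g ⬝ (Lam A fun a => Lam A fun b => c ⬝ (OneF 0 A ⬝ b) ⬝
        Transport 0 0 (One 0 A) P (OneF 0 A ⬝ a) (OneF 0 A ⬝ b) (OneE 0 A a b) (g ⬝ a) ⬝ (g ⬝ b)))
    (by decide +kernel)

/-- Induction on `‖X‖_0` into families with at most one element. -/
def TruncElim : Tm :=
  Pi (U 0) fun X => Pi (Arr (Trunc 0 0 X) (U 0)) fun P =>
    Arr (Pi (Trunc 0 0 X) fun u => AllPaths 0 (P ⬝ u)) <|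
    Arr (Pi X fun u => P ⬝ (con (.trMk 0 0) ⬝ X ⬝ u)) (Pi (Trunc 0 0 X) fun u => P ⬝ u)

theorem holds_truncElim : Holds TruncElim :=
  implies_of_checks [UIPOfAllPaths, IsSetOfUIP]
    (Lam UIPOfAllPaths fun ua => Lam IsSetOfUIP fun su => Lam (U 0) fun X =>
      Lam (Arr (Trunc 0 0 X) (U 0)) fun P =>
      Lam (Pi (Trunc 0 0 X) fun u => AllPaths 0 (P ⬝ u)) fun c =>
      con (.trInd 0 0 0) ⬝ X ⬝ P ⬝
        (Lam (Trunc 0 0 X) fun u => su ⬝ (P ⬝ u) ⬝ (ua ⬝ (P ⬝ u) ⬝ (c ⬝ u))))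
    (by decide +kernel) holds_uipOfAllPaths holds_isSetOfUIP

/-- `‖{A}‖_0` has at most one element. -/
def AllPathsTrunc : Tm := Pi (U 0) fun A => AllPaths 0 (Trunc 0 0 (One 0 A))

theorem holds_allPathsTrunc : Holds AllPathsTrunc :=
  implies_of_checks [UIPOfIsSet, OneElim, TruncElim]
    (Lam UIPOfIsSet fun us => Lam OneElim fun oe => Lam TruncElim fun te => Lam (U 0) fun A =>
      let X := One 0 A
      let Y := Trunc 0 0 X
      let m := con (.trMk 0 0) ⬝ X
      let x := fun a => OneF 0 A ⬝ a
      let s := us ⬝ Y ⬝ (con (.trTrunc 0 0) ⬝ X)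
      Lam Y fun z => Lam Y fun w =>
      te ⬝ X ⬝ (Lam Y fun z => Path 0 Y z w) ⬝ (Lam Y fun z => s ⬝ z ⬝ w) ⬝ (Lam X fun u =>
      te ⬝ X ⬝ (Lam Y fun w => Path 0 Y (m ⬝ u) w) ⬝ (Lam Y fun w => s ⬝ (m ⬝ u) ⬝ w) ⬝
        (Lam X fun v =>
      oe ⬝ A ⬝ (Lam X fun u => Path 0 Y (m ⬝ u) (m ⬝ v)) ⬝
        (Lam X fun u => s ⬝ (m ⬝ u) ⬝ (m ⬝ v)) ⬝ (Lam A fun a =>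
      oe ⬝ A ⬝ (Lam X fun v => Path 0 Y (m ⬝ x a) (m ⬝ v)) ⬝
        (Lam X fun v => s ⬝ (m ⬝ x a) ⬝ (m ⬝ v)) ⬝ (Lam A fun b =>
      Ap 0 0 X Y m (x a) (x b) (OneE 0 A a b)) ⬝ v) ⬝ u) ⬝ w) ⬝ z)
    (by decide +kernel) holds_uipOfIsSet holds_oneElim holds_truncElim

/-- Maps from `A` to types with at most one element extend to `‖A‖`. -/
def PTruncElim : Tm :=
  Pi (U 0) fun A => Pi (U 0) fun B => Arr (AllPaths 0 B) <| Arr (Arr A B) (Arr (PTrunc 0 A) B)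

theorem holds_pTruncElim : Holds PTruncElim :=
  implies_of_checks []
    (Lam (U 0) fun A => Lam (U 0) fun B => Lam (AllPaths 0 B) fun c => Lam (Arr A B) fun g =>
      let X := PTrunc 0 A
      let P := Lam X fun _ => B
      con (.ptrInd 0 0) ⬝ A ⬝ P ⬝ g ⬝
        (Lam X fun x => Lam X fun y => Lam B fun u => Lam B fun v =>
          c ⬝ Transport 0 0 X P x y (con (.ptrEps 0) ⬝ A ⬝ x ⬝ y) u ⬝ v))
    (by decide +kernel)

/-- The map `‖A‖ → ‖{A}‖_0`. -/
def TruncOfPTrunc : Tm := Pi (U 0) fun A => Arr (PTrunc 0 A) (Trunc 0 0 (One 0 A))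

theorem holds_truncOfPTrunc : Holds TruncOfPTrunc :=
  implies_of_checks [AllPathsTrunc, PTruncElim]
    (Lam AllPathsTrunc fun ap => Lam PTruncElim fun pe => Lam (U 0) fun A =>
      let X := One 0 A
      let Y := Trunc 0 0 X
      pe ⬝ A ⬝ Y ⬝ (ap ⬝ A) ⬝ Lam A fun a => con (.trMk 0 0) ⬝ X ⬝ (OneF 0 A ⬝ a))
    (by decide +kernel) holds_allPathsTrunc holds_pTruncElim

/-- The map `‖{A}‖_0 → ‖A‖`. -/
def PTruncOfTrunc : Tm := Pi (U 0) fun A => Arr (Trunc 0 0 (One 0 A)) (PTrunc 0 A)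

theorem holds_pTruncOfTrunc : Holds PTruncOfTrunc :=
  implies_of_checks [UIPOfAllPaths, IsSetOfUIP]
    (Lam UIPOfAllPaths fun ua => Lam IsSetOfUIP fun su => Lam (U 0) fun A =>
      let X := One 0 A
      let Y := Trunc 0 0 X
      let Z := PTrunc 0 A
      let mk := con (.ptrMk 0) ⬝ A
      let e := con (.ptrEps 0) ⬝ A
      con (.trInd 0 0 0) ⬝ X ⬝ (Lam Y fun _ => Z) ⬝ (Lam Y fun _ => su ⬝ Z ⬝ (ua ⬝ Z ⬝ e)) ⬝
        (con (.oneInd 0 0) ⬝ A ⬝ (Lam X fun _ => Z) ⬝ mk ⬝ (Lam A fun a => Lam A fun b =>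
          e ⬝ Transport 0 0 X (Lam X fun _ => Z) (OneF 0 A ⬝ a) (OneF 0 A ⬝ b) (OneE 0 A a b)
            (mk ⬝ a) ⬝ (mk ⬝ b))))
    (by decide +kernel) holds_uipOfAllPaths holds_isSetOfUIP

/-- `‖{A}‖_0 ≃ ‖A‖`. -/
def TruncEquivPTrunc : Tm := Pi (U 0) fun A => Equiv 0 (Trunc 0 0 (One 0 A)) (PTrunc 0 A)

theorem holds_truncEquivPTrunc : Holds TruncEquivPTrunc :=
  implies_of_checks [AllPathsTrunc, TruncOfPTrunc, PTruncOfTrunc]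
    (Lam AllPathsTrunc fun ap => Lam TruncOfPTrunc fun f => Lam PTruncOfTrunc fun g =>
      Lam (U 0) fun A =>
      let Y := Trunc 0 0 (One 0 A)
      let Z := PTrunc 0 A
      Pair 0 (Arr Y Z) (fun g => IsEquiv 0 Y Z g) (g ⬝ A)
        (Pair 0 (LInv 0 Y Z (g ⬝ A)) (fun _ => RInv 0 Y Z (g ⬝ A))
          (Pair 0 (Arr Z Y) (fun h => Pi Y fun x => Path 0 Y (h ⬝ (g ⬝ A ⬝ x)) x) (f ⬝ A)
            (Lam Y fun x => ap ⬝ A ⬝ (f ⬝ A ⬝ (g ⬝ A ⬝ x)) ⬝ x))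
          (Pair 0 (Arr Z Y) (fun h => Pi Z fun x => Path 0 Z (g ⬝ A ⬝ (h ⬝ x)) x) (f ⬝ A)
            (Lam Z fun x => con (.ptrEps 0) ⬝ A ⬝ (g ⬝ A ⬝ (f ⬝ A ⬝ x)) ⬝ x))))
    (by decide +kernel) holds_allPathsTrunc holds_truncOfPTrunc holds_pTruncOfTrunc

/-- `‖{A}‖_0` is a mere proposition. -/
def IsPropTrunc : Tm := Pi (U 0) fun A => IsProp 0 (Trunc 0 0 (One 0 A))

theorem holds_isPropTrunc : Holds IsPropTrunc :=
  implies_of_checks [AllPathsTrunc, IsPropOfAllPaths 0]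
    (Lam AllPathsTrunc fun ap => Lam (IsPropOfAllPaths 0) fun ip => Lam (U 0) fun A =>
      ip ⬝ Trunc 0 0 (One 0 A) ⬝ (ap ⬝ A))
    (by decide +kernel) holds_allPathsTrunc (holds_isPropOfAllPaths 0)

/-- `{A}` is connected if `A` is merely inhabited. -/
def IsContrOfPTrunc : Tm :=
  Pi (U 0) fun A => Arr (PTrunc 0 A) (IsContr 0 (Trunc 0 0 (One 0 A)))

theorem holds_isContrOfPTrunc : Holds IsContrOfPTrunc :=
  implies_of_checks [AllPathsTrunc, TruncOfPTrunc]
    (Lam AllPathsTrunc fun ap => Lam TruncOfPTrunc fun f => Lam (U 0) fun A =>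
      Lam (PTrunc 0 A) fun x =>
      let Y := Trunc 0 0 (One 0 A)
      Pair 0 Y (fun x => Pi Y fun y => Path 0 Y x y) (f ⬝ A ⬝ x) (ap ⬝ A ⬝ (f ⬝ A ⬝ x)))
    (by decide +kernel) holds_allPathsTrunc holds_truncOfPTrunc

/-- `{A}` is connected if `A` is inhabited. -/
def IsContrOfEl : Tm := Pi (U 0) fun A => Arr A (IsContr 0 (Trunc 0 0 (One 0 A)))

theorem holds_isContrOfEl : Holds IsContrOfEl :=
  implies_of_checks [IsContrOfPTrunc]
    (Lam IsContrOfPTrunc fun c => Lam (U 0) fun A => Lam A fun a =>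
      c ⬝ A ⬝ (con (.ptrMk 0) ⬝ A ⬝ a))
    (by decide +kernel) holds_isContrOfPTrunc

end HoTT

open HoTT in
theorem proposition3p2 (i : ℕ) :
    -- for all `a b : A` and `p : a = b`, the paths `ap_f(p)` and `e(a, b)` are different
    Holds (Pi (U i) fun A => Pi A fun a => Pi A fun b => Pi (Path i A a b) fun p =>
      Arr (Path i (Path i (One i A) (OneF i A ⬝ a) (OneF i A ⬝ b))
        (Ap i i A (One i A) (OneF i A) a b p) (OneE i A a b)) Empty0) ∧
    -- if `‖{A}‖_1` is a set, then it is empty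
    Holds (Pi (U i) fun A =>
      Arr (IsSet i (Trunc 1 i (One i A))) (Arr (Trunc 1 i (One i A)) Empty0)) ∧
    -- `{A}` is not simply connected
    Holds (Pi (U i) fun A => Arr (IsContr i (Trunc 1 i (One i A))) Empty0) ∧
    -- `‖{A}‖_0 ≃ ‖A‖`
    Holds (Pi (U i) fun A => Equiv i (Trunc 0 i (One i A)) (PTrunc i A)) ∧
    -- `‖{A}‖_0` is a mere proposition
    Holds (Pi (U i) fun A => IsProp i (Trunc 0 i (One i A))) ∧
    -- if `A` is (merely) inhabited, then `{A}` is connected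
    Holds (Pi (U i) fun A => Arr A (IsContr i (Trunc 0 i (One i A)))) ∧
    Holds (Pi (U i) fun A => Arr (PTrunc i A) (IsContr i (Trunc 0 i (One i A)))) :=
  ⟨holds_apNe.raise i rfl, holds_emptyOfIsSet.raise i rfl, holds_notIsContr.raise i rfl,
    holds_truncEquivPTrunc.raise i rfl, holds_isPropTrunc.raise i rfl,
    holds_isContrOfEl.raise i rfl, holds_isContrOfPTrunc.raise i rfl⟩
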